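/- **Hypergraphs.** A hypergraph $S$ consists of pairwise disjoint finite sets $S_k$ ($k\in\omega$) of faces of dimension $k$, only finitely many of them non-empty, together with, for each $k$, a function $\gamma:S_{k+1}\sqcup 1_{S_k}\to S_k$ and a total relation $\delta$ from $S_{k+1}\sqcup 1_{S_k}$ to $S_k\sqcup 1_{S_{k-1}}$. Here $1_{S_{k-1}}=\{1_u : u\in S_{k-1}\}$ is the set of empty faces of dimension $k$, $S_{-1}=\emptyset$, and $\delta(a)$ denotes the set of all cells related to $a$. Each $\delta(a)$ is either a singleton or a non-empty subset of $S_k$, and for $k=0$ it is a singleton. Singletons are identified with their elements. For a set $A$ of cells put $\delta(A)=\bigcup_{a\in A}\delta(a)$ and $\gamma(A)=\{\gamma(a):a\in A\}$. For $a\in S_{k+1}$ put $\theta(a)=\delta(a)\cup\{\gamma(a)\}$, and let $\dot\delta(a)$, $\dot\theta(a)$ be the sets of non-empty faces in $\delta(a)$, $\theta(a)$. The face $a$ is a *loop* if $\delta(a)=\{\gamma(a)\}$ and an *empty domain face* if $\delta(a)=1_u$ for some $u$ (faces of dimension $0$ are neither). For a family $A$ of faces, $A^\lambda$ and $A^{-\lambda}$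 are the sets of loops and of non-loops in $A$; $\dot\delta^{-\lambda}(a)$ is the set of non-loops in $\dot\delta(a)$. For $a$ of dimension $\ge 2$, $\iota(a)$ is the set of faces $x$ such that $\gamma(b)=x\in\delta(c)$ for some $b,c\in\dot\delta^{-\lambda}(a)$. On $S_k$ let $<^+$ be the transitive closure of the relation "$a\in\delta(\alpha)$ and $\gamma(\alpha)=b$ for some non-loop $\alpha\in S_{k+1}$", and let $<^-$ be the transitive closure of "$\gamma(a)\in\delta(b)$" if $k>0$ and empty if $k=0$. For a relation $<^{r}$ write $a\perp^{r}b$ if $a<^{r}b$ or $b<^{r}a$. For sets $A,B$ of cells of the same dimension write $A\equiv_1B$ if $A\cup\{1_y : y\in\dot\theta(x),\ x\in A \text{ a non-empty face}\}=B\cup\{1_y : y\in\dot\theta(x),\ x\in B\text{ a non-empty face}\}$ (with nothing added in dimension $0$). **Ordered face structures.** An ordered face structure is a hypergraph $S$ with $S_0\neq\emptyset$ and with a binary relation $<^\sim$ on each $S_k$ such that: 1. (globularity) $\gamma\gamma(a)=\gamma\delta(a)-\delta\dot\delta^{-\lambda}(a)$ and $\delta\gamma(a)\equiv_1\delta\delta(a)-\gamma\dot\delta^{-\lambda}(a)$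 for every face $a$ of dimension $\ge2$; $\delta(1_a)=a=\gamma(1_a)$ for every face $a$; 2. (local discreteness) if $x,y\in\dot\delta(a)$, then not $x\perp^+y$; 3. (strictness) $<^+$ on $S_k$ and $<^\sim$ on $S_{k+1}$ are irreflexive and transitive for all $k$; $<^+$ on $S_0$ is linear; 4. (disjointness) on faces of positive dimension $\perp^\sim$ and $\perp^+$ are disjoint; $a<^\sim b$ implies $a<^-b$; if $a,b$ are of the same positive dimension and $\theta(a)\cap\theta(b)=\emptyset$, then $a<^\sim b$ iff $a<^-b$; 5. (pencil linearity) if $a\ne b$ and $\dot\theta(a)\cap\dot\theta(b)\neq\emptyset$, then $a\perp^\sim b$ or $a\perp^+b$; if $a$ is an empty domain face and $\gamma\gamma(a)\in\iota(b)$, then $a<^\sim b$ or $a<^+b$; 6. (loop filling) every loop is $\gamma(\alpha)$ for some non-loop $\alpha$. The *size* of $S$ is the sequence whose $n$-th term is $|S_n-\delta(S_{n+1}^{-\lambda})|$. Sequences of natural numbers are compared by: $x<y$ iff there is $k$ with $x_k<y_k$ and $x_l=y_l$ for all $l>k$. **Morphisms.** A monotone morphism $f:S\to T$ of ordered face structures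 is a family of maps $f_k:S_k\to T_k$ that preserves $\gamma$ and $<^\sim$ and restricts, for each face $a$ of positive dimension, to a bijection $\delta(a)\to\delta(f(a))$ (where $1_u\mapsto1_{f(u)}$). It is a monotone isomorphism if it has a two-sided inverse that is a monotone morphism, and an embedding if it is injective on faces. Its image is the family of sets $f_k(S_k)$. **Stretching.** Let $T$ be an ordered face structure. A convex subset $X$ of $T$ is a non-empty family of sets of faces of $T$ that is closed under $\gamma$ and $\delta$ (a subhypergraph) and whose own relation $<^{+}$ is the restriction of the relation $<^{+}$ of $T$ to $X$. Let $\mathcal E^X=X^\lambda-\gamma(X^{-\lambda})$ be the set of empty loops of $X$, and let $\mathcal E^X_x=\{a\in\mathcal E^X:\gamma(a)=x\}$ for $x\in X$. The faces of $[X]$ of dimension $k$ are the cuts $(x,L,U)$ with $x\in X_k$, $L\cup U=\mathcal E^X_x$ and $l<^\sim l'$ for all $l\in L$, $l'\in U$. Since one of $L$, $U$ determines the other, we may write "$-$" for one of them. Put $\uparrow a=\{b\in\mathcal E^X_{\gamma(a)}:a<^\sim b\}$ and $\downarrow_y a=\{b\in\mathcal E^X_y:b<^\sim a\}$. Then $$\gamma(x,L,U)=(\gamma(x),-,\uparrow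 x),$$ $$\delta(x,L,U)=1_{(\gamma\gamma(x),-,\uparrow\gamma(x))}\ \text{ if }\delta(x)=1_{\gamma\gamma(x)},\qquad \delta(x,L,U)=\{(t,\downarrow_t x,-):t\in\dot\delta(x)\}\ \text{ otherwise},$$ and $\gamma(1_c)=c=\delta(1_c)$ for every cut $c$. Also $(x,L,U)<^\sim(x',L',U')$ iff $x<^\sim x'$. Let $\nu_X:[X]\to T$ be $\nu_X(x,L,U)=x$. **Proposition.** Let $T$ be an ordered face structure and $X$ a convex subset of $T$. Then: 1. $[X]$ is an ordered face structure, and $\nu_X:[X]\to T$ is a monotone morphism with image $X$; 2. if $S_0,S_1$ are ordered face structures and $f_i:S_i\to T$, $i=0,1$, are monotone morphisms with equal images, then there is a unique monotone isomorphism $g:S_0\to S_1$ such that $f_1\circ g=f_0$; 3. $\mathcal E^X$ is empty if and only if $\nu_X$ is an embedding; 4. if $X\neq T$, then the size of $[X]$ is strictly smaller than the size of $T$. -/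

import Mathlib

universe u v w

namespace FaceStructures

/-- `Cell F k` is the disjoint sum `F_k ⊔ 1_{F_{k-1}}` (with `F_{-1} = ∅`): its elements are the
(non-empty) faces of dimension `k` and the empty faces `1_u` of dimension `k`, one for each face
`u` of dimension `k - 1`. -/
inductive Cell (F : ℕ → Type u) : ℕ → Type u
  | face {k : ℕ} (x : F k) : Cell F k
  | empty {k : ℕ} (x : F k) : Cell F (k + 1)

namespace Cell

/-- The map `f_k + 1_{f_{k-1}}` induced on cells by a family of maps on faces. -/
def map {F : ℕ → Type u} {G : ℕ → Type v} (f : ∀ k, F k → G k) : ∀ {k : ℕ}, Cell F k → Cell G k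
  | _, .face x => .face (f _ x)
  | _, .empty x => .empty (f _ x)

/-- A cell lies in a family `A` of sets of faces if it is a face in `A`, or the empty face on a
face in `A`. -/
def IsIn {F : ℕ → Type u} (A : ∀ k, Set (F k)) : ∀ {k : ℕ}, Cell F k → Prop
  | _, .face x => x ∈ A _
  | _, .empty x => x ∈ A _

end Cell

/-- A hypergraph: finitely many faces, graded by dimension, with codomain functions
`γ : S_{k+1} ⊔ 1_{S_k} → S_k` and total domain relations `δ` from `S_{k+1} ⊔ 1_{S_k}` to
`S_k ⊔ 1_{S_{k-1}}`. Each `δ a` is a singleton or a non-empty set of (non-empty) faces, and in the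
lowest dimension `δ` is a function. -/
structure Hypergraph where
  Face : ℕ → Type u
  finite_face : ∀ k, Finite (Face k)
  eventually_isEmpty : ∃ n, ∀ k, n ≤ k → IsEmpty (Face k)
  γ : ∀ {k : ℕ}, Cell Face (k + 1) → Face k
  δ : ∀ {k : ℕ}, Cell Face (k + 1) → Set (Cell Face k)
  δ_nonempty : ∀ {k : ℕ} (a : Cell Face (k + 1)), (δ a).Nonempty
  δ_cases : ∀ {k : ℕ} (a : Cell Face (k + 1)),
    (∃ x, δ a = {x}) ∨ δ a ⊆ Set.range Cell.face
  δ_zero : ∀ a : Cell Face 1, ∃ x, δ a = {x}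

namespace Hypergraph

variable (S : Hypergraph.{u})

/-- `γ(a)` for a face `a`. -/
def cod {k : ℕ} (a : S.Face (k + 1)) : S.Face k := S.γ (.face a)

/-- `δ(a)` for a face `a`. -/
def dom {k : ℕ} (a : S.Face (k + 1)) : Set (Cell S.Face k) := S.δ (.face a)

/-- `θ(a) = δ(a) ∪ γ(a)`. -/
def theta {k : ℕ} (a : S.Face (k + 1)) : Set (Cell S.Face k) := S.dom a ∪ {.face (S.cod a)}

/-- Loops: `δ(a) = γ(a)`. Faces of dimension `0` are not loops. -/
def IsLoop : ∀ {k : ℕ}, S.Face k → Prop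
  | 0, _ => False
  | _ + 1, a => S.dom a = {.face (S.cod a)}

/-- Empty domain faces: `δ(a) = 1_x` for some face `x`. In dimensions `0` and `1` there are none. -/
def IsEmptyDomain {k : ℕ} (a : S.Face (k + 2)) : Prop :=
  ∃ x : S.Face k, S.dom a = {.empty x}

/-- The set of those non-empty faces in `δ(a)` that are not loops. -/
def domNonloop {k : ℕ} (a : S.Face (k + 1)) : Set (S.Face k) :=
  {x | Cell.face x ∈ S.dom a ∧ ¬ S.IsLoop x}

/-- `δ(A)`, the union of `δ(a)` over the cells `a ∈ A`. -/
def domSet {k : ℕ} (A : Set (Cell S.Face (k + 1))) : Set (Cell S.Face k) := ⋃ a ∈ A, S.δ a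

/-- `γ(A)`, the set of the (non-empty) faces `γ(a)`, `a ∈ A`, as a set of cells. -/
def codSet {k : ℕ} (A : Set (Cell S.Face (k + 1))) : Set (Cell S.Face k) :=
  {c | ∃ a ∈ A, c = Cell.face (S.γ a)}

/-- The internal faces of `α`: those `x` with `γ(a) = x ∈ δ(b)` for some non-loops
`a, b ∈ δ(α)`. -/
def internal {k : ℕ} (α : S.Face (k + 2)) : Set (S.Face k) :=
  {x | ∃ a ∈ S.domNonloop α, ∃ b ∈ S.domNonloop α, S.cod a = x ∧ Cell.face x ∈ S.dom b}

/-- `1_{θ(A ∩ S)}`: the empty faces on the non-empty faces of codimension one in the non-empty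
faces of `A`. -/
def emptyOn : ∀ {k : ℕ}, Set (Cell S.Face k) → Set (Cell S.Face k)
  | 0, _ => ∅
  | k + 1, A => {c | ∃ x : S.Face (k + 1), Cell.face x ∈ A ∧
      ∃ y : S.Face k, Cell.face y ∈ S.theta x ∧ c = Cell.empty y}

/-- `A ≡₁ B`: `A` and `B` are equal up to empty faces on non-empty faces of codimension one. -/
def OneEq {k : ℕ} (A B : Set (Cell S.Face k)) : Prop := A ∪ S.emptyOn A = B ∪ S.emptyOn B

/-- The relation `<⁺` of the family `X` of sets of faces: the transitive closure of the relation
`a ◁ b` iff `a ∈ δ(α)` and `γ(α) = b` for some `α` in `X` that is not a loop. -/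
def upperIn (X : ∀ k, Set (S.Face k)) {k : ℕ} : S.Face k → S.Face k → Prop :=
  Relation.TransGen fun a b =>
    ∃ α ∈ X (k + 1), ¬ S.IsLoop α ∧ Cell.face a ∈ S.dom α ∧ S.cod α = b

/-- The upper order `<⁺`. -/
def upper {k : ℕ} : S.Face k → S.Face k → Prop :=
  Relation.TransGen fun a b =>
    ∃ α : S.Face (k + 1), ¬ S.IsLoop α ∧ Cell.face a ∈ S.dom α ∧ S.cod α = b

/-- The relation `<⁻`: empty in dimension `0`, and in positive dimensions the transitive closure
of the relation `γ(a) ∈ δ(b)`. -/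
def minus : ∀ {k : ℕ}, S.Face k → S.Face k → Prop
  | 0, _, _ => False
  | _ + 1, a, b => Relation.TransGen (fun a b => Cell.face (S.cod a) ∈ S.dom b) a b

/-- The `n`-th term of the size: the number of faces of dimension `n` that are not in the domain
of a non-loop. -/
noncomputable def size (n : ℕ) : ℕ :=
  {a : S.Face n | ¬ ∃ α : S.Face (n + 1), ¬ S.IsLoop α ∧ Cell.face a ∈ S.dom α}.ncard

end Hypergraph

/-- The order on sizes: `x < y` iff `x_k < y_k` for some `k` and `x_l = y_l` for all `l > k`. -/
def SizeLT (x y : ℕ → ℕ) : Prop := ∃ k, x k < y k ∧ ∀ l, k < l → x l = y l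

/-- A hypergraph with a binary relation `<^∼` on the faces of each dimension. -/
structure OrderedHypergraph extends Hypergraph.{u} where
  lower : ∀ {k : ℕ}, Face k → Face k → Prop

/-- Ordered face structures. -/
structure IsOrderedFaceStructure (S : OrderedHypergraph.{u}) : Prop where
  nonempty : Nonempty (S.Face 0)
  globularity_γ : ∀ {k : ℕ} (a : S.Face (k + 2)),
    {Cell.face (S.cod (S.cod a))} =
      S.codSet (S.dom a) \ S.domSet (Cell.face '' S.domNonloop a)
  globularity_δ : ∀ {k : ℕ} (a : S.Face (k + 2)),
    S.OneEq (S.dom (S.cod a))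
      (S.domSet (S.dom a) \ S.codSet (Cell.face '' S.domNonloop a))
  γ_empty : ∀ {k : ℕ} (a : S.Face k), S.γ (Cell.empty a) = a
  δ_empty : ∀ {k : ℕ} (a : S.Face k), S.δ (Cell.empty a) = {Cell.face a}
  local_discreteness : ∀ {k : ℕ} (a : S.Face (k + 1)) (x y : S.Face k),
    Cell.face x ∈ S.dom a → Cell.face y ∈ S.dom a → ¬ S.upper x y ∧ ¬ S.upper y x
  upper_irrefl : ∀ {k : ℕ} (a : S.Face k), ¬ S.upper a a
  upper_trans : ∀ {k : ℕ} (a b c : S.Face k), S.upper a b → S.upper b c → S.upper a c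
  lower_irrefl : ∀ {k : ℕ} (a : S.Face (k + 1)), ¬ S.lower a a
  lower_trans : ∀ {k : ℕ} (a b c : S.Face (k + 1)), S.lower a b → S.lower b c → S.lower a c
  upper_linear : ∀ a b : S.Face 0, a = b ∨ S.upper a b ∨ S.upper b a
  disjointness : ∀ {k : ℕ} (a b : S.Face (k + 1)),
    ¬ ((S.lower a b ∨ S.lower b a) ∧ (S.upper a b ∨ S.upper b a))
  lower_minus : ∀ {k : ℕ} (a b : S.Face k), S.lower a b → S.minus a b
  lower_iff_minus : ∀ {k : ℕ} (a b : S.Face (k + 1)), S.theta a ∩ S.theta b = ∅ →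
    (S.lower a b ↔ S.minus a b)
  pencil_linearity : ∀ {k : ℕ} (a b : S.Face (k + 1)), a ≠ b →
    (∃ x, Cell.face x ∈ S.theta a ∧ Cell.face x ∈ S.theta b) →
    (S.lower a b ∨ S.lower b a) ∨ (S.upper a b ∨ S.upper b a)
  pencil_linearity_internal : ∀ {k : ℕ} (a b : S.Face (k + 2)), S.IsEmptyDomain a →
    S.cod (S.cod a) ∈ S.internal b → S.lower a b ∨ S.upper a b
  loop_filling : ∀ {k : ℕ} (a : S.Face k), S.IsLoop a →
    ∃ α : S.Face (k + 1), ¬ S.IsLoop α ∧ S.cod α = a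

/-- A family of maps on faces is a morphism of hypergraphs if it commutes with `γ` and restricts,
for each face `a`, to a bijection from `δ(a)` to `δ(f(a))`. -/
structure IsHypergraphHom (S : Hypergraph.{u}) (T : Hypergraph.{v})
    (f : ∀ k, S.Face k → T.Face k) : Prop where
  map_cod : ∀ {k : ℕ} (a : S.Face (k + 1)), f k (S.cod a) = T.cod (f (k + 1) a)
  map_dom : ∀ {k : ℕ} (a : S.Face (k + 1)),
    Set.BijOn (Cell.map f) (S.dom a) (T.dom (f (k + 1) a))

/-- Monotone morphisms: morphisms of hypergraphs that preserve `<^∼`. -/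
structure IsMonotoneHom (S : OrderedHypergraph.{u}) (T : OrderedHypergraph.{v})
    (f : ∀ k, S.Face k → T.Face k) : Prop
    extends IsHypergraphHom S.toHypergraph T.toHypergraph f where
  map_lower : ∀ {k : ℕ} (a b : S.Face k), S.lower a b → T.lower (f k a) (f k b)

/-- Monotone isomorphisms: monotone morphisms with a two-sided monotone inverse. -/
def IsMonotoneIso (S : OrderedHypergraph.{u}) (T : OrderedHypergraph.{v})
    (f : ∀ k, S.Face k → T.Face k) : Prop :=
  IsMonotoneHom S T f ∧ ∃ g : ∀ k, T.Face k → S.Face k, IsMonotoneHom T S g ∧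
    (∀ k a, g k (f k a) = a) ∧ ∀ k b, f k (g k b) = b

/-- A subhypergraph: a family of sets of faces that is closed under `γ` and `δ`. -/
structure Subhypergraph (S : Hypergraph.{u}) where
  faces : ∀ k, Set (S.Face k)
  γ_mem : ∀ {k : ℕ} (a : Cell S.Face (k + 1)), a.IsIn faces → S.γ a ∈ faces k
  δ_mem : ∀ {k : ℕ} (a : Cell S.Face (k + 1)), a.IsIn faces → ∀ c ∈ S.δ a, c.IsIn faces

namespace Subhypergraph

variable {S : Hypergraph.{u}} (X : Subhypergraph S)

/-- A subhypergraph is convex if it is non-empty and its own relation `<⁺` is the restriction of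
the relation `<⁺` of the ambient hypergraph. -/
def IsConvex : Prop :=
  (∃ k, (X.faces k).Nonempty) ∧
    ∀ k, ∀ a ∈ X.faces k, ∀ b ∈ X.faces k, S.upperIn X.faces a b ↔ S.upper a b

/-- The empty loops of `X`: the loops in `X` that are not of the form `γ(α)` with `α` in `X`
a non-loop. -/
def emptyLoops (k : ℕ) : Set (S.Face k) :=
  {a | a ∈ X.faces k ∧ S.IsLoop a ∧ ¬ ∃ α ∈ X.faces (k + 1), ¬ S.IsLoop α ∧ S.cod α = a}

/-- The empty loops of `X` over `x`. -/
def emptyLoopsOver {k : ℕ} (x : S.Face k) : Set (S.Face (k + 1)) :=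
  {a | a ∈ X.emptyLoops (k + 1) ∧ S.cod a = x}

end Subhypergraph

/-- A cut `(x, L, U)` of the set of empty loops of `X` over a face `x` of `X`. -/
@[ext]
structure Cut (T : OrderedHypergraph.{u}) (X : Subhypergraph T.toHypergraph) (k : ℕ) :
    Type u where
  base : T.Face k
  base_mem : base ∈ X.faces k
  L : Set (T.Face (k + 1))
  U : Set (T.Face (k + 1))
  union_eq : L ∪ U = X.emptyLoopsOver base
  lower_of_mem : ∀ l ∈ L, ∀ l' ∈ U, T.lower l l'

section Stretching

variable {T : OrderedHypergraph.{u}} {X : Subhypergraph T.toHypergraph}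

theorem emptyLoopsOver_linear (hT : IsOrderedFaceStructure T) (hX : X.IsConvex) {k : ℕ}
    {x : T.Face k} {l l' : T.Face (k + 1)} (hl : l ∈ X.emptyLoopsOver x)
    (hl' : l' ∈ X.emptyLoopsOver x) (hne : l ≠ l') : T.lower l l' ∨ T.lower l' l := by
  have key : ∀ m m' : T.Face (k + 1), m ∈ X.emptyLoopsOver x → m' ∈ X.emptyLoopsOver x →
      ¬ T.upper m m' := by
    intro m m' hm hm' hu
    have h := (hX.2 _ m hm.1.1 m' hm'.1.1).2 hu
    obtain ⟨_, _, α, hα, hnl, _, he⟩ := Relation.TransGen.tail'_iff.1 h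
    exact hm'.1.2.2 ⟨α, hα, hnl, he⟩
  have hx : ∀ m ∈ X.emptyLoopsOver x, Cell.face x ∈ T.theta m := fun m hm =>
    Or.inr (by rw [← hm.2]; rfl)
  rcases hT.pencil_linearity l l' hne ⟨x, hx l hl, hx l' hl'⟩ with h | h | h
  · exact h
  · exact absurd h (key _ _ hl hl')
  · exact absurd h (key _ _ hl' hl)

/-- The cut `(γ(a), -, ↑a)`, where `↑a` is the set of the empty loops `b` over `γ(a)` with
`a <^∼ b`. -/
def upCut (hT : IsOrderedFaceStructure T) (hX : X.IsConvex) {k : ℕ} (a : T.Face (k + 1))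
    (ha : a ∈ X.faces (k + 1)) : Cut T X k where
  base := T.cod a
  base_mem := X.γ_mem (.face a) ha
  L := {b | b ∈ X.emptyLoopsOver (T.cod a) ∧ ¬ T.lower a b}
  U := {b | b ∈ X.emptyLoopsOver (T.cod a) ∧ T.lower a b}
  union_eq := by
    ext b
    by_cases h : T.lower a b <;> simp [h]
  lower_of_mem := by
    rintro l ⟨hl, hal⟩ l' ⟨hl', hal'⟩
    rcases emptyLoopsOver_linear hT hX hl hl' (fun e => hal (e ▸ hal')) with h | h
    · exact h
    · exact absurd (hT.lower_trans _ _ _ hal' h) hal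

/-- The cut `(y, ↓a, -)` for a face `y ∈ δ(a)`, where `↓a` is the set of the empty loops `b` over
`y` with `b <^∼ a`. -/
def downCut (hT : IsOrderedFaceStructure T) (hX : X.IsConvex) {k : ℕ} (a : T.Face (k + 1))
    (ha : a ∈ X.faces (k + 1)) (y : T.Face k) (hy : Cell.face y ∈ T.dom a) : Cut T X k where
  base := y
  base_mem := X.δ_mem (.face a) ha _ hy
  L := {b | b ∈ X.emptyLoopsOver y ∧ T.lower b a}
  U := {b | b ∈ X.emptyLoopsOver y ∧ ¬ T.lower b a}
  union_eq := by
    ext b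
    by_cases h : T.lower b a <;> simp [h]
  lower_of_mem := by
    rintro l ⟨hl, hal⟩ l' ⟨hl', hal'⟩
    rcases emptyLoopsOver_linear hT hX hl hl' (fun e => hal' (e ▸ hal)) with h | h
    · exact h
    · exact absurd (hT.lower_trans _ _ _ h hal) hal'

/-- The codomain function of the stretching: `γ(x, L, U) = (γ(x), -, ↑x)`. -/
def stretchCod (hT : IsOrderedFaceStructure T) (hX : X.IsConvex) :
    ∀ {k : ℕ}, Cell (Cut T X) (k + 1) → Cut T X k
  | _, .face c => upCut hT hX c.base c.base_mem
  | _, .empty c => c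

open Classical in
/-- The domain relation of the stretching: `δ(x, L, U)` is the empty face on
`(γγ(x), -, ↑γ(x))` if `δ(x) = 1_{γγ(x)}`, and `{(t, ↓x, -) : t ∈ δ(x)}` otherwise. -/
def stretchDom (hT : IsOrderedFaceStructure T) (hX : X.IsConvex) :
    ∀ {k : ℕ}, Cell (Cut T X) (k + 1) → Set (Cell (Cut T X) k)
  | 0, .face c => {d | ∃ (t : T.Face 0) (ht : Cell.face t ∈ T.dom c.base),
      d = .face (downCut hT hX c.base c.base_mem t ht)}
  | k + 1, .face c =>
      if T.dom c.base = {Cell.empty (T.cod (T.cod c.base))} then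
        {.empty (upCut hT hX (T.cod c.base) (X.γ_mem (.face c.base) c.base_mem))}
      else {d | ∃ (t : T.Face (k + 1)) (ht : Cell.face t ∈ T.dom c.base),
        d = .face (downCut hT hX c.base c.base_mem t ht)}
  | _, .empty c => {.face c}

theorem dom_eq_empty (hT : IsOrderedFaceStructure T) {k : ℕ} (a : T.Face (k + 2))
    (u : T.Face k) (h : T.dom a = {Cell.empty u}) :
    T.dom a = {Cell.empty (T.cod (T.cod a))} := by
  have h1 : Cell.face (T.cod (T.cod a)) ∈ T.codSet (T.dom a) := by
    have := hT.globularity_γ a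
    have h2 : Cell.face (T.cod (T.cod a)) ∈ ({Cell.face (T.cod (T.cod a))} : Set _) := rfl
    rw [this] at h2
    exact h2.1
  obtain ⟨c, hc, he⟩ := h1
  rw [h] at hc
  subst hc
  rw [hT.γ_empty] at he
  cases he
  exact h

theorem exists_face_mem_dom (hT : IsOrderedFaceStructure T) {k : ℕ} (a : T.Face (k + 2))
    (h : T.dom a ≠ {Cell.empty (T.cod (T.cod a))}) : ∃ t, Cell.face t ∈ T.dom a := by
  rcases T.δ_cases (.face a) with ⟨x, hx⟩ | hs
  · cases x with
    | face t => exact ⟨t, by change _ ∈ T.δ _; rw [hx]; rfl⟩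
    | empty u => exact absurd (dom_eq_empty hT a u hx) h
  · obtain ⟨c, hc⟩ := T.δ_nonempty (.face a)
    obtain ⟨t, rfl⟩ := hs hc
    exact ⟨t, hc⟩

theorem exists_dom_eq_singleton (a : T.Face 1) : ∃ t, T.dom a = {Cell.face t} := by
  obtain ⟨x, hx⟩ := T.δ_zero (.face a)
  cases x with
  | face t => exact ⟨t, hx⟩

/-- The stretching `[X]` of a convex subset `X` of an ordered face structure `T`. -/
def stretch (hT : IsOrderedFaceStructure T) (hX : X.IsConvex) : OrderedHypergraph.{u} where
  Face := Cut T X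
  finite_face k := by
    have := T.finite_face k
    have := T.finite_face (k + 1)
    refine Finite.of_injective (fun c : Cut T X k => (c.base, c.L, c.U)) ?_
    intro c d h
    simp only [Prod.mk.injEq] at h
    exact Cut.ext h.1 h.2.1 h.2.2
  eventually_isEmpty := by
    obtain ⟨n, hn⟩ := T.eventually_isEmpty
    exact ⟨n, fun k hk => ⟨fun c => (hn k hk).false c.base⟩⟩
  γ := stretchCod hT hX
  δ := stretchDom hT hX
  δ_nonempty := by
    intro k a
    cases a with
    | empty c => cases k <;> exact ⟨_, rfl⟩
    | face c =>
      cases k with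
      | zero =>
        obtain ⟨t, ht⟩ := exists_dom_eq_singleton c.base
        exact ⟨_, t, by rw [ht]; rfl, rfl⟩
      | succ k =>
        simp only [stretchDom]
        split_ifs with h
        · exact ⟨_, rfl⟩
        · obtain ⟨t, ht⟩ := exists_face_mem_dom hT c.base h
          exact ⟨_, t, ht, rfl⟩
  δ_cases := by
    intro k a
    cases a with
    | empty c => cases k <;> exact Or.inl ⟨_, rfl⟩
    | face c =>
      cases k with
      | zero =>
        right
        rintro _ ⟨t, ht, rfl⟩
        exact ⟨_, rfl⟩
      | succ k =>
        simp only [stretchDom]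
        split_ifs with h
        · exact Or.inl ⟨_, rfl⟩
        · right
          rintro _ ⟨t, ht, rfl⟩
          exact ⟨_, rfl⟩
  δ_zero := by
    intro a
    cases a with
    | empty c => exact ⟨_, rfl⟩
    | face c =>
      obtain ⟨t, ht⟩ := exists_dom_eq_singleton c.base
      have ht' : Cell.face t ∈ T.dom c.base := by rw [ht]; rfl
      refine ⟨.face (downCut hT hX c.base c.base_mem t ht'), ?_⟩
      ext d
      constructor
      · rintro ⟨s, hs, rfl⟩
        have : s = t := by
          rw [ht] at hs
          cases hs
          rfl
        subst this
        rfl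
      · rintro rfl
        exact ⟨t, ht', rfl⟩
  lower c d := T.lower c.base d.base

/-- The map `ν_X : [X] → T`, `(x, L, U) ↦ x`. -/
def stretchMap (hT : IsOrderedFaceStructure T) (hX : X.IsConvex) (k : ℕ) :
    (stretch hT hX).Face k → T.Face k :=
  fun c => Cut.base c

end Stretching

end FaceStructures

open FaceStructures

/-! A convex subset X may contain loops that no non-loop of X fills: the empty loops. By pencil
linearity and convexity the empty loops over a face x form a chain for `<^∼`. The stretching opens
them: x is replaced by the chain of cuts of its empty loops, and a face over an empty loop l becomes
a non-loop leading from the cut just below l to the cut just above l. No other loop is opened than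
those lying `<⁺`-above an empty loop (`stretch_isLoop_iff`).

Two facts govern [X]. First, its order `<⁺` is lexicographic: compare the bases in T, and over one
base compare the sets L by inclusion (`upper_of_stretch_upper`, `stretch_upperEq_of_subset`,
`stretch_upper_of_upper`). Second, when several faces of δ(x) pass through w, every empty loop over
w lies below one of them or is separated from γ(x) by `<^∼` (`emptyLoop_position`). Hence the cuts
over w at the faces of δ(x) cancel between neighbours, and only the cuts of γ(x) survive
(`cod_position`, `dom_position`). This is globularity on non-empty faces; the empty faces then take
care of themselves (`FaceGlobular.globularity_δ`).

All this needs order theory in T: `<⁻` is expressed by `<⁺` one dimension lower (`minus_iff`), the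
faces `<⁺`-above a face form a chain (`comparable_of_upper`), and faces with `<⁺`-comparable
codomains are comparable for `<⁺` or `<^∼` (`comparable_of_cod_le`).

For uniqueness, let f be a monotone morphism with image X. Comparability of codomains, by induction
on dimension, makes every fibre of f a `<⁺`-chain. Consecutive members of a fibre are joined by a
face over an empty loop, so a member s is determined by the set of empty loops f(l) with γ(l) below
or equal to s. This identifies the source of f with [X] over T (`isMonotoneIso_lift`), compatibly
with isomorphisms over T.

An empty loop produces two different cuts over its codomain, whence the criterion for an embedding.
For the size, take the greatest dimension k in which X differs from T: there are no empty loops over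
faces of dimension k or more, and in dimension k the missing faces include one that lies in no
domain of a non-loop. -/

namespace FaceStructures

/-! ### The upper order, and globularity on non-empty faces -/

namespace Hypergraph

variable (S : Hypergraph.{u})

/-- The reflexive closure of the upper order. -/
def upperEq {k : ℕ} (a b : S.Face k) : Prop := a = b ∨ S.upper a b

variable {S} {k : ℕ} {a b c : S.Face k}

theorem upperEq.refl (a : S.Face k) : S.upperEq a a := Or.inl rfl

theorem upper.le (h : S.upper a b) : S.upperEq a b := Or.inr h

theorem upper.trans (h : S.upper a b) (h' : S.upper b c) : S.upper a c :=
  Relation.TransGen.trans h h'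

theorem upper.trans_le (h : S.upper a b) (h' : S.upperEq b c) : S.upper a c := by
  rcases h' with rfl | h'
  · exact h
  · exact h.trans h'

theorem upperEq.trans_lt (h : S.upperEq a b) (h' : S.upper b c) : S.upper a c := by
  rcases h with rfl | h
  · exact h'
  · exact h.trans h'

theorem upperEq.trans (h : S.upperEq a b) (h' : S.upperEq b c) : S.upperEq a c := by
  rcases h with rfl | h
  · exact h'
  · exact (h.trans_le h').le

theorem upper_of_mem_dom {α : S.Face (k + 1)} (hα : ¬ S.IsLoop α) (ha : Cell.face a ∈ S.dom α) :
    S.upper a (S.cod α) := Relation.TransGen.single ⟨α, hα, ha, rfl⟩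

theorem upperEq_of_mem_dom {α : S.Face (k + 1)} (ha : Cell.face a ∈ S.dom α) :
    S.upperEq a (S.cod α) := by
  by_cases hα : S.IsLoop α
  · have h : S.dom α = {.face (S.cod α)} := hα
    rw [h] at ha
    cases ha
    exact .refl _
  · exact (upper_of_mem_dom hα ha).le

theorem exists_last_link (h : S.upper a b) : ∃ α : S.Face (k + 1), ¬ S.IsLoop α ∧
    S.cod α = b ∧ ∃ c, Cell.face c ∈ S.dom α ∧ S.upperEq a c := by
  obtain ⟨c, hac, α, hα, hc, rfl⟩ := Relation.TransGen.tail'_iff.1 h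
  refine ⟨α, hα, rfl, c, hc, ?_⟩
  rcases Relation.reflTransGen_iff_eq_or_transGen.1 hac with rfl | h
  · exact .refl _
  · exact upper.le h

theorem exists_first_link (h : S.upper a b) : ∃ α : S.Face (k + 1), ¬ S.IsLoop α ∧
    Cell.face a ∈ S.dom α ∧ S.upperEq (S.cod α) b := by
  obtain ⟨c, ⟨α, hα, hc, rfl⟩, hac⟩ := Relation.TransGen.head'_iff.1 h
  refine ⟨α, hα, hc, ?_⟩
  rcases Relation.reflTransGen_iff_eq_or_transGen.1 hac with h | h
  · exact Or.inl h.symm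
  · exact upper.le h

theorem IsLoop.eq_cod {α : S.Face (k + 1)} (hα : S.IsLoop α) (ha : Cell.face a ∈ S.dom α) :
    a = S.cod α := by
  have h : S.dom α = {.face (S.cod α)} := hα
  rw [h] at ha
  cases ha
  rfl

theorem IsLoop.cod_mem {α : S.Face (k + 1)} (hα : S.IsLoop α) :
    Cell.face (S.cod α) ∈ S.dom α := by
  have h : S.dom α = {.face (S.cod α)} := hα
  rw [h]
  rfl

theorem mem_theta {α : S.Face (k + 1)} :
    Cell.face a ∈ S.theta α ↔ Cell.face a ∈ S.dom α ∨ S.cod α = a := by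
  constructor
  · rintro (h | h)
    · exact Or.inl h
    · cases h
      exact Or.inr rfl
  · rintro (h | rfl)
    · exact Or.inl h
    · exact Or.inr rfl

theorem IsLoop.mem_theta_iff {α : S.Face (k + 1)} (hα : S.IsLoop α) :
    Cell.face a ∈ S.theta α ↔ S.cod α = a := by
  rw [mem_theta]
  exact ⟨fun h => h.elim (fun h => (hα.eq_cod h).symm) id, Or.inr⟩

/-- A face with a face in its domain has only faces in its domain. -/
theorem exists_eq_face {α : S.Face (k + 1)} (ha : Cell.face a ∈ S.dom α) {d : Cell S.Face k}
    (hd : d ∈ S.dom α) : ∃ t, d = .face t := by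
  rcases S.δ_cases (.face α) with ⟨x, hx⟩ | h
  · have hx' : S.dom α = {x} := hx
    rw [hx'] at ha hd
    cases ha
    cases hd
    exact ⟨_, rfl⟩
  · obtain ⟨t, rfl⟩ := h hd
    exact ⟨t, rfl⟩

theorem dom_eq_singleton_of_forall {α : S.Face (k + 1)} (ha : Cell.face a ∈ S.dom α)
    (h : ∀ t, Cell.face t ∈ S.dom α → t = a) : S.dom α = {.face a} := by
  ext d
  constructor
  · intro hd
    obtain ⟨t, rfl⟩ := exists_eq_face ha hd
    rw [h t hd]
    rfl
  · rintro rfl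
    exact ha

theorem isEmptyDomain_or_exists (α : S.Face (k + 2)) :
    S.IsEmptyDomain α ∨ ∃ t, Cell.face t ∈ S.dom α := by
  rcases S.δ_cases (.face α) with ⟨x, hx⟩ | h
  · have hx' : S.dom α = {x} := hx
    cases x with
    | face t => exact Or.inr ⟨t, by rw [hx']; rfl⟩
    | empty u => exact Or.inl ⟨u, hx'⟩
  · obtain ⟨d, hd⟩ := S.δ_nonempty (.face α)
    obtain ⟨t, rfl⟩ := h hd
    exact Or.inr ⟨t, hd⟩

theorem IsEmptyDomain.not_mem {α : S.Face (k + 2)} (hα : S.IsEmptyDomain α) (t : S.Face (k + 1)) :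
    Cell.face t ∉ S.dom α := by
  obtain ⟨u, hu⟩ := hα
  rw [hu]
  intro h
  cases h

theorem IsEmptyDomain.not_isLoop {α : S.Face (k + 2)} (hα : S.IsEmptyDomain α) :
    ¬ S.IsLoop α := fun h => hα.not_mem _ h.cod_mem

theorem isEmptyDomain_of_mem {α : S.Face (k + 2)} {u : S.Face k} (hu : Cell.empty u ∈ S.dom α) :
    S.dom α = {.empty u} := by
  rcases isEmptyDomain_or_exists α with ⟨v, hv⟩ | ⟨t, ht⟩
  · rw [hv] at hu ⊢
    cases hu
    rfl
  · obtain ⟨s, hs⟩ := exists_eq_face ht hu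
    cases hs

/-- The part of the axioms of ordered face structures on globularity and strictness in which
the domains of codomains are only compared on non-empty faces. -/
structure FaceGlobular (S : Hypergraph.{u}) : Prop where
  globularity_γ : ∀ {k : ℕ} (a : S.Face (k + 2)),
    {Cell.face (S.cod (S.cod a))} =
      S.codSet (S.dom a) \ S.domSet (Cell.face '' S.domNonloop a)
  globularity_face : ∀ {k : ℕ} (a : S.Face (k + 2)) (w : S.Face k),
    Cell.face w ∈ S.dom (S.cod a) ↔
      Cell.face w ∈ S.domSet (S.dom a) \ S.codSet (Cell.face '' S.domNonloop a)
  γ_empty : ∀ {k : ℕ} (a : S.Face k), S.γ (Cell.empty a) = a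
  δ_empty : ∀ {k : ℕ} (a : S.Face k), S.δ (Cell.empty a) = {Cell.face a}
  upper_irrefl : ∀ {k : ℕ} (a : S.Face k), ¬ S.upper a a

namespace FaceGlobular

variable (hS : S.FaceGlobular)
include hS

theorem upper_wf (k : ℕ) : WellFounded (S.upper (k := k)) := by
  have := S.finite_face k
  have : IsTrans (S.Face k) S.upper := ⟨fun _ _ _ h h' => h.trans h'⟩
  have : Std.Irrefl (S.upper (k := k)) := ⟨hS.upper_irrefl⟩
  exact Finite.wellFounded_of_trans_of_irrefl _

theorem upper_wf_flip (k : ℕ) : WellFounded (fun a b : S.Face k => S.upper b a) := by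
  have := S.finite_face k
  have : IsTrans (S.Face k) (fun a b : S.Face k => S.upper b a) := ⟨fun _ _ _ h h' => h'.trans h⟩
  have : Std.Irrefl (fun a b : S.Face k => S.upper b a) := ⟨hS.upper_irrefl⟩
  exact Finite.wellFounded_of_trans_of_irrefl _

theorem upperEq_antisymm (h : S.upperEq a b) (h' : S.upperEq b a) : a = b := by
  rcases h with h | h
  · exact h
  · exact absurd (h.trans_le h') (hS.upper_irrefl _)

theorem not_upper_of_le (h : S.upperEq a b) : ¬ S.upper b a :=
  fun h' => hS.upper_irrefl _ (h.trans_lt h')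

theorem isLoop_of_cod_mem {α : S.Face (k + 1)} (h : Cell.face (S.cod α) ∈ S.dom α) :
    S.IsLoop α := by
  by_contra hα
  exact hS.upper_irrefl _ (upper_of_mem_dom hα h)

theorem not_mem_dom_of_nonloop {Φ : S.Face (k + 2)} {p : S.Face (k + 1)}
    (hp : Cell.face p ∈ S.dom Φ) (hpl : ¬ S.IsLoop p) :
    Cell.face (S.cod (S.cod Φ)) ∉ S.dom p := by
  intro h
  have h1 : Cell.face (S.cod (S.cod Φ)) ∈ ({Cell.face (S.cod (S.cod Φ))} : Set _) := rfl
  rw [hS.globularity_γ Φ] at h1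
  exact h1.2 (Set.mem_biUnion (x := Cell.face p) ⟨p, ⟨hp, hpl⟩, rfl⟩ h)

theorem exists_nonloop_out {Φ : S.Face (k + 2)} {t : S.Face (k + 1)}
    (ht : Cell.face t ∈ S.dom Φ) (hne : S.cod t ≠ S.cod (S.cod Φ)) :
    ∃ p, Cell.face p ∈ S.dom Φ ∧ ¬ S.IsLoop p ∧ Cell.face (S.cod t) ∈ S.dom p := by
  by_contra hcon
  push Not at hcon
  have h1 : Cell.face (S.cod t) ∈
      S.codSet (S.dom Φ) \ S.domSet (Cell.face '' S.domNonloop Φ) := by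
    refine ⟨⟨_, ht, rfl⟩, ?_⟩
    intro h
    obtain ⟨_, ⟨p, ⟨hp, hpl⟩, rfl⟩, h2⟩ := Set.mem_iUnion₂.1 h
    exact hcon p hp hpl h2
  rw [← hS.globularity_γ Φ] at h1
  exact hne (Cell.face.inj h1)

theorem exists_cod_eq {Φ : S.Face (k + 2)} {t : S.Face (k + 1)} (ht : Cell.face t ∈ S.dom Φ) :
    ∃ p, Cell.face p ∈ S.dom Φ ∧ S.cod p = S.cod (S.cod Φ) := by
  have h1 : Cell.face (S.cod (S.cod Φ)) ∈ ({Cell.face (S.cod (S.cod Φ))} : Set _) := rfl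
  rw [hS.globularity_γ Φ] at h1
  obtain ⟨⟨d, hd, he⟩, -⟩ := h1
  obtain ⟨p, rfl⟩ := exists_eq_face ht hd
  exact ⟨p, hd, (Cell.face.inj he).symm⟩

theorem mem_dom_cod {Φ : S.Face (k + 2)} {t : S.Face (k + 1)} {w : S.Face k}
    (ht : Cell.face t ∈ S.dom Φ) (hw : Cell.face w ∈ S.dom t)
    (h : ∀ p, Cell.face p ∈ S.dom Φ → ¬ S.IsLoop p → S.cod p ≠ w) :
    Cell.face w ∈ S.dom (S.cod Φ) := by
  rw [hS.globularity_face Φ]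
  refine ⟨Set.mem_biUnion ht hw, ?_⟩
  rintro ⟨_, ⟨p, ⟨hp, hpl⟩, rfl⟩, he⟩
  cases he
  exact h p hp hpl rfl

theorem exists_mem_dom_of_mem_dom_cod {Φ : S.Face (k + 2)} {t : S.Face (k + 1)} {w : S.Face k}
    (ht : Cell.face t ∈ S.dom Φ) (hw : Cell.face w ∈ S.dom (S.cod Φ)) :
    ∃ p, Cell.face p ∈ S.dom Φ ∧ Cell.face w ∈ S.dom p := by
  rw [hS.globularity_face Φ] at hw
  obtain ⟨d, hd, hw⟩ := Set.mem_iUnion₂.1 hw.1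
  obtain ⟨p, rfl⟩ := exists_eq_face ht hd
  exact ⟨p, hd, hw⟩

theorem cod_ne_of_mem_dom_cod {Φ : S.Face (k + 2)} {p : S.Face (k + 1)} {w : S.Face k}
    (hw : Cell.face w ∈ S.dom (S.cod Φ)) (hp : Cell.face p ∈ S.dom Φ) (hpl : ¬ S.IsLoop p) :
    S.cod p ≠ w := by
  rintro rfl
  rw [hS.globularity_face Φ] at hw
  exact hw.2 ⟨_, ⟨p, ⟨hp, hpl⟩, rfl⟩, rfl⟩

theorem dom_cod_of_dom_eq_empty {Φ : S.Face (k + 2)} {u : S.Face k}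
    (h : S.dom Φ = {.empty u}) : S.cod (S.cod Φ) = u ∧ S.dom (S.cod Φ) = {.face u} := by
  constructor
  · have h1 : Cell.face (S.cod (S.cod Φ)) ∈ ({Cell.face (S.cod (S.cod Φ))} : Set _) := rfl
    rw [hS.globularity_γ Φ, h] at h1
    obtain ⟨⟨d, rfl, he⟩, -⟩ := h1
    rw [hS.γ_empty] at he
    cases he
    rfl
  · have key : ∀ w, Cell.face w ∈ S.dom (S.cod Φ) ↔ w = u := by
      intro w
      rw [hS.globularity_face Φ, h]
      constructor
      · rintro ⟨h1, -⟩
        obtain ⟨d, rfl, hw⟩ := Set.mem_iUnion₂.1 h1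
        rw [hS.δ_empty] at hw
        cases hw
        rfl
      · rintro rfl
        refine ⟨Set.mem_biUnion (x := Cell.empty w) rfl (by rw [hS.δ_empty]; rfl), ?_⟩
        rintro ⟨_, ⟨p, ⟨hp, hpl⟩, rfl⟩, he⟩
        rw [h] at hp
        cases hp
    exact dom_eq_singleton_of_forall ((key u).2 rfl) fun t ht => (key t).1 ht

theorem isLoop_cod_of_isEmptyDomain {Φ : S.Face (k + 2)} (h : S.IsEmptyDomain Φ) :
    S.IsLoop (S.cod Φ) := by
  obtain ⟨u, hu⟩ := h
  obtain ⟨h1, h2⟩ := hS.dom_cod_of_dom_eq_empty hu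
  change S.dom (S.cod Φ) = _
  rw [h2, h1]

theorem dom_eq_of_isEmptyDomain {Φ : S.Face (k + 2)} (h : S.IsEmptyDomain Φ) :
    S.dom Φ = {.empty (S.cod (S.cod Φ))} := by
  obtain ⟨u, hu⟩ := h
  rw [(hS.dom_cod_of_dom_eq_empty hu).1, hu]

/-- The codomain of a non-loop codomain is reached by a non-loop of the domain. -/
theorem exists_nonloop_cod_eq {Φ : S.Face (k + 2)} (h : ¬ S.IsLoop (S.cod Φ)) :
    ∃ p, Cell.face p ∈ S.dom Φ ∧ ¬ S.IsLoop p ∧ S.cod p = S.cod (S.cod Φ) := by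
  rcases isEmptyDomain_or_exists Φ with he | ⟨t, ht⟩
  · exact absurd (hS.isLoop_cod_of_isEmptyDomain he) h
  obtain ⟨p, hp, hc⟩ := hS.exists_cod_eq ht
  by_cases hpl : S.IsLoop p
  · by_contra hcon
    push Not at hcon
    apply h
    apply hS.isLoop_of_cod_mem
    exact hS.mem_dom_cod hp (hc ▸ hpl.cod_mem) hcon
  · exact ⟨p, hp, hpl, hc⟩

/-- An element of the domain of a non-loop codomain is in the domain of a non-loop of the
domain. -/
theorem exists_nonloop_mem_dom {Φ : S.Face (k + 2)} {w : S.Face k} (h : ¬ S.IsLoop (S.cod Φ))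
    (hw : Cell.face w ∈ S.dom (S.cod Φ)) :
    ∃ p, Cell.face p ∈ S.dom Φ ∧ ¬ S.IsLoop p ∧ Cell.face w ∈ S.dom p := by
  rcases isEmptyDomain_or_exists Φ with he | ⟨t, ht⟩
  · exact absurd (hS.isLoop_cod_of_isEmptyDomain he) h
  obtain ⟨p, hp, hc⟩ := hS.exists_mem_dom_of_mem_dom_cod ht hw
  by_cases hpl : S.IsLoop p
  · have := hpl.eq_cod hc
    subst this
    refine hS.exists_nonloop_out hp fun he => h (hS.isLoop_of_cod_mem ?_)
    rw [← he]
    exact hw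
  · exact ⟨p, hp, hpl, hc⟩

/-- Unless r is the codomain of a non-loop c' of δ(Φ), it survives in δγ(Φ). If it is, some non-loop
in δ(c') has the same codomain q and lies strictly below r, so the search ends. -/
theorem exists_face_descend {Φ : S.Face (k + 3)} {q : S.Face k} (r : S.Face (k + 1))
    (hr : ¬ S.IsLoop r) (hq : S.cod r = q) (c : S.Face (k + 2)) (hc : Cell.face c ∈ S.dom Φ)
    (hrc : Cell.face r ∈ S.dom c) :
    ∃ p, Cell.face p ∈ S.dom (S.cod Φ) ∧ Cell.face q ∈ S.theta p := by
  induction r using (hS.upper_wf (k + 1)).induction generalizing c with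
  | _ r ih =>
    by_cases h : ∃ c', Cell.face c' ∈ S.dom Φ ∧ ¬ S.IsLoop c' ∧ S.cod c' = r
    · obtain ⟨c', hc', hl, rfl⟩ := h
      obtain ⟨r', hr', hrl, he⟩ := hS.exists_nonloop_cod_eq hr
      exact ih r' (upper_of_mem_dom hl hr') hrl (he.trans hq) c' hc' hr'
    · push Not at h
      exact ⟨r, hS.mem_dom_cod hc hrc h, mem_theta.2 (Or.inr hq)⟩

/-- As long as r is not γγ(Φ), it lies in the domain of a non-loop c' of δ(Φ). Either q is the
codomain of a non-loop in δ(c'), and `exists_face_descend` finds a surviving face at q, or q stays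
incident to γ(c'), which lies strictly above r. -/
theorem exists_face_ascend {Φ : S.Face (k + 3)} {q : S.Face k} (r : S.Face (k + 1))
    (hq : Cell.face q ∈ S.theta r) (c : S.Face (k + 2)) (hc : Cell.face c ∈ S.dom Φ)
    (hrc : S.cod c = r) :
    (∃ p, Cell.face p ∈ S.dom (S.cod Φ) ∧ Cell.face q ∈ S.theta p) ∨
      Cell.face q ∈ S.theta (S.cod (S.cod Φ)) := by
  induction r using (hS.upper_wf_flip (k + 1)).induction generalizing c with
  | _ r ih =>
    subst hrc
    by_cases hr : S.cod c = S.cod (S.cod Φ)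
    · exact Or.inr (hr ▸ hq)
    obtain ⟨c', hc', hcl, hrc'⟩ := hS.exists_nonloop_out hc hr
    by_cases h : ∃ r', Cell.face r' ∈ S.dom c' ∧ ¬ S.IsLoop r' ∧ S.cod r' = q
    · obtain ⟨r', hr', hrl, he⟩ := h
      exact Or.inl (hS.exists_face_descend r' hrl he c' hc' hr')
    push Not at h
    refine ih (S.cod c') (upper_of_mem_dom hcl hrc') ?_ c' hc' rfl
    rw [mem_theta] at hq ⊢
    rcases hq with hq | rfl
    · exact Or.inl (hS.mem_dom_cod hrc' hq h)
    · by_cases he : S.cod (S.cod c) = S.cod (S.cod c')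
      · exact Or.inr he.symm
      · obtain ⟨p, hp, -, hpq⟩ := hS.exists_nonloop_out hrc' he
        exact Or.inl (hS.mem_dom_cod hp hpq h)

/-- No face survives in δγ(Φ), so every face in the domain of a member of δ(Φ) is the codomain of a
non-loop of δ(Φ). Passing to that non-loop descends in `<⁺`, and the descent can only stop at a face
with empty domain. -/
theorem exists_isEmptyDomain {Φ : S.Face (k + 3)} (h : S.IsEmptyDomain (S.cod Φ))
    (c : S.Face (k + 2)) (hc : Cell.face c ∈ S.dom Φ) :
    ∃ c', Cell.face c' ∈ S.dom Φ ∧ S.IsEmptyDomain c' := by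
  have key : ∀ r : S.Face (k + 1), ∀ c : S.Face (k + 2), S.cod c = r → Cell.face c ∈ S.dom Φ →
      ¬ S.IsLoop c → ∃ c', Cell.face c' ∈ S.dom Φ ∧ S.IsEmptyDomain c' := by
    intro r
    induction r using (hS.upper_wf (k + 1)).induction with
    | _ r ih =>
      rintro c rfl hc hcl
      rcases isEmptyDomain_or_exists c with he | ⟨t, ht⟩
      · exact ⟨c, hc, he⟩
      by_cases h' : ∃ c', Cell.face c' ∈ S.dom Φ ∧ ¬ S.IsLoop c' ∧ S.cod c' = t
      · obtain ⟨c', hc', hcl', rfl⟩ := h'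
        exact ih _ (upper_of_mem_dom hcl ht) c' rfl hc' hcl'
      · push Not at h'
        exact absurd (hS.mem_dom_cod hc ht h') (h.not_mem t)
  rcases isEmptyDomain_or_exists c with he | ⟨t, ht⟩
  · exact ⟨c, hc, he⟩
  by_cases h' : ∃ c', Cell.face c' ∈ S.dom Φ ∧ ¬ S.IsLoop c' ∧ S.cod c' = t
  · obtain ⟨c', hc', hcl', rfl⟩ := h'
    exact key _ c' rfl hc' hcl'
  · push Not at h'
    exact absurd (hS.mem_dom_cod hc ht h') (h.not_mem t)

theorem cod_cod_cod_eq_of_isEmptyDomain {Φ : S.Face (k + 3)} (h : S.IsEmptyDomain (S.cod Φ))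
    {q : S.Face k} {c : S.Face (k + 2)} (hc : Cell.face c ∈ S.dom Φ)
    (hq : S.dom c = {.empty q}) : q = S.cod (S.cod (S.cod Φ)) := by
  obtain ⟨h1, h2⟩ := hS.dom_cod_of_dom_eq_empty hq
  rcases hS.exists_face_ascend (S.cod c) (mem_theta.2 (Or.inr h1)) c hc rfl with ⟨p, hp, -⟩ | h3
  · exact absurd hp (h.not_mem p)
  · exact ((hS.isLoop_cod_of_isEmptyDomain h).mem_theta_iff.1 h3).symm

/-- The relation `OneEq` forgives empty faces on faces incident to the non-empty part. Ascending
from c in δ(Φ) with empty domain on q shows that q is incident to δγ(Φ), or is the face carrying the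
empty domain of γ(Φ). So the comparison on non-empty faces suffices. -/
theorem globularity_δ (Φ : S.Face (k + 2)) :
    S.OneEq (S.dom (S.cod Φ))
      (S.domSet (S.dom Φ) \ S.codSet (Cell.face '' S.domNonloop Φ)) := by
  cases k with
  | zero =>
    have : S.dom (S.cod Φ) = S.domSet (S.dom Φ) \ S.codSet (Cell.face '' S.domNonloop Φ) := by
      ext d
      cases d with
      | face w => exact hS.globularity_face Φ w
    rw [← this]
    rfl
  | succ k =>
    -- The added empty faces depend only on the non-empty members, which agree on both sides.
    have hE : S.emptyOn (S.dom (S.cod Φ)) =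
        S.emptyOn (S.domSet (S.dom Φ) \ S.codSet (Cell.face '' S.domNonloop Φ)) := by
      ext d
      constructor
      · rintro ⟨x, hx, y, hy, rfl⟩
        exact ⟨x, (hS.globularity_face Φ x).1 hx, y, hy, rfl⟩
      · rintro ⟨x, hx, y, hy, rfl⟩
        exact ⟨x, (hS.globularity_face Φ x).2 hx, y, hy, rfl⟩
    have hR : ∀ q : S.Face k,
        Cell.empty q ∈ S.domSet (S.dom Φ) \ S.codSet (Cell.face '' S.domNonloop Φ) ↔
          ∃ c, Cell.face c ∈ S.dom Φ ∧ S.dom c = {.empty q} := by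
      intro q
      constructor
      · rintro ⟨h1, -⟩
        obtain ⟨d, hd, hq⟩ := Set.mem_iUnion₂.1 h1
        cases d with
        | face c => exact ⟨c, hd, isEmptyDomain_of_mem hq⟩
        | empty u =>
          rw [hS.δ_empty] at hq
          cases hq
      · rintro ⟨c, hc, hq⟩
        refine ⟨Set.mem_biUnion hc (show Cell.empty q ∈ S.dom c by rw [hq]; rfl), ?_⟩
        rintro ⟨_, -, he⟩
        cases he
    unfold OneEq
    rw [← hE]
    ext d
    cases d with
    | face w =>
      have := hS.globularity_face Φ w
      simp only [Set.mem_union, this]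
    | empty q =>
      rw [Set.mem_union, Set.mem_union, hR]
      constructor
      · rintro (h | h)
        · left
          have hd := isEmptyDomain_of_mem h
          rcases isEmptyDomain_or_exists Φ with ⟨u, hu⟩ | ⟨t, ht⟩
          · rw [(hS.dom_cod_of_dom_eq_empty hu).2] at h
            cases h
          obtain ⟨c, hc, q', hq'⟩ := hS.exists_isEmptyDomain ⟨q, hd⟩ t ht
          have e1 := hS.cod_cod_cod_eq_of_isEmptyDomain ⟨q, hd⟩ hc hq'
          have e2 := (hS.dom_cod_of_dom_eq_empty hd).1
          rw [e1, e2] at hq'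
          exact ⟨c, hc, hq'⟩
        · exact Or.inr h
      · rintro (⟨c, hc, hq⟩ | h)
        · rcases isEmptyDomain_or_exists (S.cod Φ) with hd | ⟨t, ht⟩
          · left
            rw [hS.cod_cod_cod_eq_of_isEmptyDomain hd hc hq, hS.dom_eq_of_isEmptyDomain hd]
            rfl
          · right
            obtain ⟨h1, h2⟩ := hS.dom_cod_of_dom_eq_empty hq
            rcases hS.exists_face_ascend (S.cod c) (mem_theta.2 (Or.inr h1)) c hc rfl with
              ⟨p, hp, hpq⟩ | h3
            · exact ⟨p, hp, q, hpq, rfl⟩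
            · rcases mem_theta.1 h3 with h4 | rfl
              · obtain ⟨p, hp, hpq⟩ := hS.exists_mem_dom_of_mem_dom_cod ht h4
                exact ⟨p, hp, q, Or.inl hpq, rfl⟩
              · obtain ⟨p, hp, hpq⟩ := hS.exists_cod_eq ht
                exact ⟨p, hp, _, mem_theta.2 (Or.inr hpq), rfl⟩
        · exact Or.inr h

end FaceGlobular

end Hypergraph

open FaceStructures.Hypergraph

/-- The subhypergraph of all faces. -/
def Subhypergraph.univ (S : Hypergraph.{u}) : Subhypergraph S where
  faces _ := Set.univ
  γ_mem _ _ := trivial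
  δ_mem _ _ c _ := by cases c <;> trivial

/-! ### Order theory of an ordered face structure -/

namespace IsOrderedFaceStructure

variable {S : OrderedHypergraph.{u}} (hS : IsOrderedFaceStructure S)
include hS

theorem faceGlobular : S.toHypergraph.FaceGlobular where
  globularity_γ := hS.globularity_γ
  globularity_face := by
    intro k a w
    have key : ∀ A : Set (Cell S.Face k), Cell.face w ∈ A ∪ S.emptyOn A ↔ Cell.face w ∈ A := by
      intro A
      constructor
      · rintro (h | h)
        · exact h
        · cases k with
          | zero => exact h.elim
          | succ k =>
            obtain ⟨_, _, _, _, he⟩ := h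
            cases he
      · exact Or.inl
    rw [← key, ← key (S.domSet _ \ _), hS.globularity_δ a]
  γ_empty := hS.γ_empty
  δ_empty := hS.δ_empty
  upper_irrefl := hS.upper_irrefl

theorem isConvex_univ : (Subhypergraph.univ S.toHypergraph).IsConvex := by
  refine ⟨⟨0, ?_⟩, fun k a _ b _ => ?_⟩
  · obtain ⟨x⟩ := hS.nonempty
    exact ⟨x, trivial⟩
  · have : ∀ a b : S.Face k, (∃ α ∈ (Subhypergraph.univ S.toHypergraph).faces (k + 1),
        ¬ S.IsLoop α ∧ Cell.face a ∈ S.dom α ∧ S.cod α = b) ↔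
        ∃ α : S.Face (k + 1), ¬ S.IsLoop α ∧ Cell.face a ∈ S.dom α ∧ S.cod α = b :=
      fun a b => ⟨fun ⟨α, _, h⟩ => ⟨α, h⟩, fun ⟨α, h⟩ => ⟨α, trivial, h⟩⟩
    unfold upperIn upper
    simp only [this]

variable {k : ℕ}

theorem eq_of_upperEq_of_mem_dom {Φ : S.Face (k + 1)} {x y : S.Face k}
    (hx : Cell.face x ∈ S.dom Φ) (hy : Cell.face y ∈ S.dom Φ) (h : S.upperEq x y) : x = y :=
  h.resolve_right (hS.local_discreteness Φ x y hx hy).1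

omit hS in
-- Along a `<⁻`-chain each codomain lies in the next domain, so the codomains climb in `<⁺`;
-- conversely a `<⁺`-chain of faces supplies the intermediate terms. Questions on `<⁻` and `<^∼`
-- thus move one dimension down.
theorem minus_iff {a b : S.Face (k + 1)} :
    S.minus a b ↔ ∃ d, Cell.face d ∈ S.dom b ∧ S.upperEq (S.cod a) d := by
  constructor
  · intro h
    change Relation.TransGen _ a b at h
    induction h with
    | single h => exact ⟨_, h, .refl _⟩
    | tail _ h ih =>
      obtain ⟨d, hd, hle⟩ := ih
      exact ⟨_, h, hle.trans (upperEq_of_mem_dom hd)⟩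
  · have key : ∀ x d : S.Face k, S.upper x d → ∀ a : S.Face (k + 1), S.cod a = x →
        Cell.face d ∈ S.dom b → S.minus a b := by
      intro x d h
      induction h using Relation.TransGen.head_induction_on with
      | single h =>
        obtain ⟨α, -, h1, rfl⟩ := h
        rintro a rfl h2
        exact Relation.TransGen.head h1 (.single h2)
      | head h _ ih =>
        obtain ⟨α, -, h1, h3⟩ := h
        rintro a rfl h2
        exact Relation.TransGen.head h1 (ih α h3 h2)
    rintro ⟨d, hd, h | h⟩
    · subst h
      exact Relation.TransGen.single hd
    · exact key _ _ h _ rfl hd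

omit hS in
theorem minus_of_le {a b : S.Face (k + 1)} {d : S.Face k} (hd : Cell.face d ∈ S.dom b)
    (h : S.upperEq (S.cod a) d) : S.minus a b := minus_iff.2 ⟨d, hd, h⟩

theorem isLoop_of_minus_of_minus {a b : S.Face (k + 1)} (h : S.minus a b) (h' : S.minus b a) :
    S.IsLoop a ∧ S.IsLoop b ∧ S.cod a = S.cod b := by
  obtain ⟨d, hd, hle⟩ := minus_iff.1 h
  obtain ⟨e, he, hle'⟩ := minus_iff.1 h'
  have h1 := upperEq_of_mem_dom hd
  have h2 := upperEq_of_mem_dom he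
  have e1 : S.cod a = d := hS.faceGlobular.upperEq_antisymm hle (h1.trans (hle'.trans h2))
  have e2 : S.cod b = e := hS.faceGlobular.upperEq_antisymm hle' (h2.trans (hle.trans h1))
  refine ⟨hS.faceGlobular.isLoop_of_cod_mem ?_, hS.faceGlobular.isLoop_of_cod_mem ?_,
    hS.faceGlobular.upperEq_antisymm (hle.trans h1) (hle'.trans h2)⟩
  · have : S.cod a = e := hS.faceGlobular.upperEq_antisymm (hle.trans (h1.trans hle')) h2
    rw [this]
    exact he
  · have : S.cod b = d := hS.faceGlobular.upperEq_antisymm (hle'.trans (h2.trans hle)) h1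
    rw [this]
    exact hd

theorem not_minus_of_nonloop {a b : S.Face (k + 1)} (ha : ¬ S.IsLoop a ∨ ¬ S.IsLoop b)
    (h : S.minus a b) : ¬ S.minus b a := fun h' =>
  have := hS.isLoop_of_minus_of_minus h h'
  ha.elim (fun h => h this.1) (fun h => h this.2.1)

theorem lower_asymm {a b : S.Face (k + 1)} (h : S.lower a b) : ¬ S.lower b a :=
  fun h' => hS.lower_irrefl _ (hS.lower_trans _ _ _ h h')

theorem not_upperEq_of_lower {a b : S.Face (k + 1)} (h : S.lower a b) : ¬ S.upperEq a b := by
  rintro (rfl | h')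
  · exact hS.lower_irrefl _ h
  · exact hS.disjointness a b ⟨Or.inl h, Or.inl h'⟩

theorem not_upperEq_of_lower' {a b : S.Face (k + 1)} (h : S.lower a b) : ¬ S.upperEq b a := by
  rintro (rfl | h')
  · exact hS.lower_irrefl _ h
  · exact hS.disjointness a b ⟨Or.inl h, Or.inr h'⟩

/-- Disjoint boundaries are settled by disjointness, meeting ones by pencil linearity. The last
alternative is unavoidable: between two loops over one face `<⁻` holds in both directions and does
not orient `<^∼`. -/
theorem lower_or_of_minus {a b : S.Face (k + 1)} (h : S.minus a b) (hne : a ≠ b) :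
    S.lower a b ∨ (S.upper a b ∨ S.upper b a) ∨
      (S.IsLoop a ∧ S.IsLoop b ∧ S.cod a = S.cod b ∧ S.lower b a) := by
  by_cases hd : S.theta a ∩ S.theta b = ∅
  · exact Or.inl ((hS.lower_iff_minus a b hd).2 h)
  obtain ⟨d, hda, hdb⟩ := Set.nonempty_iff_ne_empty.2 hd
  obtain ⟨e, he, -⟩ := minus_iff.1 h
  have : ∃ t, d = .face t := by
    rcases hdb with hdb | rfl
    · exact exists_eq_face he hdb
    · exact ⟨_, rfl⟩
  obtain ⟨t, rfl⟩ := this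
  rcases hS.pencil_linearity a b hne ⟨t, hda, hdb⟩ with (h1 | h1) | h1
  · exact Or.inl h1
  · obtain ⟨h2, h3, h4⟩ := hS.isLoop_of_minus_of_minus h (hS.lower_minus _ _ h1)
    exact Or.inr (Or.inr ⟨h2, h3, h4, h1⟩)
  · exact Or.inr (Or.inl h1)

theorem lower_of_minus {a b : S.Face (k + 1)} (h : S.minus a b)
    (hl : ¬ S.IsLoop a ∨ ¬ S.IsLoop b) (h1 : ¬ S.upper a b) (h2 : ¬ S.upper b a) :
    S.lower a b := by
  have hne : a ≠ b := by
    rintro rfl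
    exact hS.not_minus_of_nonloop hl h h
  rcases hS.lower_or_of_minus h hne with h | (h | h) | h
  · exact h
  · exact absurd h h1
  · exact absurd h h2
  · exact (hl.elim (fun h' => h' h.1) (fun h' => h' h.2.1)).elim

/-- Non-loops with the same codomain are comparable in the upper order. -/
theorem comparable_of_cod_eq {a b : S.Face (k + 1)} (ha : ¬ S.IsLoop a) (hb : ¬ S.IsLoop b)
    (h : S.cod a = S.cod b) : a = b ∨ S.upper a b ∨ S.upper b a := by
  by_cases hne : a = b
  · exact Or.inl hne
  have key : ∀ a b : S.Face (k + 1), ¬ S.IsLoop b → S.cod a = S.cod b → ¬ S.lower a b := by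
    intro a b hb h hl
    obtain ⟨d, hd, hle⟩ := minus_iff.1 (hS.lower_minus _ _ hl)
    exact hS.upper_irrefl _ ((h ▸ hle).trans_lt (upper_of_mem_dom hb hd))
  rcases hS.pencil_linearity a b hne ⟨S.cod a, mem_theta.2 (Or.inr rfl),
    mem_theta.2 (Or.inr h.symm)⟩ with (h1 | h1) | h1
  · exact absurd h1 (key _ _ hb h)
  · exact absurd h1 (key _ _ ha h.symm)
  · exact Or.inr h1

/-- Non-loops whose domains meet are comparable in the upper order. -/
theorem comparable_of_mem_dom {a b : S.Face (k + 1)} {z : S.Face k} (ha : ¬ S.IsLoop a)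
    (hb : ¬ S.IsLoop b) (hza : Cell.face z ∈ S.dom a) (hzb : Cell.face z ∈ S.dom b) :
    a = b ∨ S.upper a b ∨ S.upper b a := by
  by_cases hne : a = b
  · exact Or.inl hne
  have key : ∀ a b : S.Face (k + 1), ¬ S.IsLoop a → Cell.face z ∈ S.dom a →
      Cell.face z ∈ S.dom b → ¬ S.lower a b := by
    intro a b ha hza hzb hl
    obtain ⟨d, hd, hle⟩ := minus_iff.1 (hS.lower_minus _ _ hl)
    exact (hS.local_discreteness b z d hzb hd).1 ((upper_of_mem_dom ha hza).trans_le hle)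
  rcases hS.pencil_linearity a b hne ⟨z, Or.inl hza, Or.inl hzb⟩ with (h1 | h1) | h1
  · exact absurd h1 (key _ _ ha hza hzb)
  · exact absurd h1 (key _ _ hb hzb hza)
  · exact Or.inr h1

/-- A codomain other than γγ(Φ) enters a further non-loop of δ(Φ), whose codomain is strictly
higher; by finiteness the climb ends at γγ(Φ). -/
theorem cod_le_cod_cod {Φ : S.Face (k + 2)} (t : S.Face (k + 1)) (ht : Cell.face t ∈ S.dom Φ) :
    S.upperEq (S.cod t) (S.cod (S.cod Φ)) := by
  obtain ⟨x, hx⟩ : ∃ x, S.cod t = x := ⟨_, rfl⟩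
  induction x using (hS.faceGlobular.upper_wf_flip k).induction generalizing t with
  | _ x ih =>
    subst hx
    by_cases he : S.cod t = S.cod (S.cod Φ)
    · exact Or.inl he
    obtain ⟨p, hp, hpl, hc⟩ := hS.faceGlobular.exists_nonloop_out ht he
    have h1 := upper_of_mem_dom hpl hc
    exact (h1.trans_le (ih _ h1 p hp rfl)).le

theorem cod_mono {a b : S.Face (k + 1)} (h : S.upper a b) :
    S.upperEq (S.cod a) (S.cod b) := by
  induction h with
  | single h =>
    obtain ⟨Φ, _, ha, rfl⟩ := h
    exact hS.cod_le_cod_cod a ha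
  | tail _ h ih =>
    obtain ⟨Φ, _, ha, rfl⟩ := h
    exact ih.trans (hS.cod_le_cod_cod _ ha)

theorem cod_mono_le {a b : S.Face (k + 1)} (h : S.upperEq a b) :
    S.upperEq (S.cod a) (S.cod b) := by
  rcases h with rfl | h
  · exact .refl _
  · exact hS.cod_mono h

/-- The faces above a face are linearly ordered by the upper order. -/
theorem comparable_of_upper {a b c : S.Face k} (hb : S.upperEq a b) (hc : S.upperEq a c) :
    b = c ∨ S.upper b c ∨ S.upper c b := by
  induction a using (hS.faceGlobular.upper_wf_flip k).induction with
  | _ a ih =>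
    rcases hb with rfl | hb
    · rcases hc with rfl | hc
      · exact Or.inl rfl
      · exact Or.inr (Or.inl hc)
    rcases hc with rfl | hc
    · exact Or.inr (Or.inr hb)
    obtain ⟨α, hα, h1, h2⟩ := exists_first_link hb
    obtain ⟨β, hβ, h3, h4⟩ := exists_first_link hc
    rcases hS.comparable_of_mem_dom hα hβ h1 h3 with rfl | h | h
    · exact ih _ (upper_of_mem_dom hα h1) h2 h4
    · exact ih _ (upper_of_mem_dom hα h1) h2 ((hS.cod_mono h).trans h4)
    · exact ih _ (upper_of_mem_dom hβ h3) ((hS.cod_mono h).trans h2) h4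

/-- A non-loop in a domain is connected to a non-loop at the root. -/
theorem exists_root {Φ : S.Face (k + 2)} (p : S.Face (k + 1)) (hp : Cell.face p ∈ S.dom Φ)
    (hpl : ¬ S.IsLoop p) : ∃ p', Cell.face p' ∈ S.dom Φ ∧ ¬ S.IsLoop p' ∧
      S.cod p' = S.cod (S.cod Φ) ∧
      ∀ c, Cell.face c ∈ S.dom p → ∃ d, Cell.face d ∈ S.dom p' ∧ S.upperEq c d := by
  obtain ⟨x, hx⟩ : ∃ x, S.cod p = x := ⟨_, rfl⟩
  induction x using (hS.faceGlobular.upper_wf_flip k).induction generalizing p with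
  | _ x ih =>
    subst hx
    by_cases he : S.cod p = S.cod (S.cod Φ)
    · exact ⟨p, hp, hpl, he, fun c hc => ⟨c, hc, .refl _⟩⟩
    obtain ⟨q, hq, hql, hc⟩ := hS.faceGlobular.exists_nonloop_out hp he
    obtain ⟨p', h1, h2, h3, h4⟩ := ih _ (upper_of_mem_dom hql hc) q hq hql rfl
    obtain ⟨d, hd, hle⟩ := h4 _ hc
    exact ⟨p', h1, h2, h3, fun c hc' => ⟨d, hd, (upperEq_of_mem_dom hc').trans hle⟩⟩

/-- A non-loop in δ(Φ) would lead to one at the root, with codomain γγ(Φ). When γ(Φ) is a loop this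
face lies in δγ(Φ), where globularity forbids it to be the codomain of a non-loop of δ(Φ). -/
theorem isLoop_of_mem_dom {Φ : S.Face (k + 2)} (h : S.IsLoop (S.cod Φ)) {a : S.Face (k + 1)}
    (ha : Cell.face a ∈ S.dom Φ) : S.IsLoop a ∧ S.cod a = S.cod (S.cod Φ) := by
  have key : ∀ p, Cell.face p ∈ S.dom Φ → S.IsLoop p := by
    intro p hp
    by_contra hpl
    obtain ⟨p', h1, h2, h3, -⟩ := hS.exists_root p hp hpl
    exact hS.faceGlobular.cod_ne_of_mem_dom_cod h.cod_mem h1 h2 h3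
  refine ⟨key a ha, ?_⟩
  by_contra he
  obtain ⟨p, hp, hpl, -⟩ := hS.faceGlobular.exists_nonloop_out ha he
  exact hpl (key p hp)

theorem isLoop_of_upper {a s : S.Face (k + 1)} (h : S.upper a s) (hs : S.IsLoop s) :
    S.IsLoop a ∧ S.cod a = S.cod s := by
  induction h using Relation.TransGen.head_induction_on with
  | single h =>
    obtain ⟨Φ, _, ha, rfl⟩ := h
    exact hS.isLoop_of_mem_dom hs ha
  | head h _ ih =>
    obtain ⟨Φ, _, ha, rfl⟩ := h
    obtain ⟨h1, h2⟩ := hS.isLoop_of_mem_dom ih.1 ha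
    exact ⟨h1, h2.trans ih.2⟩

theorem isLoop_of_upperEq {a s : S.Face (k + 1)} (h : S.upperEq a s) (hs : S.IsLoop s) :
    S.IsLoop a ∧ S.cod a = S.cod s := by
  rcases h with rfl | h
  · exact ⟨hs, rfl⟩
  · exact hS.isLoop_of_upper h hs

/-- Below every loop there is a loop filled by a face with empty domain. -/
theorem exists_isEmptyDomain_le (b : S.Face (k + 1)) (hb : S.IsLoop b) :
    ∃ α : S.Face (k + 2), S.IsEmptyDomain α ∧ S.upperEq (S.cod α) b ∧
      S.cod (S.cod α) = S.cod b := by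
  induction b using (hS.faceGlobular.upper_wf (k + 1)).induction with
  | _ b ih =>
    obtain ⟨α, hα, rfl⟩ := hS.loop_filling b hb
    rcases isEmptyDomain_or_exists α with he | ⟨t, ht⟩
    · exact ⟨α, he, .refl _, rfl⟩
    · obtain ⟨h1, h2⟩ := hS.isLoop_of_mem_dom hb ht
      have h3 := upper_of_mem_dom hα ht
      obtain ⟨β, h4, h5, h6⟩ := ih t h3 h1
      exact ⟨β, h4, (h5.trans_lt h3).le, h6.trans h2⟩

/-- At each link Φ on the way from z to z' the codomain does not change, so z is the root of δ(Φ).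
Everything in δγ(Φ) then flows through δ(Φ) into δ(z). -/
theorem exists_le_dom_of_upperEq_of_cod_eq {z z' : S.Face (k + 1)} (h : S.upperEq z z')
    (hz : ¬ S.IsLoop z) (he : S.cod z = S.cod z') {c : S.Face k} (hc : Cell.face c ∈ S.dom z') :
    ∃ d, Cell.face d ∈ S.dom z ∧ S.upperEq c d := by
  induction z using (hS.faceGlobular.upper_wf_flip (k + 1)).induction with
  | _ z ih =>
    rcases h with rfl | h
    · exact ⟨c, hc, .refl _⟩
    obtain ⟨Φ, hΦ, hzΦ, hle⟩ := exists_first_link h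
    have hl : ¬ S.IsLoop (S.cod Φ) := fun hl => hz (hS.isLoop_of_mem_dom hl hzΦ).1
    have he' : S.cod z = S.cod (S.cod Φ) := hS.faceGlobular.upperEq_antisymm
      (hS.cod_le_cod_cod z hzΦ) (he ▸ hS.cod_mono_le hle)
    obtain ⟨d, hd, hcd⟩ := ih _ (upper_of_mem_dom hΦ hzΦ) hle hl (he' ▸ he)
    obtain ⟨p, hp, hpl, hdp⟩ := hS.faceGlobular.exists_nonloop_mem_dom hl hd
    obtain ⟨p', h1, h2, h3, h4⟩ := hS.exists_root p hp hpl
    obtain ⟨e, he1, he2⟩ := h4 d hdp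
    have : p' = z := by
      rcases hS.comparable_of_cod_eq h2 hz (h3.trans he'.symm) with h5 | h5 | h5
      · exact h5
      · exact absurd h5 (hS.local_discreteness Φ _ _ h1 hzΦ).1
      · exact absurd h5 (hS.local_discreteness Φ _ _ h1 hzΦ).2
    subst this
    exact ⟨e, he1, hcd.trans he2⟩

/-! ### Chains inside a convex subset -/

section Convex

variable {X : Subhypergraph S.toHypergraph} (hX : X.IsConvex)
include hX

omit hS in
theorem exists_last_link_of_isConvex {a b : S.Face k} (ha : a ∈ X.faces k) (hb : b ∈ X.faces k)
    (h : S.upper a b) : ∃ α ∈ X.faces (k + 1), ¬ S.IsLoop α ∧ S.cod α = b ∧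
      ∃ c ∈ X.faces k, Cell.face c ∈ S.dom α ∧ S.upperEq a c := by
  have h' := (hX.2 k a ha b hb).2 h
  obtain ⟨c, hac, α, hαX, hα, hc, rfl⟩ := Relation.TransGen.tail'_iff.1 h'
  have hcX : c ∈ X.faces k := X.δ_mem (.face α) hαX _ hc
  refine ⟨α, hαX, hα, rfl, c, hcX, hc, ?_⟩
  rcases Relation.reflTransGen_iff_eq_or_transGen.1 hac with rfl | h
  · exact .refl _
  · exact upper.le ((hX.2 k a ha c hcX).1 h)

omit hS in
theorem exists_first_link_of_isConvex {a b : S.Face k} (ha : a ∈ X.faces k)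
    (hb : b ∈ X.faces k) (h : S.upper a b) : ∃ α ∈ X.faces (k + 1), ¬ S.IsLoop α ∧
      Cell.face a ∈ S.dom α ∧ S.upperEq (S.cod α) b := by
  have h' := (hX.2 k a ha b hb).2 h
  obtain ⟨c, ⟨α, hαX, hα, hc, rfl⟩, hac⟩ := Relation.TransGen.head'_iff.1 h'
  have hcX : S.cod α ∈ X.faces k := X.γ_mem (.face α) hαX
  refine ⟨α, hαX, hα, hc, ?_⟩
  rcases Relation.reflTransGen_iff_eq_or_transGen.1 hac with h | h
  · exact Or.inl h.symm
  · exact upper.le ((hX.2 k _ hcX b hb).1 h)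

/-- A face s below δ(y) either still sees the domain of x after the passage from y up to x, or has
been absorbed into x; in the latter case a non-loop below x ends at s. Working inside X matters
because empty loops are codomains of no non-loop of X. -/
theorem le_dom_or_exists_of_upperEq {s c : S.Face k} {y x : S.Face (k + 1)}
    (hs : s ∈ X.faces k) (hy : y ∈ X.faces (k + 1)) (hx : x ∈ X.faces (k + 1))
    (hyx : S.upperEq y x) (hc : Cell.face c ∈ S.dom y) (hsc : S.upperEq s c) :
    (∃ d, Cell.face d ∈ S.dom x ∧ S.upperEq s d) ∨
      ∃ y' ∈ X.faces (k + 1), ¬ S.IsLoop y' ∧ S.upper y' x ∧ S.cod y' = s := by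
  induction x using (hS.faceGlobular.upper_wf (k + 1)).induction generalizing y c with
  | _ x ih =>
    rcases hyx with rfl | hyx
    · exact Or.inl ⟨c, hc, hsc⟩
    obtain ⟨Φ, hΦX, hΦ, rfl, y₁, hy₁X, hy₁, hyy₁⟩ := exists_last_link_of_isConvex hX hy hx hyx
    have hlt := upper_of_mem_dom hΦ hy₁
    rcases ih y₁ hlt hy hy₁X hyy₁ hc hsc with h | ⟨y', h1, h2, h3, h4⟩
    swap
    · exact Or.inr ⟨y', h1, h2, h3.trans hlt, h4⟩
    -- A minimal such d survives in δγ(Φ) unless a non-loop z of δ(Φ) ends there. In that case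
    -- minimality keeps s from lying below δ(z), and the induction hypothesis at z yields the
    -- non-loop ending at s.
    let D : Set (S.Face k) := {d | (∃ p, Cell.face p ∈ S.dom Φ ∧ Cell.face d ∈ S.dom p) ∧
      S.upperEq s d}
    have hD : D.Nonempty := by
      obtain ⟨d, hd, hsd⟩ := h
      exact ⟨d, ⟨y₁, hy₁, hd⟩, hsd⟩
    obtain ⟨d, ⟨⟨p, hp, hdp⟩, hsd⟩, hmin⟩ := (hS.faceGlobular.upper_wf k).has_min D hD
    by_cases hz : ∃ z, Cell.face z ∈ S.dom Φ ∧ ¬ S.IsLoop z ∧ S.cod z = d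
    swap
    · push Not at hz
      exact Or.inl ⟨d, hS.faceGlobular.mem_dom_cod hp hdp hz, hsd⟩
    obtain ⟨z, hzΦ, hzl, rfl⟩ := hz
    have hzX : z ∈ X.faces (k + 1) := X.δ_mem (.face Φ) hΦX _ hzΦ
    have hzlt := upper_of_mem_dom hΦ hzΦ
    rcases hsd with rfl | hsd
    · exact Or.inr ⟨z, hzX, hzl, hzlt, rfl⟩
    obtain ⟨z', hz'X, hz'l, hze, c', hc'X, hc', hsc'⟩ :=
      exists_last_link_of_isConvex hX hs (X.γ_mem (.face z) hzX) hsd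
    have contra : ∀ e, Cell.face e ∈ S.dom z → ¬ S.upperEq s e := fun e he hse =>
      hmin e ⟨⟨z, hzΦ, he⟩, hse⟩ (upper_of_mem_dom hzl he)
    rcases hS.comparable_of_cod_eq hz'l hzl hze with rfl | hlt' | hlt'
    · exact absurd hsc' (contra c' hc')
    · rcases ih z hzlt hz'X hzX hlt'.le hc' hsc' with ⟨e, he, hse⟩ | ⟨y', h1, h2, h3, h4⟩
      · exact absurd hse (contra e he)
      · exact Or.inr ⟨y', h1, h2, h3.trans hzlt, h4⟩
    · obtain ⟨e, he, hce⟩ := hS.exists_le_dom_of_upperEq_of_cod_eq hlt'.le hzl hze.symm hc'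
      exact absurd (hsc'.trans hce) (contra e he)

/-- A face below the codomain of a non-loop `x` is below a face in the domain of `x`, or it is
the codomain of a non-loop below `x`. -/
theorem le_dom_or_exists_of_upper_cod {s : S.Face k} {x : S.Face (k + 1)}
    (hs : s ∈ X.faces k) (hx : x ∈ X.faces (k + 1)) (hxl : ¬ S.IsLoop x)
    (h : S.upper s (S.cod x)) :
    (∃ d, Cell.face d ∈ S.dom x ∧ S.upperEq s d) ∨
      ∃ y' ∈ X.faces (k + 1), ¬ S.IsLoop y' ∧ S.upper y' x ∧ S.cod y' = s := by
  obtain ⟨y, hyX, hyl, hye, c, hcX, hc, hsc⟩ :=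
    exists_last_link_of_isConvex hX hs (X.γ_mem (.face x) hx) h
  rcases hS.comparable_of_cod_eq hyl hxl hye with rfl | hlt | hlt
  · exact Or.inl ⟨c, hc, hsc⟩
  · exact hS.le_dom_or_exists_of_upperEq hX hs hyX hx hlt.le hc hsc
  · obtain ⟨e, he, hce⟩ := hS.exists_le_dom_of_upperEq_of_cod_eq hlt.le hxl hye.symm hc
    exact Or.inl ⟨e, he, hsc.trans hce⟩

end Convex

theorem exists_nonloop_cod_eq_upper {s : S.Face k} {x : S.Face (k + 1)} (hxl : ¬ S.IsLoop x)
    (h : S.upper s (S.cod x)) (hn : ∀ d, Cell.face d ∈ S.dom x → ¬ S.upperEq s d) :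
    ∃ y, ¬ S.IsLoop y ∧ S.upper y x ∧ S.cod y = s := by
  rcases hS.le_dom_or_exists_of_upper_cod hS.isConvex_univ trivial trivial hxl h with
    ⟨d, hd, hsd⟩ | ⟨y, -, hy⟩
  · exact absurd hsd (hn d hd)
  · exact ⟨y, hy⟩

/-- Companion of `exists_nonloop_cod_eq_upper` for non-loops leaving s. The first link β out of s
ends at γ(x) or at a face which is itself interior to x; comparing β with x, or with the non-loop
below x that has the same codomain as β, puts β below x. -/
theorem exists_nonloop_mem_dom_upper {s : S.Face k} {x : S.Face (k + 1)} (hxl : ¬ S.IsLoop x)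
    (h : S.upper s (S.cod x)) (hn : ∀ d, Cell.face d ∈ S.dom x → ¬ S.upperEq s d) :
    ∃ y, ¬ S.IsLoop y ∧ S.upper y x ∧ Cell.face s ∈ S.dom y := by
  induction s using (hS.faceGlobular.upper_wf_flip k).induction with
  | _ s ih =>
    obtain ⟨β, hβ, hsβ, hle⟩ := exists_first_link h
    have hlt := upper_of_mem_dom hβ hsβ
    rcases hle with he | hle
    · rcases hS.comparable_of_cod_eq hβ hxl he with rfl | h1 | h1
      · exact absurd (.refl _) (hn s hsβ)
      · exact ⟨β, hβ, h1, hsβ⟩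
      · obtain ⟨e, he1, he2⟩ :=
          hS.exists_le_dom_of_upperEq_of_cod_eq h1.le hxl he.symm hsβ
        exact absurd he2 (hn e he1)
    · obtain ⟨y, hy, hyx, hye⟩ := hS.exists_nonloop_cod_eq_upper hxl hle
        fun d hd hd' => hn d hd (hlt.trans_le hd').le
      rcases hS.comparable_of_cod_eq hβ hy hye.symm with rfl | h1 | h1
      · exact ⟨β, hβ, hyx, hsβ⟩
      · exact ⟨β, hβ, h1.trans hyx, hsβ⟩
      · rcases hS.comparable_of_upper h1.le hyx.le with rfl | h2 | h2
        · exact absurd hle (hS.upper_irrefl _)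
        · exact ⟨β, hβ, h2, hsβ⟩
        · exact absurd hle (hS.faceGlobular.not_upper_of_le (hS.cod_mono h2))

/-- Non-loops of a domain are separated by the domains of faces below them. -/
theorem eq_of_upper_of_mem_dom {Φ : S.Face (k + 2)} {p q β : S.Face (k + 1)} {d : S.Face k}
    (hp : Cell.face p ∈ S.dom Φ) (hq : Cell.face q ∈ S.dom Φ) (hql : ¬ S.IsLoop q)
    (hβl : ¬ S.IsLoop β) (hβ : S.upperEq β p)
    (hd : (Cell.face d ∈ S.dom β ∧ Cell.face d ∈ S.dom q) ∨ S.cod β = d ∧ S.cod q = d) :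
    q = p := by
  have h : β = q ∨ S.upper β q ∨ S.upper q β := by
    rcases hd with ⟨h1, h2⟩ | ⟨h1, h2⟩
    · exact hS.comparable_of_mem_dom hβl hql h1 h2
    · exact hS.comparable_of_cod_eq hβl hql (h1.trans h2.symm)
  have h' : q = p ∨ S.upper q p ∨ S.upper p q := by
    rcases h with rfl | h | h
    · exact hβ.imp_right Or.inl
    · exact hS.comparable_of_upper h.le hβ
    · exact Or.inr (Or.inl (h.trans_le hβ))
  rcases h' with h | h | h
  · exact h
  · exact absurd h (hS.local_discreteness Φ _ _ hq hp).1
  · exact absurd h (hS.local_discreteness Φ _ _ hq hp).2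

/-- If γ(t) were strictly below d, climbing through δ(Φ) would give a non-loop p with γ(t) in δ(p)
and d strictly below γ(p). By local discreteness d is interior to p, so a non-loop below p leaves d.
A non-loop q of δ(Φ) leaves d as well, which forces q = p, so d would lie in δ(p) after all. -/
theorem not_upper_cod_of_mem_dom_cod {Φ : S.Face (k + 2)} {d : S.Face k}
    (hd : Cell.face d ∈ S.dom (S.cod Φ)) (t : S.Face (k + 1)) (ht : Cell.face t ∈ S.dom Φ) :
    ¬ S.upper (S.cod t) d := by
  intro hlt
  by_cases hl : S.IsLoop (S.cod Φ)
  · rw [hl.eq_cod hd, (hS.isLoop_of_mem_dom hl ht).2] at hlt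
    exact hS.upper_irrefl _ hlt
  obtain ⟨q, hq, hql, hdq⟩ := hS.faceGlobular.exists_nonloop_mem_dom hl hd
  obtain ⟨x, hx⟩ : ∃ x, S.cod t = x := ⟨_, rfl⟩
  induction x using (hS.faceGlobular.upper_wf_flip k).induction generalizing t with
  | _ x ih =>
    subst hx
    have hne : S.cod t ≠ S.cod (S.cod Φ) := by
      intro he
      rw [he] at hlt
      exact hS.faceGlobular.not_upper_of_le (upperEq_of_mem_dom hd) hlt
    obtain ⟨p, hp, hpl, htp⟩ := hS.faceGlobular.exists_nonloop_out ht hne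
    have h1 := upper_of_mem_dom hpl htp
    have h2 : S.upper d (S.cod p) := by
      rcases hS.comparable_of_upper hlt.le h1.le with h | h | h
      · exact absurd h.symm (hS.faceGlobular.cod_ne_of_mem_dom_cod hd hp hpl)
      · exact h
      · exact absurd rfl (ih _ h1 p hp h)
    have hn : ∀ e, Cell.face e ∈ S.dom p → ¬ S.upperEq d e := fun e he hde =>
      (hS.local_discreteness p _ _ htp he).1 (hlt.trans_le hde)
    obtain ⟨β, hβl, hβ, hdβ⟩ := hS.exists_nonloop_mem_dom_upper hpl h2 hn
    have := hS.eq_of_upper_of_mem_dom hp hq hql hβl hβ.le (Or.inl ⟨hdβ, hdq⟩)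
    subst this
    exact hn d hdq (.refl _)

/-- The orders `<⁺` and `<⁻` are disjoint up to loops at the domain of the larger face. -/
theorem isLoop_of_upper_of_minus {a b : S.Face (k + 1)} (h : S.upper a b) (h' : S.minus a b) :
    S.IsLoop a ∧ Cell.face (S.cod a) ∈ S.dom b := by
  induction b using (hS.faceGlobular.upper_wf (k + 1)).induction with
  | _ b ih =>
    obtain ⟨d, hd, had⟩ := minus_iff.1 h'
    by_cases hbl : S.IsLoop b
    · obtain ⟨h1, h2⟩ := hS.isLoop_of_upper h hbl
      exact ⟨h1, h2 ▸ hbl.cod_mem⟩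
    obtain ⟨Φ, hΦ, rfl, a₁, ha₁, haa₁⟩ := exists_last_link h
    have key := hS.not_upper_cod_of_mem_dom_cod hd a₁ ha₁
    rcases hS.comparable_of_upper (hS.cod_mono_le haa₁) had with h1 | h1 | h1
    · have hl : S.IsLoop a₁ := by
        by_contra hl
        exact hS.faceGlobular.cod_ne_of_mem_dom_cod hd ha₁ hl h1
      obtain ⟨h2, h3⟩ := hS.isLoop_of_upperEq haa₁ hl
      exact ⟨h2, h3 ▸ h1 ▸ hd⟩
    · exact absurd h1 key
    · rcases haa₁ with rfl | haa₁
      · exact absurd h1 (hS.faceGlobular.not_upper_of_le had)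
      have ha₁l : ¬ S.IsLoop a₁ := by
        intro hl
        rw [(hS.isLoop_of_upper haa₁ hl).2] at had
        exact hS.faceGlobular.not_upper_of_le had h1
      obtain ⟨q, hq, hql, hdq⟩ := hS.faceGlobular.exists_nonloop_mem_dom hbl hd
      -- Either d is below δ(a₁), and the induction hypothesis applies to a₁, or d is interior to
      -- a₁, and the non-loop q of δ(Φ) leaving d would have to be a₁ itself.
      by_cases hn : ∃ e, Cell.face e ∈ S.dom a₁ ∧ S.upperEq d e
      · obtain ⟨e, he, hde⟩ := hn
        obtain ⟨h2, h3⟩ := ih a₁ (upper_of_mem_dom hΦ ha₁) haa₁ (minus_of_le he (had.trans hde))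
        have h4 := hS.eq_of_upperEq_of_mem_dom h3 he (had.trans hde)
        have h5 : S.cod a = d := hS.faceGlobular.upperEq_antisymm had (h4 ▸ hde)
        exact ⟨h2, h5 ▸ hd⟩
      · push Not at hn
        obtain ⟨β, hβl, hβ, hdβ⟩ := hS.exists_nonloop_mem_dom_upper ha₁l h1 hn
        have := hS.eq_of_upper_of_mem_dom ha₁ hq hql hβl hβ.le (Or.inl ⟨hdβ, hdq⟩)
        subst this
        exact absurd (.refl _) (hn d hdq)

theorem isLoop_of_upper_of_minus' {a b : S.Face (k + 1)} (h : S.upper a b) (h' : S.minus b a) :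
    S.IsLoop a ∧ S.cod a = S.cod b := by
  obtain ⟨d, hd, hle⟩ := minus_iff.1 h'
  have h1 := upperEq_of_mem_dom hd
  have h2 := hS.cod_mono h
  have e1 : S.cod a = d := hS.faceGlobular.upperEq_antisymm (h2.trans hle) h1
  refine ⟨hS.faceGlobular.isLoop_of_cod_mem (e1 ▸ hd), hS.faceGlobular.upperEq_antisymm h2
    (hle.trans h1)⟩

/-- If the codomain of a face below a face `d` of a domain is incident to some face of the domain,
then it is incident to `d`. -/
theorem mem_theta_of_upperEq {x : S.Face (k + 2)} {b d t : S.Face (k + 1)} {w : S.Face k}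
    (hb : S.cod b = w) (hbd : S.upperEq b d) (hd : Cell.face d ∈ S.dom x)
    (ht : Cell.face t ∈ S.dom x) (hwt : Cell.face w ∈ S.theta t) : Cell.face w ∈ S.theta d := by
  rcases hbd with rfl | hbd
  · exact mem_theta.2 (Or.inr hb)
  subst hb
  rcases hS.cod_mono hbd with he | hlt
  · exact mem_theta.2 (Or.inr he.symm)
  by_cases hn : ∃ e, Cell.face e ∈ S.dom d ∧ S.upperEq (S.cod b) e
  · obtain ⟨e, he, hbe⟩ := hn
    exact Or.inl (hS.isLoop_of_upper_of_minus hbd (minus_of_le he hbe)).2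
  push Not at hn
  have hdl : ¬ S.IsLoop d := by
    intro hdl
    rw [(hS.isLoop_of_upper hbd hdl).2] at hlt
    exact hS.upper_irrefl _ hlt
  obtain ⟨β, hβl, hβ, hwβ⟩ := hS.exists_nonloop_mem_dom_upper hdl hlt hn
  obtain ⟨y, hyl, hy, hyw⟩ := hS.exists_nonloop_cod_eq_upper hdl hlt hn
  by_cases htl : S.IsLoop t
  · have h1 := htl.mem_theta_iff.1 hwt
    have h2 : S.cod t ≠ S.cod (S.cod x) := by
      intro h2
      rw [← h1, h2] at hlt
      exact hS.faceGlobular.not_upper_of_le (hS.cod_le_cod_cod d hd) hlt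
    obtain ⟨p, hp, hpl, hcp⟩ := hS.faceGlobular.exists_nonloop_out ht h2
    have := hS.eq_of_upper_of_mem_dom hd hp hpl hβl hβ.le (Or.inl ⟨hwβ, h1 ▸ hcp⟩)
    subst this
    exact Or.inl (h1 ▸ hcp)
  · have : t = d := by
      rcases mem_theta.1 hwt with h | h
      · exact hS.eq_of_upper_of_mem_dom hd ht htl hβl hβ.le (Or.inl ⟨hwβ, h⟩)
      · exact hS.eq_of_upper_of_mem_dom hd ht htl hyl hy.le (Or.inr ⟨hyw, h⟩)
    exact this ▸ hwt

/-- On the way from y up to s the codomain has to change at some link Φ. There c ends one non-loop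
of δ(Φ) and starts another. This provides the hypothesis of the second pencil axiom. -/
theorem exists_internal {y s : S.Face (k + 1)} {c : S.Face k} (hy : ¬ S.IsLoop y)
    (hys : S.upper y s) (hyc : S.cod y = c) (hc : S.cod s ≠ c) :
    ∃ Φ : S.Face (k + 2), ¬ S.IsLoop Φ ∧ S.upperEq (S.cod Φ) s ∧ c ∈ S.internal Φ := by
  induction y using (hS.faceGlobular.upper_wf_flip (k + 1)).induction with
  | _ y ih =>
    obtain ⟨Φ, hΦ, hyΦ, hle⟩ := exists_first_link hys
    by_cases he : S.cod (S.cod Φ) = c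
    · have hlt : S.upper (S.cod Φ) s := by
        rcases hle with h | h
        · exact absurd (h ▸ he) hc
        · exact h
      exact ih _ (upper_of_mem_dom hΦ hyΦ) (fun hl => hy (hS.isLoop_of_mem_dom hl hyΦ).1) hlt he
    · obtain ⟨p, hp, hpl, hcp⟩ := hS.faceGlobular.exists_nonloop_out hyΦ
        (fun h => he (h ▸ hyc))
      exact ⟨Φ, hΦ, hle, y, ⟨hyΦ, hy⟩, p, ⟨hp, hpl⟩, hyc, hyc ▸ hcp⟩

/-- Faces with comparable codomains are comparable in one of the orders. -/
theorem comparable_of_cod_le {s t : S.Face (k + 1)} (h : S.upperEq (S.cod s) (S.cod t)) :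
    s = t ∨ (S.lower s t ∨ S.lower t s) ∨ (S.upper s t ∨ S.upper t s) := by
  by_cases hne : s = t
  · exact Or.inl hne
  right
  rcases h with h | h
  · exact hS.pencil_linearity s t hne ⟨S.cod s, mem_theta.2 (Or.inr rfl),
      mem_theta.2 (Or.inr h.symm)⟩
  by_cases hn : ∃ e, Cell.face e ∈ S.dom t ∧ S.upperEq (S.cod s) e
  · obtain ⟨e, he, hse⟩ := hn
    rcases hS.lower_or_of_minus (minus_of_le he hse) hne with h | h | ⟨_, _, _, h⟩
    · exact Or.inl (Or.inl h)
    · exact Or.inr h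
    · exact Or.inl (Or.inr h)
  push Not at hn
  -- What remains is γ(s) interior to t, so that a non-loop y below t has codomain γ(s). A non-loop
  -- s is comparable with y; a loop s lies above the codomain of an empty domain face, which the
  -- second pencil axiom places relative to t.
  have htl : ¬ S.IsLoop t := fun htl => hn _ htl.cod_mem h.le
  obtain ⟨y, hyl, hyt, hye⟩ := hS.exists_nonloop_cod_eq_upper htl h hn
  by_cases hsl : S.IsLoop s
  · obtain ⟨Φ, hΦ, hle, hι⟩ := hS.exists_internal hyl hyt hye
      (fun he => hS.upper_irrefl _ (he ▸ h))
    obtain ⟨α, hα, hαs, hαc⟩ := hS.exists_isEmptyDomain_le s hsl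
    have hαt : S.upperEq (S.cod α) t := by
      rcases hS.pencil_linearity_internal α Φ hα (hαc ▸ hι) with h1 | h1
      · obtain ⟨d, hd, hle'⟩ := minus_iff.1 (hS.lower_minus _ _ h1)
        exact hle'.trans ((upperEq_of_mem_dom hd).trans hle)
      · exact (hS.cod_mono h1).trans hle
    rcases hS.comparable_of_upper hαs hαt with h1 | h1
    · exact absurd h1 hne
    · exact Or.inr h1
  · rcases hS.comparable_of_cod_eq hsl hyl hye.symm with rfl | h1 | h1
    · exact Or.inr (Or.inl hyt)
    · exact Or.inr (Or.inl (h1.trans hyt))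
    · rcases hS.comparable_of_upper h1.le hyt.le with h2 | h2
      · exact absurd h2 hne
      · exact Or.inr h2

/-- A face left by a non-loop of δ(x) but not internal is cancelled by nothing and stays in δγ(x). A
face left by no non-loop of δ(x) can only be γγ(x). -/
theorem mem_theta_cod_of_not_internal {x : S.Face (k + 2)} {t : S.Face (k + 1)} {w : S.Face k}
    (ht : Cell.face t ∈ S.dom x) (hw : Cell.face w ∈ S.theta t) (hι : w ∉ S.internal x) :
    Cell.face w ∈ S.theta (S.cod x) := by
  by_cases ho : ∃ q, Cell.face q ∈ S.dom x ∧ ¬ S.IsLoop q ∧ Cell.face w ∈ S.dom q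
  · obtain ⟨q, hq, hql, hwq⟩ := ho
    refine Or.inl (hS.faceGlobular.mem_dom_cod hq hwq fun p hp hpl he => hι ?_)
    exact ⟨p, ⟨hp, hpl⟩, q, ⟨hq, hql⟩, he, hwq⟩
  · push Not at ho
    have hc : S.cod t = w := by
      rcases mem_theta.1 hw with h | h
      · by_cases htl : S.IsLoop t
        · exact (htl.eq_cod h).symm
        · exact absurd h (ho t ht htl)
      · exact h
    subst hc
    refine mem_theta.2 (Or.inr ?_)
    by_contra hne
    obtain ⟨p, hp, hpl, hcp⟩ := hS.faceGlobular.exists_nonloop_out ht (Ne.symm hne)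
    exact ho p hp hpl hcp

/-- Faces of a domain with a common face are comparable in the lower order. -/
theorem lower_or_lower_of_mem_dom {x : S.Face (k + 2)} {s t : S.Face (k + 1)} {w : S.Face k}
    (hs : Cell.face s ∈ S.dom x) (ht : Cell.face t ∈ S.dom x) (hne : s ≠ t)
    (hws : Cell.face w ∈ S.theta s) (hwt : Cell.face w ∈ S.theta t) :
    S.lower s t ∨ S.lower t s := by
  rcases hS.pencil_linearity s t hne ⟨w, hws, hwt⟩ with h | h | h
  · exact h
  · exact absurd h (hS.local_discreteness x _ _ hs ht).1
  · exact absurd h (hS.local_discreteness x _ _ hs ht).2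

end IsOrderedFaceStructure

open FaceStructures.IsOrderedFaceStructure (minus_iff minus_of_le exists_first_link_of_isConvex
  exists_last_link_of_isConvex)

/-! ### Position of the empty loops along the domain of a face -/

section Loops

variable {T : OrderedHypergraph.{u}} (X : Subhypergraph T.toHypergraph) {k : ℕ}

/-- The empty loops over `w` before `t`. -/
def loopsBefore (w : T.Face k) (t : T.Face (k + 1)) : Set (T.Face (k + 1)) :=
  {b | b ∈ X.emptyLoopsOver w ∧ T.lower b t}

/-- The empty loops over `w` that are not after `t`. -/
def loopsUpTo (w : T.Face k) (t : T.Face (k + 1)) : Set (T.Face (k + 1)) :=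
  {b | b ∈ X.emptyLoopsOver w ∧ ¬ T.lower t b}

/-- A face is stretched if it is not a loop or if there are empty loops below it. -/
def IsStretched (t : T.Face (k + 1)) : Prop :=
  ¬ T.IsLoop t ∨ ∃ b ∈ X.emptyLoopsOver (T.cod t), T.upperEq b t

variable {X} (hT : IsOrderedFaceStructure T) (hX : X.IsConvex)

include hX in
-- By convexity the last link of a chain ending at b could be taken in X, and would fill b. So empty
-- loops are `<⁺`-minimal in X.
theorem not_upper_emptyLoop {w : T.Face k} {a b : T.Face (k + 1)} (ha : a ∈ X.faces (k + 1))
    (hb : b ∈ X.emptyLoopsOver w) : ¬ T.upper a b := by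
  intro h
  obtain ⟨α, hα, hl, he, -⟩ :=
    exists_last_link_of_isConvex hX ha hb.1.1 h
  exact hb.1.2.2 ⟨α, hα, hl, he⟩

include hX in
theorem upperEq_of_comparable {w : T.Face k} {a b : T.Face (k + 1)} (ha : a ∈ X.faces (k + 1))
    (hb : b ∈ X.emptyLoopsOver w) (h : b = a ∨ T.upper b a ∨ T.upper a b) : T.upperEq b a := by
  rcases h with h | h | h
  · exact Or.inl h
  · exact Or.inr h
  · exact absurd h (not_upper_emptyLoop hX ha hb)

include hT hX

theorem compare_emptyLoop {w : T.Face k} {b t : T.Face (k + 1)} (hb : b ∈ X.emptyLoopsOver w)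
    (ht : t ∈ X.faces (k + 1)) (hw : Cell.face w ∈ T.theta t) :
    T.lower b t ∨ T.lower t b ∨ T.upperEq b t := by
  by_cases hne : b = t
  · exact Or.inr (Or.inr (Or.inl hne))
  rcases hT.pencil_linearity b t hne ⟨w, mem_theta.2 (Or.inr hb.2), hw⟩ with (h | h) | h
  · exact Or.inl h
  · exact Or.inr (Or.inl h)
  · exact Or.inr (Or.inr (upperEq_of_comparable hX ht hb (Or.inr h)))

/-- Empty loops below the codomain of a non-loop are below a face in its domain. -/
theorem le_dom_of_upper_cod {w : T.Face k} {b : T.Face (k + 1)} {x : T.Face (k + 2)}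
    (hb : b ∈ X.emptyLoopsOver w) (hx : x ∈ X.faces (k + 2)) (hxl : ¬ T.IsLoop x)
    (h : T.upper b (T.cod x)) : ∃ d, Cell.face d ∈ T.dom x ∧ T.upperEq b d := by
  rcases hT.le_dom_or_exists_of_upper_cod hX hb.1.1 hx hxl h with h | ⟨y, hy, hyl, -, hyb⟩
  · exact h
  · exact absurd ⟨y, hy, hyl, hyb⟩ hb.1.2.2

/-- The position of the empty loops over a face in the boundary of the domain of a non-loop. -/
theorem emptyLoop_position {w : T.Face k} {b t : T.Face (k + 1)} {x : T.Face (k + 2)}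
    (hx : x ∈ X.faces (k + 2)) (hxl : ¬ T.IsLoop x) (ht : Cell.face t ∈ T.dom x)
    (hw : Cell.face w ∈ T.theta t) (hb : b ∈ X.emptyLoopsOver w) :
    (∃ d, Cell.face d ∈ T.dom x ∧ T.upperEq b d ∧ Cell.face w ∈ T.theta d) ∨
      T.lower b (T.cod x) ∨ T.lower (T.cod x) b := by
  have key : (∃ d, Cell.face d ∈ T.dom x ∧ T.upperEq b d) →
      ∃ d, Cell.face d ∈ T.dom x ∧ T.upperEq b d ∧ Cell.face w ∈ T.theta d := by
    rintro ⟨d, hd, hbd⟩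
    exact ⟨d, hd, hbd, hT.mem_theta_of_upperEq hb.2 hbd hd ht hw⟩
  have hsX : T.cod x ∈ X.faces (k + 1) := X.γ_mem (.face x) hx
  have hbs : T.upperEq b (T.cod x) → ∃ d, Cell.face d ∈ T.dom x ∧ T.upperEq b d := by
    rintro (h | h)
    · exact absurd ⟨x, hx, hxl, h.symm⟩ hb.1.2.2
    · exact le_dom_of_upper_cod hT hX hb hx hxl h
  -- For internal w the second pencil axiom compares x with an empty domain face whose codomain lies
  -- below b. Otherwise w is incident to γ(x), and b can be compared with γ(x) directly.
  by_cases hι : w ∈ T.internal x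
  · left
    apply key
    obtain ⟨α, hα, hαb, hαc⟩ := hT.exists_isEmptyDomain_le b hb.1.2.1
    rcases hT.pencil_linearity_internal α x hα (hαc ▸ hb.2 ▸ hι) with h | h
    · obtain ⟨d, hd, hle⟩ := minus_iff.1 (hT.lower_minus _ _ h)
      exact ⟨d, hd, upperEq_of_comparable hX (X.δ_mem (.face x) hx _ hd) hb
        (hT.comparable_of_upper hαb hle)⟩
    · exact hbs (upperEq_of_comparable hX hsX hb
        (hT.comparable_of_upper hαb (hT.cod_mono h)))
  · rcases compare_emptyLoop hT hX hb hsX (hT.mem_theta_cod_of_not_internal ht hw hι) with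
      h | h | h
    · exact Or.inr (Or.inl h)
    · exact Or.inr (Or.inr h)
    · exact Or.inl (key (hbs h))

omit hX hT in
theorem isStretched_of_upperEq {w : T.Face k} {b d : T.Face (k + 1)}
    (hb : b ∈ X.emptyLoopsOver w) (hbd : T.upperEq b d) (hw : Cell.face w ∈ T.theta d) :
    IsStretched X d := by
  by_cases hl : T.IsLoop d
  · have := hl.mem_theta_iff.1 hw
    exact Or.inr ⟨b, this ▸ hb, hbd⟩
  · exact Or.inl hl

section Dom

variable {x : T.Face (k + 2)} (hx : x ∈ X.faces (k + 2)) (hxl : ¬ T.IsLoop x)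
  {w : T.Face k} {t t' : T.Face (k + 1)} (ht : Cell.face t ∈ T.dom x)
include hx hxl ht

omit hX hx in
theorem not_lower_cod : ¬ T.lower t (T.cod x) ∧ ¬ T.lower (T.cod x) t :=
  have h := (upper_of_mem_dom hxl ht).le
  ⟨fun h' => hT.not_upperEq_of_lower h' h, fun h' => hT.not_upperEq_of_lower' h' h⟩

/-- An empty loop strictly between t and t' cannot be `<^∼`-related to γ(x), since t and t' lie
`<⁺`-below γ(x). So it is below some d in δ(x) through w, and that d is a stretched face between t
and t'. -/
theorem loopsUpTo_eq_loopsBefore (ht' : Cell.face t' ∈ T.dom x) (hw : T.cod t = w)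
    (hw' : Cell.face w ∈ T.dom t') (hlt : T.lower t t')
    (h : ∀ d, Cell.face d ∈ T.dom x → Cell.face w ∈ T.theta d → T.lower t d → T.lower d t' →
      ¬ IsStretched X d) : loopsUpTo X w t = loopsBefore X w t' := by
  have hwt : Cell.face w ∈ T.theta t := mem_theta.2 (Or.inr hw)
  have htX := X.δ_mem (.face x) hx _ ht
  have htX' := X.δ_mem (.face x) hx _ ht'
  ext b
  constructor
  · rintro ⟨hb, hn⟩
    refine ⟨hb, ?_⟩
    rcases compare_emptyLoop hT hX hb htX' (Or.inl hw') with h1 | h1 | h1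
    · exact h1
    · exact absurd (hT.lower_trans _ _ _ hlt h1) hn
    rcases compare_emptyLoop hT hX hb htX hwt with h2 | h2 | h2
    · exact absurd h1 (hT.not_upperEq_of_lower (hT.lower_trans _ _ _ h2 hlt))
    · exact absurd h2 hn
    rcases hT.comparable_of_upper h1 h2 with h3 | h3 | h3
    · exact absurd (h3 ▸ hlt) (hT.lower_irrefl _)
    · exact absurd h3 (hT.local_discreteness x _ _ ht' ht).1
    · exact absurd h3 (hT.local_discreteness x _ _ ht' ht).2
  · rintro ⟨hb, hbt⟩
    refine ⟨hb, fun htb => ?_⟩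
    rcases emptyLoop_position hT hX hx hxl ht hwt hb with ⟨d, hd, hbd, hwd⟩ | h1 | h1
    · have h1 : T.lower t d := by
        rcases hT.lower_or_lower_of_mem_dom ht hd
          (fun e => hT.not_upperEq_of_lower' htb (e ▸ hbd)) hwt hwd with h1 | h1
        · exact h1
        · exact absurd hbd (hT.not_upperEq_of_lower' (hT.lower_trans _ _ _ h1 htb))
      have h2 : T.lower d t' := by
        rcases hT.lower_or_lower_of_mem_dom hd ht'
          (fun e => hT.not_upperEq_of_lower hbt (e ▸ hbd)) hwd (Or.inl hw') with h2 | h2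
        · exact h2
        · exact absurd hbd (hT.not_upperEq_of_lower (hT.lower_trans _ _ _ hbt h2))
      exact h d hd hwd h1 h2 (isStretched_of_upperEq hb hbd hwd)
    · exact (not_lower_cod hT hxl ht).1 (hT.lower_trans _ _ _ htb h1)
    · exact (not_lower_cod hT hxl ht').2 (hT.lower_trans _ _ _ h1 hbt)

theorem loopsUpTo_eq_loopsUpTo_cod (hw : T.cod t = w)
    (h : ∀ d, Cell.face d ∈ T.dom x → Cell.face w ∈ T.theta d → T.lower t d →
      ¬ IsStretched X d) : loopsUpTo X w t = loopsUpTo X w (T.cod x) := by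
  have hwt : Cell.face w ∈ T.theta t := mem_theta.2 (Or.inr hw)
  have htX := X.δ_mem (.face x) hx _ ht
  have hlt := upper_of_mem_dom hxl ht
  have key : ∀ b ∈ X.emptyLoopsOver w, T.lower t b ↔ T.lower (T.cod x) b := by
    intro b hb
    constructor
    · intro htb
      have hd : ∀ d, Cell.face d ∈ T.dom x → T.upperEq b d → Cell.face w ∈ T.theta d → False := by
        intro d hd hbd hwd
        rcases hT.lower_or_lower_of_mem_dom ht hd
          (fun e => hT.not_upperEq_of_lower' htb (e ▸ hbd)) hwt hwd with h1 | h1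
        · exact h d hd hwd h1 (isStretched_of_upperEq hb hbd hwd)
        · exact hT.not_upperEq_of_lower' (hT.lower_trans _ _ _ h1 htb) hbd
      rcases emptyLoop_position hT hX hx hxl ht hwt hb with ⟨d, hd', hbd, hwd⟩ | h1 | h1
      · exact (hd d hd' hbd hwd).elim
      · exact absurd (hT.lower_trans _ _ _ htb h1) (not_lower_cod hT hxl ht).1
      · exact h1
    · intro hsb
      rcases compare_emptyLoop hT hX hb htX hwt with h1 | h1 | h1
      · exact absurd (hT.lower_trans _ _ _ hsb h1) (not_lower_cod hT hxl ht).2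
      · exact h1
      · exact absurd (h1.trans hlt.le) (hT.not_upperEq_of_lower' hsb)
  ext b
  constructor
  · rintro ⟨hb, hn⟩
    exact ⟨hb, fun h' => hn ((key b hb).2 h')⟩
  · rintro ⟨hb, hn⟩
    exact ⟨hb, fun h' => hn ((key b hb).1 h')⟩

theorem loopsBefore_eq_loopsBefore_cod (hw : Cell.face w ∈ T.dom t)
    (h : ∀ d, Cell.face d ∈ T.dom x → Cell.face w ∈ T.theta d → T.lower d t →
      ¬ IsStretched X d) : loopsBefore X w t = loopsBefore X w (T.cod x) := by
  have hwt : Cell.face w ∈ T.theta t := Or.inl hw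
  have htX := X.δ_mem (.face x) hx _ ht
  have hlt := upper_of_mem_dom hxl ht
  have key : ∀ b ∈ X.emptyLoopsOver w, T.lower b t ↔ T.lower b (T.cod x) := by
    intro b hb
    constructor
    · intro htb
      have hd : ∀ d, Cell.face d ∈ T.dom x → T.upperEq b d → Cell.face w ∈ T.theta d → False := by
        intro d hd hbd hwd
        rcases hT.lower_or_lower_of_mem_dom hd ht
          (fun e => hT.not_upperEq_of_lower htb (e ▸ hbd)) hwd hwt with h1 | h1
        · exact h d hd hwd h1 (isStretched_of_upperEq hb hbd hwd)
        · exact hT.not_upperEq_of_lower (hT.lower_trans _ _ _ htb h1) hbd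
      rcases emptyLoop_position hT hX hx hxl ht hwt hb with ⟨d, hd', hbd, hwd⟩ | h1 | h1
      · exact (hd d hd' hbd hwd).elim
      · exact h1
      · exact absurd (hT.lower_trans _ _ _ h1 htb) (not_lower_cod hT hxl ht).2
    · intro hsb
      rcases compare_emptyLoop hT hX hb htX hwt with h1 | h1 | h1
      · exact h1
      · exact absurd (hT.lower_trans _ _ _ h1 hsb) (not_lower_cod hT hxl ht).1
      · exact absurd (h1.trans hlt.le) (hT.not_upperEq_of_lower hsb)
  ext b
  constructor
  · rintro ⟨hb, hn⟩
    exact ⟨hb, (key b hb).1 hn⟩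
  · rintro ⟨hb, hn⟩
    exact ⟨hb, (key b hb).2 hn⟩

omit hX hx hxl ht in
theorem lower_wf (k : ℕ) : WellFounded (T.lower (k := k + 1)) := by
  have := T.finite_face (k + 1)
  have : IsTrans (T.Face (k + 1)) T.lower := ⟨hT.lower_trans⟩
  have : Std.Irrefl (T.lower (k := k + 1)) := ⟨hT.lower_irrefl⟩
  exact Finite.wellFounded_of_trans_of_irrefl _

omit hX hx hxl ht in
theorem lower_wf_flip (k : ℕ) : WellFounded (fun a b : T.Face (k + 1) => T.lower b a) := by
  have := T.finite_face (k + 1)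
  have : IsTrans (T.Face (k + 1)) (fun a b => T.lower b a) :=
    ⟨fun _ _ _ h h' => hT.lower_trans _ _ _ h' h⟩
  have : Std.Irrefl (fun a b : T.Face (k + 1) => T.lower b a) := ⟨hT.lower_irrefl⟩
  exact Finite.wellFounded_of_trans_of_irrefl _

omit hX hx hxl ht in
theorem mem_dom_of_lower {d : T.Face (k + 1)} (hw : T.cod t = w) (htd : T.lower t d)
    (hwd : Cell.face w ∈ T.theta d) : Cell.face w ∈ T.dom d := by
  rcases mem_theta.1 hwd with h | h
  · exact h
  by_cases hl : T.IsLoop d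
  · exact h ▸ hl.cod_mem
  obtain ⟨e, he, hle⟩ := minus_iff.1 (hT.lower_minus _ _ htd)
  exact absurd ((hw.trans h.symm) ▸ hle.trans_lt (upper_of_mem_dom hl he)) (hT.upper_irrefl _)

omit hX hx hxl ht in
theorem cod_eq_of_lower {d : T.Face (k + 1)} (hw : Cell.face w ∈ T.dom t) (hdt : T.lower d t)
    (hwd : Cell.face w ∈ T.theta d) : T.cod d = w := by
  rcases mem_theta.1 hwd with h | h
  · by_cases hl : T.IsLoop d
    · exact (hl.eq_cod h).symm
    obtain ⟨e, he, hle⟩ := minus_iff.1 (hT.lower_minus _ _ hdt)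
    exact absurd ((upper_of_mem_dom hl h).trans_le hle) (hT.local_discreteness t _ _ hw he).1
  · exact h

/-- One inclusion of γ-globularity for [X], read in T: the cut at the end of t is cancelled by the
cut at the start of a next stretched face leaving w, minimal for `<^∼`. If there is no such face, t
is last at w and its cut is that of γγ(x). -/
theorem cod_position (hw : T.cod t = w) :
    (T.cod (T.cod x) = w ∧ loopsUpTo X w t = loopsUpTo X w (T.cod x)) ∨
      ∃ t', Cell.face t' ∈ T.dom x ∧ IsStretched X t' ∧ T.lower t t' ∧ Cell.face w ∈ T.dom t' ∧
        loopsUpTo X w t = loopsBefore X w t' := by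
  have hwt : Cell.face w ∈ T.theta t := mem_theta.2 (Or.inr hw)
  let N : Set (T.Face (k + 1)) := {t' | Cell.face t' ∈ T.dom x ∧ IsStretched X t' ∧
    T.lower t t' ∧ Cell.face w ∈ T.dom t'}
  by_cases hN : N.Nonempty
  · obtain ⟨t', ⟨h1, h2, h3, h4⟩, hmin⟩ := (lower_wf hT k).has_min N hN
    refine Or.inr ⟨t', h1, h2, h3, h4, loopsUpTo_eq_loopsBefore hT hX hx hxl ht h1 hw h4 h3 ?_⟩
    intro d hd hwd htd hdt hs
    exact hmin d ⟨hd, hs, htd, mem_dom_of_lower hT hw htd hwd⟩ hdt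
  · have hN' : ∀ d, Cell.face d ∈ T.dom x → Cell.face w ∈ T.theta d → T.lower t d →
        ¬ IsStretched X d := fun d hd hwd htd hs =>
      hN ⟨d, hd, hs, htd, mem_dom_of_lower hT hw htd hwd⟩
    have hc : T.cod (T.cod x) = w := by
      by_contra hne
      obtain ⟨p, hp, hpl, hcp⟩ := hT.faceGlobular.exists_nonloop_out ht
        (fun h => hne (h ▸ hw))
      rw [hw] at hcp
      by_cases htp : t = p
      · subst htp
        exact hpl (hT.faceGlobular.isLoop_of_cod_mem (hw ▸ hcp))
      rcases hT.lower_or_lower_of_mem_dom ht hp htp hwt (Or.inl hcp) with h | h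
      · exact hN' p hp (Or.inl hcp) h (Or.inl hpl)
      · obtain ⟨e, he, hle⟩ := minus_iff.1 (hT.lower_minus _ _ h)
        have h1 := upperEq_of_mem_dom he
        rw [hw] at h1
        exact hT.upper_irrefl _ ((upper_of_mem_dom hpl hcp).trans_le (hle.trans h1))
    exact Or.inl ⟨hc, loopsUpTo_eq_loopsUpTo_cod hT hX hx hxl ht hw hN'⟩

/-- Dual of `cod_position`: the cut at the start of t is the end of a stretched face arriving at w,
`<^∼`-maximal before t, or else it belongs to δγ(x). -/
theorem dom_position (hw : Cell.face w ∈ T.dom t) :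
    (Cell.face w ∈ T.dom (T.cod x) ∧ loopsBefore X w t = loopsBefore X w (T.cod x)) ∨
      ∃ t', Cell.face t' ∈ T.dom x ∧ IsStretched X t' ∧ T.lower t' t ∧ T.cod t' = w ∧
        loopsUpTo X w t' = loopsBefore X w t := by
  let N : Set (T.Face (k + 1)) := {t' | Cell.face t' ∈ T.dom x ∧ IsStretched X t' ∧
    T.lower t' t ∧ T.cod t' = w}
  by_cases hN : N.Nonempty
  · obtain ⟨t', ⟨h1, h2, h3, h4⟩, hmin⟩ := (lower_wf_flip hT k).has_min N hN
    refine Or.inr ⟨t', h1, h2, h3, h4, loopsUpTo_eq_loopsBefore hT hX hx hxl h1 ht h4 hw h3 ?_⟩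
    intro d hd hwd htd hdt hs
    exact hmin d ⟨hd, hs, hdt, cod_eq_of_lower hT hw hdt hwd⟩ htd
  · have hN' : ∀ d, Cell.face d ∈ T.dom x → Cell.face w ∈ T.theta d → T.lower d t →
        ¬ IsStretched X d := fun d hd hwd htd hs =>
      hN ⟨d, hd, hs, htd, cod_eq_of_lower hT hw htd hwd⟩
    have hc : Cell.face w ∈ T.dom (T.cod x) := by
      refine hT.faceGlobular.mem_dom_cod ht hw fun p hp hpl hpw => ?_
      have hwp : Cell.face w ∈ T.theta p := mem_theta.2 (Or.inr hpw)
      by_cases hpt : p = t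
      · subst hpt
        exact hpl (hT.faceGlobular.isLoop_of_cod_mem (hpw ▸ hw))
      rcases hT.lower_or_lower_of_mem_dom hp ht hpt hwp (Or.inl hw) with h | h
      · exact hN' p hp hwp h (Or.inl hpl)
      · obtain ⟨e, he, hle⟩ := minus_iff.1 (hT.lower_minus _ _ h)
        exact hT.upper_irrefl w ((upperEq_of_mem_dom hw).trans (hle) |>.trans_lt
          (hpw ▸ upper_of_mem_dom hpl he))
    exact Or.inl ⟨hc, loopsBefore_eq_loopsBefore_cod hT hX hx hxl ht hw hN'⟩

end Dom

end Loops

/-! ### Loops, upper order and globularity of the stretching -/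

section Stretch

variable {T : OrderedHypergraph.{u}} {X : Subhypergraph T.toHypergraph} {k : ℕ}
  (hT : IsOrderedFaceStructure T) (hX : X.IsConvex)
include hT

/-- An empty loop below t is `<^∼`-related to t in neither direction, by disjointness, so it belongs
to the second set only. -/
theorem loopsBefore_ssubset_loopsUpTo {t : T.Face (k + 1)} (ht : IsStretched X t)
    (hl : T.IsLoop t) : loopsBefore X (T.cod t) t ⊂ loopsUpTo X (T.cod t) t := by
  constructor
  · rintro b ⟨hb, h⟩
    exact ⟨hb, hT.lower_asymm h⟩
  · intro hsub
    obtain ⟨b, hb, hle⟩ := ht.resolve_left (not_not.2 hl)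
    exact hT.not_upperEq_of_lower (hsub ⟨hb, fun h => hT.not_upperEq_of_lower' h hle⟩).2 hle

include hX

section Dom

variable {x : T.Face (k + 2)} (hx : x ∈ X.faces (k + 2)) {w : T.Face k} {t : T.Face (k + 1)}
include hx

theorem cod_position' (ht : Cell.face t ∈ T.dom x) (hw : T.cod t = w) :
    (T.cod (T.cod x) = w ∧ loopsUpTo X w t = loopsUpTo X w (T.cod x)) ∨
      ∃ t', Cell.face t' ∈ T.dom x ∧ IsStretched X t' ∧ Cell.face w ∈ T.dom t' ∧
        loopsUpTo X w t = loopsBefore X w t' := by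
  by_cases hxl : T.IsLoop x
  · have := hxl.eq_cod ht
    subst this
    exact Or.inl ⟨hw, rfl⟩
  · rcases cod_position hT hX hx hxl ht hw with h | ⟨t', h1, h2, -, h3, h4⟩
    · exact Or.inl h
    · exact Or.inr ⟨t', h1, h2, h3, h4⟩

theorem dom_position' (ht : Cell.face t ∈ T.dom x) (hw : Cell.face w ∈ T.dom t) :
    (Cell.face w ∈ T.dom (T.cod x) ∧ loopsBefore X w t = loopsBefore X w (T.cod x)) ∨
      ∃ t', Cell.face t' ∈ T.dom x ∧ IsStretched X t' ∧ T.cod t' = w ∧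
        loopsUpTo X w t' = loopsBefore X w t := by
  by_cases hxl : T.IsLoop x
  · have := hxl.eq_cod ht
    subst this
    exact Or.inl ⟨hw, rfl⟩
  · rcases dom_position hT hX hx hxl ht hw with h | ⟨t', h1, h2, -, h3, h4⟩
    · exact Or.inl h
    · exact Or.inr ⟨t', h1, h2, h3, h4⟩

theorem exists_cod_position {t₀ : T.Face (k + 1)} (ht₀ : Cell.face t₀ ∈ T.dom x)
    (hw : T.cod (T.cod x) = w) :
    ∃ t, Cell.face t ∈ T.dom x ∧ T.cod t = w ∧ loopsUpTo X w t = loopsUpTo X w (T.cod x) := by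
  by_cases hxl : T.IsLoop x
  · exact ⟨_, hxl.cod_mem, hw, rfl⟩
  let N : Set (T.Face (k + 1)) := {t | Cell.face t ∈ T.dom x ∧ T.cod t = w}
  have hN : N.Nonempty := by
    obtain ⟨p, hp, hpc⟩ := hT.faceGlobular.exists_cod_eq ht₀
    exact ⟨p, hp, hpc.trans hw⟩
  -- A `<^∼`-maximal face of δ(x) ending at γγ(x) has no successor there: a later face through w
  -- would be a loop at w, contradicting maximality, or a non-loop leaving γγ(x).
  obtain ⟨t, ⟨ht, htw⟩, hmax⟩ := (lower_wf_flip hT k).has_min N hN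
  rcases cod_position hT hX hx hxl ht htw with h | ⟨t', h1, -, h2, h3, -⟩
  · exact ⟨t, ht, htw, h.2⟩
  · exfalso
    by_cases hl : T.IsLoop t'
    · exact hmax t' ⟨h1, (hl.eq_cod h3).symm⟩ h2
    · exact hT.faceGlobular.not_mem_dom_of_nonloop h1 hl (hw ▸ h3)

theorem exists_dom_position {t₀ : T.Face (k + 1)} (ht₀ : Cell.face t₀ ∈ T.dom x)
    (hw : Cell.face w ∈ T.dom (T.cod x)) : ∃ t, Cell.face t ∈ T.dom x ∧
      Cell.face w ∈ T.dom t ∧ loopsBefore X w t = loopsBefore X w (T.cod x) := by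
  by_cases hxl : T.IsLoop x
  · exact ⟨_, hxl.cod_mem, hw, rfl⟩
  let N : Set (T.Face (k + 1)) := {t | Cell.face t ∈ T.dom x ∧ Cell.face w ∈ T.dom t}
  have hN : N.Nonempty := by
    obtain ⟨p, hp, hpc⟩ := hT.faceGlobular.exists_mem_dom_of_mem_dom_cod ht₀ hw
    exact ⟨p, hp, hpc⟩
  obtain ⟨t, ⟨ht, htw⟩, hmin⟩ := (lower_wf hT k).has_min N hN
  rcases dom_position hT hX hx hxl ht htw with h | ⟨t', h1, -, h2, h3, -⟩
  · exact ⟨t, ht, htw, h.2⟩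
  · exfalso
    by_cases hl : T.IsLoop t'
    · exact hmin t' ⟨h1, h3 ▸ hl.cod_mem⟩ h2
    · exact hT.faceGlobular.cod_ne_of_mem_dom_cod hw h1 hl h3

omit hX hx in
-- The other half of γ-globularity for [X]: γγ of a cut is in the domain of no stretched face. For
-- non-loops this is globularity in T; for a stretched loop t, an empty loop below t is also below
-- γ(x), and so distinguishes the two cuts.
theorem loopsBefore_ne_loopsUpTo_cod (ht : Cell.face t ∈ T.dom x) (hs : IsStretched X t)
    (hwt : Cell.face w ∈ T.dom t) (hw : T.cod (T.cod x) = w) :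
    loopsBefore X w t ≠ loopsUpTo X w (T.cod x) := by
  intro he
  have key : T.IsLoop t → T.upperEq t (T.cod x) → False := by
    intro hl hle
    have := hl.eq_cod hwt
    subst this
    obtain ⟨b, hb, hbt⟩ := hs.resolve_left (not_not.2 hl)
    have h1 : b ∈ loopsUpTo X (T.cod t) (T.cod x) :=
      ⟨hb, fun h => hT.not_upperEq_of_lower' h (hbt.trans hle)⟩
    rw [← he] at h1
    exact hT.not_upperEq_of_lower h1.2 hbt
  by_cases hl : T.IsLoop t
  · exact key hl (upperEq_of_mem_dom ht)
  · exact hT.faceGlobular.not_mem_dom_of_nonloop ht hl (hw ▸ hwt)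

omit hX hx in
theorem loopsUpTo_ne_loopsBefore_cod (ht : Cell.face t ∈ T.dom x) (hs : IsStretched X t)
    (hwt : T.cod t = w) (hw : Cell.face w ∈ T.dom (T.cod x)) :
    loopsUpTo X w t ≠ loopsBefore X w (T.cod x) := by
  intro he
  by_cases hl : T.IsLoop t
  · subst hwt
    obtain ⟨b, hb, hbt⟩ := hs.resolve_left (not_not.2 hl)
    have h1 : b ∈ loopsUpTo X (T.cod t) t := ⟨hb, fun h => hT.not_upperEq_of_lower' h hbt⟩
    rw [he] at h1
    exact hT.not_upperEq_of_lower h1.2 (hbt.trans (upperEq_of_mem_dom ht))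
  · exact hT.faceGlobular.cod_ne_of_mem_dom_cod hw ht hl hwt

end Dom

omit hX in
theorem Cut.ext_of_L {c d : Cut T X k} (h : c.base = d.base) (hL : c.L = d.L) : c = d := by
  have key : ∀ c : Cut T X k, c.U = X.emptyLoopsOver c.base \ c.L := by
    intro c
    rw [← c.union_eq]
    ext b
    constructor
    · intro hb
      exact ⟨Or.inr hb, fun h => hT.lower_irrefl _ (c.lower_of_mem b h b hb)⟩
    · rintro ⟨h | h, h'⟩
      · exact absurd h h'
      · exact h
  exact Cut.ext h hL (by rw [key, key, h, hL])

/-- The greatest cut over a face. -/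
def topCut (X : Subhypergraph T.toHypergraph) (x : T.Face k) (hx : x ∈ X.faces k) :
    Cut T X k where
  base := x
  base_mem := hx
  L := X.emptyLoopsOver x
  U := ∅
  union_eq := Set.union_empty _
  lower_of_mem _ _ _ h := h.elim

omit hT hX in
theorem Cut.mem_of_mem_L {c : Cut T X k} {b : T.Face (k + 1)} (hb : b ∈ c.L) :
    b ∈ X.emptyLoopsOver c.base := c.union_eq ▸ Or.inl hb

omit hT hX in
theorem Cut.mem_U {c : Cut T X k} {b : T.Face (k + 1)} (hb : b ∈ X.emptyLoopsOver c.base)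
    (h : b ∉ c.L) : b ∈ c.U := by
  rw [← c.union_eq] at hb
  exact hb.resolve_left h

omit hX in
-- Loops witnessing the failure of both inclusions would be `<^∼`-related in both directions.
theorem Cut.L_subset_or {c d : Cut T X k} (h : c.base = d.base) : c.L ⊆ d.L ∨ d.L ⊆ c.L := by
  by_contra hcon
  simp only [not_or, Set.not_subset] at hcon
  obtain ⟨⟨l, hl, hl'⟩, m, hm, hm'⟩ := hcon
  exact hT.lower_asymm
    (c.lower_of_mem l hl m (Cut.mem_U (h ▸ Cut.mem_of_mem_L hm) hm'))
    (d.lower_of_mem m hm l (Cut.mem_U (h ▸ Cut.mem_of_mem_L hl) hl'))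

omit hT in
theorem stretch_cod_L (hT : IsOrderedFaceStructure T) (c : Cut T X (k + 1)) :
    Cut.L ((stretch hT hX).cod c) = loopsUpTo X (T.cod c.base) c.base := rfl

omit hT in
theorem face_mem_stretch_dom (hT : IsOrderedFaceStructure T) {c : Cut T X (k + 1)}
    {d : Cut T X k} : Cell.face d ∈ (stretch hT hX).dom c ↔
      Cell.face d.base ∈ T.dom c.base ∧ d.L = loopsBefore X d.base c.base := by
  have key : (∃ (t : T.Face k) (ht : Cell.face t ∈ T.dom c.base),
      Cell.face d = Cell.face (F := Cut T X) (downCut hT hX c.base c.base_mem t ht)) ↔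
      Cell.face d.base ∈ T.dom c.base ∧ d.L = loopsBefore X d.base c.base := by
    constructor
    · rintro ⟨t, ht, he⟩
      have he := Cell.face.inj he
      subst he
      exact ⟨ht, rfl⟩
    · rintro ⟨h1, h2⟩
      exact ⟨d.base, h1, congrArg _ (Cut.ext_of_L hT rfl h2)⟩
  cases k with
  | zero => exact key
  | succ k =>
    change Cell.face d ∈ stretchDom hT hX (.face c) ↔ _
    simp only [stretchDom]
    split_ifs with h
    · constructor
      · intro h'
        cases h'
      · rintro ⟨h', -⟩
        rw [h] at h'
        cases h'
    · exact key

omit hT in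
theorem empty_mem_stretch_dom (hT : IsOrderedFaceStructure T) {c : Cut T X (k + 2)}
    {d : Cut T X k} : Cell.empty d ∈ (stretch hT hX).dom c ↔
      T.IsEmptyDomain c.base ∧ d = (stretch hT hX).cod ((stretch hT hX).cod c) := by
  change Cell.empty d ∈ stretchDom hT hX (.face c) ↔ _
  simp only [stretchDom]
  split_ifs with h
  · constructor
    · intro h'
      exact ⟨⟨_, h⟩, Cell.empty.inj h'⟩
    · rintro ⟨-, rfl⟩
      rfl
  · constructor
    · rintro ⟨t, ht, he⟩
      cases he
    · rintro ⟨he, -⟩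
      exact absurd (hT.faceGlobular.dom_eq_of_isEmptyDomain he) h

omit hT in
theorem stretch_isEmptyDomain_iff (hT : IsOrderedFaceStructure T) {c : Cut T X (k + 2)} :
    (stretch hT hX).IsEmptyDomain c ↔ T.IsEmptyDomain c.base := by
  constructor
  · rintro ⟨d, hd⟩
    have : Cell.empty d ∈ (stretch hT hX).dom c := by
      rw [hd]
      rfl
    exact ((empty_mem_stretch_dom hX hT).1 this).1
  · intro h
    exact ⟨_, isEmptyDomain_of_mem ((empty_mem_stretch_dom hX hT).2 ⟨h, rfl⟩)⟩

omit hT in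
-- Over a loop of T the domain cut consists of the empty loops before it and the codomain cut of
-- those not after it. By `compare_emptyLoop` they differ exactly by the empty loops that lie
-- `<⁺`-below or equal to it.
theorem stretch_isLoop_iff (hT : IsOrderedFaceStructure T) {c : Cut T X (k + 1)} :
    (stretch hT hX).IsLoop c ↔ ¬ IsStretched X c.base := by
  constructor
  · intro hl
    have h1 := (face_mem_stretch_dom hX hT).1 hl.cod_mem
    have hcl : T.IsLoop c.base := hT.faceGlobular.isLoop_of_cod_mem h1.1
    intro hs
    exact (loopsBefore_ssubset_loopsUpTo hT hs hcl).ne h1.2.symm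
  · intro hs
    unfold IsStretched at hs
    push Not at hs
    obtain ⟨hl, hs⟩ := hs
    refine dom_eq_singleton_of_forall ?_ ?_
    · refine (face_mem_stretch_dom hX hT).2 ⟨hl.cod_mem, ?_⟩
      rw [stretch_cod_L]
      ext b
      constructor
      · rintro ⟨hb, h⟩
        refine ⟨hb, ?_⟩
        rcases compare_emptyLoop hT hX hb c.base_mem (mem_theta.2 (Or.inr rfl)) with h1 | h1 | h1
        · exact h1
        · exact absurd h1 h
        · exact absurd h1 (hs b hb)
      · rintro ⟨hb, h⟩
        exact ⟨hb, hT.lower_asymm h⟩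
    · intro d hd
      obtain ⟨h1, h2⟩ := (face_mem_stretch_dom hX hT).1 hd
      have h3 : Cut.base d = T.cod c.base := hl.eq_cod h1
      refine Cut.ext_of_L hT h3 ?_
      rw [h2, stretch_cod_L, h3]
      ext b
      constructor
      · rintro ⟨hb, h⟩
        exact ⟨hb, hT.lower_asymm h⟩
      · rintro ⟨hb, h⟩
        refine ⟨hb, ?_⟩
        rcases compare_emptyLoop hT hX hb c.base_mem (mem_theta.2 (Or.inr rfl)) with h1 | h1 | h1
        · exact h1
        · exact absurd h1 h
        · exact absurd h1 (hs b hb)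

omit hT in
theorem stretch_not_isLoop_iff (hT : IsOrderedFaceStructure T) {c : Cut T X (k + 1)} :
    ¬ (stretch hT hX).IsLoop c ↔ IsStretched X c.base :=
  (stretch_isLoop_iff hX hT).not.trans not_not

omit hT in
-- A link over a non-loop of T raises the base; a link over a stretched loop keeps the base and
-- strictly enlarges L. In particular `<⁺` on [X] is irreflexive.
theorem upper_of_stretch_upper (hT : IsOrderedFaceStructure T) {c d : Cut T X k}
    (h : (stretch hT hX).upper c d) :
    T.upper c.base d.base ∨ c.base = d.base ∧ c.L ⊂ d.L := by
  have link : ∀ c d : Cut T X k, (∃ α : Cut T X (k + 1), ¬ (stretch hT hX).IsLoop α ∧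
      Cell.face c ∈ (stretch hT hX).dom α ∧ (stretch hT hX).cod α = d) →
      T.upper c.base d.base ∨ c.base = d.base ∧ c.L ⊂ d.L := by
    rintro c d ⟨α, hα, hc, rfl⟩
    replace hα := (stretch_not_isLoop_iff hX hT).1 hα
    obtain ⟨h1, h2⟩ := (face_mem_stretch_dom hX hT).1 hc
    by_cases hl : T.IsLoop α.base
    · right
      have h3 := hl.eq_cod h1
      refine ⟨h3, ?_⟩
      rw [h2, stretch_cod_L, h3]
      exact loopsBefore_ssubset_loopsUpTo hT hα hl
    · exact Or.inl (upper_of_mem_dom hl h1)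
  change Relation.TransGen _ c d at h
  induction h with
  | single h => exact link _ _ h
  | tail _ h ih =>
    rcases ih with h1 | ⟨h1, h2⟩ <;> rcases link _ _ h with h3 | ⟨h3, h4⟩
    · exact Or.inl (h1.trans h3)
    · exact Or.inl (h3 ▸ h1)
    · exact Or.inl (h1 ▸ h3)
    · exact Or.inr ⟨h1.trans h3, h2.trans h4⟩

omit hT in
theorem stretch_upper_irrefl (hT : IsOrderedFaceStructure T) (c : Cut T X k) :
    ¬ (stretch hT hX).upper c c := by
  intro h
  rcases upper_of_stretch_upper hX hT h with h | ⟨-, h⟩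
  · exact hT.upper_irrefl _ h
  · exact h.ne rfl

omit hT in
theorem stretch_faceGlobular (hT : IsOrderedFaceStructure T) :
    (stretch hT hX).FaceGlobular where
  γ_empty _ := rfl
  δ_empty {k} a := by cases k <;> rfl
  upper_irrefl := stretch_upper_irrefl hX hT
  globularity_γ := by
    intro k (a : Cut T X (k + 2))
    have hdomSet : ∀ c : Cut T X k, Cell.face c ∈ (stretch hT hX).domSet
        (Cell.face '' (stretch hT hX).domNonloop a) ↔
        ∃ t : Cut T X (k + 1), Cell.face t ∈ (stretch hT hX).dom a ∧ IsStretched X t.base ∧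
          Cell.face c ∈ (stretch hT hX).dom t := by
      intro c
      constructor
      · intro h
        obtain ⟨_, ⟨t, ⟨h1, h2⟩, rfl⟩, h3⟩ := Set.mem_iUnion₂.1 h
        exact ⟨t, h1, (stretch_not_isLoop_iff hX hT).1 h2, h3⟩
      · rintro ⟨t, h1, h2, h3⟩
        exact Set.mem_biUnion (x := Cell.face t)
          ⟨t, ⟨h1, (stretch_not_isLoop_iff hX hT).2 h2⟩, rfl⟩ h3
    rcases isEmptyDomain_or_exists a.base with he | ⟨t₀, ht₀⟩
    · obtain ⟨u, hu⟩ := (stretch_isEmptyDomain_iff hX hT).2 he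
      have hu' : u = (stretch hT hX).cod ((stretch hT hX).cod a) := by
        refine ((empty_mem_stretch_dom hX hT).1 ?_).2
        rw [hu]
        rfl
      subst hu'
      ext d
      constructor
      · rintro rfl
        refine ⟨⟨Cell.empty ((stretch hT hX).cod ((stretch hT hX).cod a)), by rw [hu]; rfl, rfl⟩,
          fun h => ?_⟩
        obtain ⟨t, ht, -⟩ := (hdomSet _).1 h
        rw [hu] at ht
        cases ht
      · rintro ⟨⟨c, hc, rfl⟩, -⟩
        rw [hu] at hc
        cases hc
        rfl
    · ext d
      constructor
      · rintro rfl
        constructor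
        · obtain ⟨t, ht, htw, htL⟩ := exists_cod_position hT hX a.base_mem ht₀ rfl
          refine ⟨.face (downCut hT hX a.base a.base_mem t ht),
            (face_mem_stretch_dom hX hT).2 ⟨ht, rfl⟩, congrArg _ (Cut.ext_of_L hT htw.symm ?_)⟩
          change loopsUpTo X (T.cod (T.cod a.base)) (T.cod a.base) = loopsUpTo X (T.cod t) t
          rw [htw, htL]
        · intro h
          obtain ⟨t, h1, h2, h3⟩ := (hdomSet _).1 h
          replace h1 := (face_mem_stretch_dom hX hT).1 h1
          replace h3 := (face_mem_stretch_dom hX hT).1 h3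
          exact loopsBefore_ne_loopsUpTo_cod hT h1.1 h2 h3.1 rfl h3.2.symm
      · rintro ⟨⟨c, hc, rfl⟩, hn⟩
        have : ∃ t : Cut T X (k + 1), c = .face t := by
          cases c with
          | face t => exact ⟨t, rfl⟩
          | empty u =>
            exact absurd ht₀ (((empty_mem_stretch_dom hX hT).1 hc).1.not_mem _)
        obtain ⟨t, rfl⟩ := this
        have h1 := (face_mem_stretch_dom hX hT).1 hc
        rcases cod_position' hT hX a.base_mem h1.1 rfl with ⟨h2, h3⟩ | ⟨t', h2, h3, h4, h5⟩
        · refine congrArg Cell.face (Cut.ext_of_L hT h2.symm ?_)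
          change loopsUpTo X (T.cod t.base) t.base =
            loopsUpTo X (T.cod (T.cod a.base)) (T.cod a.base)
          rw [h3, h2]
        · refine absurd ?_ hn
          refine (hdomSet _).2 ⟨downCut hT hX a.base a.base_mem t' h2,
            (face_mem_stretch_dom hX hT).2 ⟨h2, rfl⟩, h3, (face_mem_stretch_dom hX hT).2
              ⟨h4, h5⟩⟩
  globularity_face := by
    intro k (a : Cut T X (k + 2)) (w : Cut T X k)
    have hcodSet : ∀ c : Cut T X k, Cell.face c ∈ (stretch hT hX).codSet
        (Cell.face '' (stretch hT hX).domNonloop a) ↔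
        ∃ t : Cut T X (k + 1), Cell.face t ∈ (stretch hT hX).dom a ∧ IsStretched X t.base ∧
          (stretch hT hX).cod t = c := by
      intro c
      constructor
      · rintro ⟨_, ⟨t, ⟨h1, h2⟩, rfl⟩, h3⟩
        exact ⟨t, h1, (stretch_not_isLoop_iff hX hT).1 h2, (Cell.face.inj h3).symm⟩
      · rintro ⟨t, h1, h2, rfl⟩
        exact ⟨Cell.face t, ⟨t, ⟨h1, (stretch_not_isLoop_iff hX hT).2 h2⟩, rfl⟩, rfl⟩
    rcases isEmptyDomain_or_exists a.base with he | ⟨t₀, ht₀⟩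
    · obtain ⟨u, hu⟩ := (stretch_isEmptyDomain_iff hX hT).2 he
      have hu' : u = (stretch hT hX).cod ((stretch hT hX).cod a) := by
        refine ((empty_mem_stretch_dom hX hT).1 ?_).2
        rw [hu]
        rfl
      -- No empty loop lies below γ(x) when x has empty domain: γ(x) is filled by x, and an empty
      -- loop strictly below γ(x) would lie below a face of δ(x). So the loop γ(x) is not opened.
      have hl : (stretch hT hX).IsLoop ((stretch hT hX).cod a) := by
        refine (stretch_isLoop_iff hX hT).2 ?_
        have hl := hT.faceGlobular.isLoop_cod_of_isEmptyDomain he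
        rintro (h | ⟨b, hb, h | h⟩)
        · exact h hl
        · exact hb.1.2.2 ⟨a.base, a.base_mem, he.not_isLoop, h.symm⟩
        · obtain ⟨d, hd, -⟩ := le_dom_of_upper_cod hT hX hb a.base_mem he.not_isLoop h
          exact he.not_mem d hd
      have hl' : (stretch hT hX).dom ((stretch hT hX).cod a) = _ := hl
      rw [hl', ← hu', hu]
      constructor
      · intro h
        refine ⟨Set.mem_biUnion (x := Cell.empty u) rfl ?_, ?_⟩
        · cases k <;> exact h
        · intro h'
          obtain ⟨t, ht, -⟩ := (hcodSet _).1 h'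
          rw [hu] at ht
          cases ht
      · rintro ⟨h, -⟩
        obtain ⟨_, rfl, h⟩ := Set.mem_iUnion₂.1 h
        cases k <;> exact h
    · refine (face_mem_stretch_dom hX hT).trans ?_
      change Cell.face w.base ∈ T.dom (T.cod a.base) ∧
        w.L = loopsBefore X w.base (T.cod a.base) ↔ _
      constructor
      · rintro ⟨h1, h2⟩
        constructor
        · obtain ⟨t, h3, h4, h5⟩ := exists_dom_position hT hX a.base_mem ht₀ h1
          exact Set.mem_biUnion (x := Cell.face (downCut hT hX a.base a.base_mem t h3))
            ((face_mem_stretch_dom hX hT).2 ⟨h3, rfl⟩)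
            ((face_mem_stretch_dom hX hT).2 ⟨h4, h2.trans h5.symm⟩)
        · intro h
          obtain ⟨t, h3, h4, rfl⟩ := (hcodSet _).1 h
          exact loopsUpTo_ne_loopsBefore_cod hT
            ((face_mem_stretch_dom hX hT).1 h3).1 h4 rfl h1 h2
      · rintro ⟨h, hn⟩
        obtain ⟨c, hc, hw⟩ := Set.mem_iUnion₂.1 h
        have : ∃ t : Cut T X (k + 1), c = .face t := by
          cases c with
          | face t => exact ⟨t, rfl⟩
          | empty u =>
            exact absurd ht₀ (((empty_mem_stretch_dom hX hT).1 hc).1.not_mem _)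
        obtain ⟨t, rfl⟩ := this
        have h1 := (face_mem_stretch_dom hX hT).1 hc
        have h2 := (face_mem_stretch_dom hX hT).1 hw
        rcases dom_position' hT hX a.base_mem h1.1 h2.1 with ⟨h3, h4⟩ | ⟨t', h3, h4, h5, h6⟩
        · exact ⟨h3, h2.2.trans h4⟩
        · refine absurd ?_ hn
          refine (hcodSet _).2 ⟨downCut hT hX a.base a.base_mem t' h3,
            (face_mem_stretch_dom hX hT).2 ⟨h3, rfl⟩, h4, Cut.ext_of_L hT h5 ?_⟩
          change loopsUpTo X (T.cod t') t' = w.L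
          rw [h5, h6, h2.2]

end Stretch

/-! ### Lifting the orders of the ambient structure, and the remaining axioms -/

section Lift

variable {T : OrderedHypergraph.{u}} {X : Subhypergraph T.toHypergraph} {k : ℕ}
  (hT : IsOrderedFaceStructure T) (hX : X.IsConvex)
include hT hX

/-- The least non-loop of `X` with a given face in its domain. -/
theorem exists_least_out {x : T.Face k} {β : T.Face (k + 1)} (hβ : β ∈ X.faces (k + 1))
    (hβl : ¬ T.IsLoop β) (hxβ : Cell.face x ∈ T.dom β) :
    ∃ α ∈ X.faces (k + 1), ¬ T.IsLoop α ∧ Cell.face x ∈ T.dom α ∧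
      (∀ β ∈ X.faces (k + 1), ¬ T.IsLoop β → Cell.face x ∈ T.dom β → T.upperEq α β) ∧
      loopsBefore X x α = X.emptyLoopsOver x := by
  let N : Set (T.Face (k + 1)) := {α | α ∈ X.faces (k + 1) ∧ ¬ T.IsLoop α ∧
    Cell.face x ∈ T.dom α}
  obtain ⟨α, ⟨h1, h2, h3⟩, hmin⟩ :=
    (hT.faceGlobular.upper_wf (k + 1)).has_min N ⟨β, hβ, hβl, hxβ⟩
  refine ⟨α, h1, h2, h3, ?_, ?_⟩
  · intro β hβ hβl hxβ
    rcases hT.comparable_of_mem_dom h2 hβl h3 hxβ with h | h | h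
    · exact Or.inl h
    · exact h.le
    · exact absurd h (hmin β ⟨hβ, hβl, hxβ⟩)
  · refine Set.Subset.antisymm (fun b hb => hb.1) fun b hb => ⟨hb, ?_⟩
    rcases compare_emptyLoop hT hX hb h1 (Or.inl h3) with h | h | h
    · exact h
    · obtain ⟨d, hd, hle⟩ := minus_iff.1 (hT.lower_minus _ _ h)
      rw [(hb.1.2.1 : T.IsLoop b).eq_cod hd, hb.2] at hle
      exact absurd ((upper_of_mem_dom h2 h3).trans_le hle) (hT.upper_irrefl _)
    · exfalso
      rcases h with rfl | h
      · exact h2 hb.1.2.1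
      -- An empty loop below α would give a link Φ of X ending at α, and δ(Φ) contains a smaller
      -- non-loop leaving x.
      obtain ⟨Φ, hΦX, hΦ, rfl, -⟩ := exists_last_link_of_isConvex hX hb.1.1 h1 h
      obtain ⟨p, hp, hpl, hxp⟩ := hT.faceGlobular.exists_nonloop_mem_dom h2 h3
      exact hmin p ⟨X.δ_mem (.face Φ) hΦX _ hp, hpl, hxp⟩ (upper_of_mem_dom hΦ hp)

/-- The least non-loop of `X` with a given codomain. -/
theorem exists_least_in {x : T.Face k} {β : T.Face (k + 1)} (hβ : β ∈ X.faces (k + 1))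
    (hβl : ¬ T.IsLoop β) (hxβ : T.cod β = x) :
    ∃ α ∈ X.faces (k + 1), ¬ T.IsLoop α ∧ T.cod α = x ∧
      (∀ β ∈ X.faces (k + 1), ¬ T.IsLoop β → T.cod β = x → T.upperEq α β) ∧
      loopsUpTo X x α = ∅ := by
  let N : Set (T.Face (k + 1)) := {α | α ∈ X.faces (k + 1) ∧ ¬ T.IsLoop α ∧ T.cod α = x}
  obtain ⟨α, ⟨h1, h2, h3⟩, hmin⟩ :=
    (hT.faceGlobular.upper_wf (k + 1)).has_min N ⟨β, hβ, hβl, hxβ⟩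
  refine ⟨α, h1, h2, h3, ?_, ?_⟩
  · intro β hβ hβl hxβ
    rcases hT.comparable_of_cod_eq h2 hβl (h3.trans hxβ.symm) with h | h | h
    · exact Or.inl h
    · exact h.le
    · exact absurd h (hmin β ⟨hβ, hβl, hxβ⟩)
  · refine Set.eq_empty_of_forall_notMem fun b ⟨hb, hn⟩ => ?_
    rcases compare_emptyLoop hT hX hb h1 (mem_theta.2 (Or.inr h3)) with h | h | h
    · obtain ⟨d, hd, hle⟩ := minus_iff.1 (hT.lower_minus _ _ h)
      rw [hb.2, ← h3] at hle
      exact hT.faceGlobular.not_upper_of_le hle (upper_of_mem_dom h2 hd)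
    · exact hn h
    · rcases h with rfl | h
      · exact h2 hb.1.2.1
      obtain ⟨Φ, hΦX, hΦ, rfl, -⟩ := exists_last_link_of_isConvex hX hb.1.1 h1 h
      obtain ⟨p, hp, hpl, hxp⟩ := hT.faceGlobular.exists_nonloop_cod_eq h2
      exact hmin p ⟨X.δ_mem (.face Φ) hΦX _ hp, hpl, hxp.trans h3⟩ (upper_of_mem_dom hΦ hp)

/-- The loops of d.L missing from c.L are added one at a time in the order `<^∼`: a minimal missing
loop l, seen as a non-loop of [X], starts at c and ends at the cut in which l has been added. -/
theorem stretch_upperEq_of_subset (c d : Cut T X k) (h : c.base = d.base) (hL : c.L ⊆ d.L) :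
    (stretch hT hX).upperEq c d := by
  have := T.finite_face (k + 1)
  obtain ⟨s, hs⟩ : ∃ s, c.L = s := ⟨_, rfl⟩
  induction s using (wellFounded_gt (α := Set (T.Face (k + 1)))).induction generalizing c with
  | _ s ih =>
    subst hs
    by_cases he : d.L ⊆ c.L
    · exact Or.inl (Cut.ext_of_L hT h (hL.antisymm he))
    obtain ⟨l₀, hl₀, hl₀'⟩ := Set.not_subset.1 he
    obtain ⟨l, ⟨hl, hl'⟩, hmin⟩ := (lower_wf hT k).has_min (d.L \ c.L) ⟨l₀, hl₀, hl₀'⟩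
    have hlE : l ∈ X.emptyLoopsOver c.base := h ▸ Cut.mem_of_mem_L hl
    have hlU : l ∈ c.U := Cut.mem_U hlE hl'
    -- Which cut is chosen over l is immaterial: domain and codomain in [X] depend on the base only.
    let lc : Cut T X (k + 1) := topCut X l hlE.1.1
    have hlc : ¬ (stretch hT hX).IsLoop lc :=
      (stretch_not_isLoop_iff hX hT).2 (Or.inr ⟨l, hlE.2.symm ▸ hlE, .refl _⟩)
    have hlb : T.cod l = c.base := hlE.2
    have hdom : Cell.face c ∈ (stretch hT hX).dom lc := by
      refine (face_mem_stretch_dom hX hT).2 ⟨hlb ▸ (hlE.1.2.1 : T.IsLoop l).cod_mem, ?_⟩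
      ext b
      constructor
      · exact fun hb => ⟨Cut.mem_of_mem_L hb, c.lower_of_mem b hb l hlU⟩
      · rintro ⟨hb, hbl⟩
        by_contra hbc
        have hbd : b ∈ d.L := by
          by_contra hbd
          exact hT.lower_asymm hbl (d.lower_of_mem l hl b (Cut.mem_U (h ▸ hb) hbd))
        exact hmin b ⟨hbd, hbc⟩ hbl
    have hup := upper_of_mem_dom hlc hdom
    have hL' : Cut.L ((stretch hT hX).cod lc) = loopsUpTo X c.base l := by
      rw [← hlb]
      rfl
    refine (hup.trans_le (ih _ ?_ _ (hlb.trans h) ?_ rfl)).le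
    · rw [hL']
      constructor
      · intro b hb
        exact ⟨Cut.mem_of_mem_L hb, hT.lower_asymm (c.lower_of_mem b hb l hlU)⟩
      · intro hsub
        exact hl' (hsub ⟨hlE, hT.lower_irrefl _⟩)
    · rw [hL']
      rintro b ⟨hb, hbl⟩
      by_contra hbd
      exact hbl (d.lower_of_mem l hl b (Cut.mem_U (h ▸ hb) hbd))

/-- Climb to the top cut over the base of c, then cross the least non-loop α of X leaving it, whose
domain cut is exactly that top cut. Continue in this way until the base of d is reached, where the
path enters at the bottom cut. -/
theorem stretch_upper_of_upper (c d : Cut T X k) (h : T.upper c.base d.base) :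
    (stretch hT hX).upper c d := by
  obtain ⟨x, hx⟩ : ∃ x, c.base = x := ⟨_, rfl⟩
  induction x using (hT.faceGlobular.upper_wf_flip k).induction generalizing c with
  | _ x ih =>
    subst hx
    obtain ⟨β, hβX, hβl, hcβ, hβd⟩ :=
      exists_first_link_of_isConvex hX c.base_mem d.base_mem h
    obtain ⟨α, hαX, hαl, hcα, hαmin, hαL⟩ := exists_least_out hT hX hβX hβl hcβ
    let αc : Cut T X (k + 1) := topCut X α hαX
    have hup : (stretch hT hX).upper c ((stretch hT hX).cod αc) := by
      refine upperEq.trans_lt (b := topCut X c.base c.base_mem)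
        (stretch_upperEq_of_subset hT hX c _ rfl fun b hb => Cut.mem_of_mem_L hb)
        (upper_of_mem_dom ((stretch_not_isLoop_iff hX hT).2 (Or.inl hαl)) ?_)
      exact (face_mem_stretch_dom hX hT).2 ⟨hcα, hαL.symm⟩
    rcases (hT.cod_mono_le (hαmin β hβX hβl hcβ)).trans hβd with he | hlt
    · refine hup.trans_le (stretch_upperEq_of_subset hT hX _ d he ?_)
      obtain ⟨α', hα'X, hα'l, hα'e, hα'min, hα'L⟩ := exists_least_in hT hX hαX hαl he
      have hle := hα'min α hαX hαl he
      obtain ⟨e, hed, hce⟩ := hT.exists_le_dom_of_upperEq_of_cod_eq hle hα'l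
        (hα'e.trans he.symm) hcα
      -- The least non-loop leaving the base of c and ending at the base of d is also the least one
      -- arriving there: leaving through a lower α' would require an intermediate face strictly
      -- below γ(α), whereas every exit from the base of c has codomain at least γ(α). Hence its
      -- codomain cut has empty L.
      have : α = α' := by
        refine hT.faceGlobular.upperEq_antisymm ?_ hle
        rcases hce with rfl | hce
        · exact hαmin α' hα'X hα'l hed
        · obtain ⟨β', h1, h2, h3, h4⟩ := exists_first_link_of_isConvex hX c.base_mem
            (X.δ_mem (.face α') hα'X _ hed) hce
          have h5 := (hT.cod_mono_le (hαmin β' h1 h2 h3)).trans h4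
          have h6 := upper_of_mem_dom hα'l hed
          rw [hα'e, ← he] at h6
          exact absurd h6 (hT.faceGlobular.not_upper_of_le h5)
      subst this
      change loopsUpTo X (T.cod α) α ⊆ d.L
      rw [he, hα'L]
      exact Set.empty_subset _
    · exact hup.trans (ih _ (upper_of_mem_dom hαl hcα) _ hlt rfl)

theorem stretch_comparable_of_base_eq {c d : Cut T X k} (h : c.base = d.base) :
    c = d ∨ (stretch hT hX).upper c d ∨ (stretch hT hX).upper d c := by
  rcases Cut.L_subset_or hT h with h' | h'
  · exact (stretch_upperEq_of_subset hT hX c d h h').imp_right Or.inl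
  · rcases stretch_upperEq_of_subset hT hX d c h.symm h' with h' | h'
    · exact Or.inl h'.symm
    · exact Or.inr (Or.inr h')

omit hT in
theorem mem_theta_of_mem_stretch_theta (hT : IsOrderedFaceStructure T) {c : Cut T X (k + 1)}
    {d : Cut T X k} (h : Cell.face d ∈ (stretch hT hX).theta c) :
    Cell.face d.base ∈ T.theta c.base := by
  rcases mem_theta.1 h with h | h
  · exact Or.inl ((face_mem_stretch_dom hX hT).1 h).1
  · exact mem_theta.2 (Or.inr (congrArg Cut.base h))

theorem stretch_minus_of_lower {a b : Cut T X (k + 1)} (h : T.lower a.base b.base) :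
    (stretch hT hX).minus a b := by
  obtain ⟨d, hd, hle⟩ := minus_iff.1 (hT.lower_minus _ _ h)
  refine minus_of_le (d := downCut hT hX b.base b.base_mem d hd)
    ((face_mem_stretch_dom hX hT).2 ⟨hd, rfl⟩) ?_
  rcases hle with rfl | hlt
  · refine stretch_upperEq_of_subset hT hX _ _ rfl ?_
    rintro l ⟨hl, hal⟩
    refine ⟨hl, ?_⟩
    rcases compare_emptyLoop hT hX hl b.base_mem (Or.inl hd) with h1 | h1 | h1
    · exact h1
    · exact absurd (hT.lower_trans _ _ _ h h1) hal
    · exfalso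
      rcases compare_emptyLoop hT hX hl a.base_mem (mem_theta.2 (Or.inr rfl)) with h2 | h2 | h2
      · exact hT.not_upperEq_of_lower (hT.lower_trans _ _ _ h2 h) h1
      · exact hal h2
      · rcases hT.comparable_of_upper h2 h1 with h3 | h3 | h3
        · exact hT.not_upperEq_of_lower h (Or.inl h3)
        · exact hT.not_upperEq_of_lower h h3.le
        · exact hT.not_upperEq_of_lower' h h3.le
  · exact (stretch_upper_of_upper hT hX _ _ hlt).le

/-- Disjoint boundaries in [X] may have meeting boundaries in T, so disjointness in T is not
directly available. Where the bases share the face in question, the two cuts over it differ, and an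
empty loop lies between a and b for `<^∼`. -/
theorem lower_of_stretch_minus {a b : Cut T X (k + 1)}
    (hd : (stretch hT hX).theta a ∩ (stretch hT hX).theta b = ∅)
    (h : (stretch hT hX).minus a b) : T.lower a.base b.base := by
  have hdisj : ∀ c : Cut T X k, Cell.face c ∈ (stretch hT hX).theta a →
      Cell.face c ∉ (stretch hT hX).theta b := fun c h1 h2 =>
    (hd ▸ (⟨h1, h2⟩ : _ ∈ (stretch hT hX).theta a ∩ (stretch hT hX).theta b) :
      Cell.face c ∈ (∅ : Set _))
  have hcod : ∀ c : Cut T X (k + 1),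
      Cell.face ((stretch hT hX).cod c) ∈ (stretch hT hX).theta c := fun c => Or.inr rfl
  obtain ⟨d, hdb, hle⟩ := minus_iff.1 h
  have hdb' := (face_mem_stretch_dom hX hT).1 hdb
  have key : T.cod a.base = Cut.base d → T.lower a.base b.base := by
    intro he
    rcases hle with hle | hle
    · exact absurd (Or.inl (hle ▸ hdb)) (hdisj _ (hcod a))
    rcases upper_of_stretch_upper hX hT hle with h1 | ⟨-, h1⟩
    · exact absurd (he ▸ h1) (hT.upper_irrefl _)
    · rw [stretch_cod_L, hdb'.2, he] at h1
      obtain ⟨l, ⟨hl, hlb⟩, hn⟩ := Set.exists_of_ssubset h1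
      have : T.lower a.base l := by
        by_contra hal
        exact hn ⟨hl, hal⟩
      exact hT.lower_trans _ _ _ this hlb
  have hle' : T.upperEq (T.cod a.base) (Cut.base d) := by
    rcases hle with hle | hle
    · exact Or.inl (congrArg Cut.base hle)
    · rcases upper_of_stretch_upper hX hT hle with h1 | ⟨h1, -⟩
      · exact h1.le
      · exact Or.inl h1
  have hne : a.base ≠ b.base := by
    intro he
    have : (stretch hT hX).cod a = (stretch hT hX).cod b := by
      refine Cut.ext_of_L hT (show T.cod a.base = T.cod b.base by rw [he]) ?_
      rw [stretch_cod_L, stretch_cod_L, he]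
    exact hdisj _ (hcod a) (this ▸ hcod b)
  have hm : T.minus a.base b.base := minus_of_le hdb'.1 hle'
  rcases hT.lower_or_of_minus hm hne with h1 | (h1 | h1) | ⟨_, h1, h2, _⟩
  · exact h1
  · exact key (hT.eq_of_upperEq_of_mem_dom (hT.isLoop_of_upper_of_minus h1 hm).2 hdb'.1 hle')
  · obtain ⟨h2, h3⟩ := hT.isLoop_of_upper_of_minus' h1 hm
    exact key (h3.symm.trans (h2.eq_cod hdb'.1).symm)
  · exact key (h2.trans (h1.eq_cod hdb'.1).symm)

/-- A cut with non-empty L is the end of the non-loop over the `<^∼`-last loop in L. With L empty,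
the base is a loop but not an empty one, hence filled in X; the least non-loop of X filling it ends
at the bottom cut. -/
theorem stretch_loop_filling (c : Cut T X (k + 1)) (hc : (stretch hT hX).IsLoop c) :
    ∃ α : Cut T X (k + 2), ¬ (stretch hT hX).IsLoop α ∧ (stretch hT hX).cod α = c := by
  have hns := (stretch_isLoop_iff hX hT).1 hc
  unfold IsStretched at hns
  push Not at hns
  obtain ⟨hl, hE⟩ := hns
  rcases c.L.eq_empty_or_nonempty with he | hne
  · have : ∃ α ∈ X.faces (k + 2), ¬ T.IsLoop α ∧ T.cod α = c.base := by
      by_contra hcon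
      exact hE c.base ⟨⟨c.base_mem, hl, hcon⟩, rfl⟩ (.refl _)
    obtain ⟨β, hβX, hβl, hβ⟩ := this
    obtain ⟨α, hαX, hαl, hα, -, hαL⟩ := exists_least_in hT hX hβX hβl hβ
    refine ⟨topCut X α hαX, (stretch_not_isLoop_iff hX hT).2 (Or.inl hαl),
      Cut.ext_of_L hT hα ?_⟩
    rw [he, ← hαL, ← hα]
    rfl
  · obtain ⟨l, hlL, hmax⟩ := (lower_wf_flip hT (k + 1)).has_min c.L hne
    have hlE := Cut.mem_of_mem_L hlL
    refine ⟨topCut X l hlE.1.1, (stretch_not_isLoop_iff hX hT).2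
      (Or.inr ⟨l, ?_, .refl _⟩), Cut.ext_of_L hT hlE.2 ?_⟩
    · change l ∈ X.emptyLoopsOver (T.cod l)
      rw [hlE.2]
      exact hlE
    · change loopsUpTo X (T.cod l) l = c.L
      rw [hlE.2]
      ext b
      constructor
      · rintro ⟨hb, hbl⟩
        by_contra hbc
        exact hbl (c.lower_of_mem l hlL b (Cut.mem_U hb hbc))
      · intro hb
        exact ⟨Cut.mem_of_mem_L hb, hmax b hb⟩

/-- Pencil linearity for an internal face of the stretching, in terms of positions. -/
theorem lower_or_upper_of_position {x y : T.Face (k + 2)} (hx : x ∈ X.faces (k + 2))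
    (hy : y ∈ X.faces (k + 2)) (hxe : T.IsEmptyDomain x) {z : T.Face k} {t t' : T.Face (k + 1)}
    (hz : T.cod (T.cod x) = z) (ht : Cell.face t ∈ T.dom y) (ht' : Cell.face t' ∈ T.dom y)
    (hts : IsStretched X t) (hts' : IsStretched X t') (htz : T.cod t = z)
    (hzt' : Cell.face z ∈ T.dom t') (h1 : loopsUpTo X z t = loopsUpTo X z (T.cod x))
    (h2 : loopsBefore X z t' = loopsUpTo X z (T.cod x)) : T.lower x y ∨ T.upper x y := by
  have hxl := hxe.not_isLoop
  have hsl := hT.faceGlobular.isLoop_cod_of_isEmptyDomain hxe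
  have hzs : Cell.face z ∈ T.theta (T.cod x) := mem_theta.2 (Or.inr hz)
  have hzt : Cell.face z ∈ T.theta t := mem_theta.2 (Or.inr htz)
  have hsX : T.cod x ∈ X.faces (k + 1) := X.γ_mem (.face x) hx
  have htX : t ∈ X.faces (k + 1) := X.δ_mem (.face y) hy _ ht
  have htX' : t' ∈ X.faces (k + 1) := X.δ_mem (.face y) hy _ ht'
  have hns : ∀ b ∈ X.emptyLoopsOver z, ¬ T.upperEq b (T.cod x) := by
    rintro b hb (h | h)
    · exact hb.1.2.2 ⟨x, hx, hxl, h.symm⟩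
    · obtain ⟨d, hd, -⟩ := le_dom_of_upper_cod hT hX hb hx hxl h
      exact hxe.not_mem d hd
  have htt' : t ≠ t' := by
    rintro rfl
    have hl := hT.faceGlobular.isLoop_of_cod_mem (htz ▸ hzt')
    have := loopsBefore_ssubset_loopsUpTo hT hts hl
    rw [htz] at this
    exact this.ne (h2.trans h1.symm)
  have hyl : ¬ T.IsLoop y := fun hl => htt' ((hl.eq_cod ht).trans (hl.eq_cod ht').symm)
  have hxy : x ≠ y := by
    rintro rfl
    exact hxe.not_mem _ ht
  have hdone : (∃ d, Cell.face d ∈ T.dom y ∧ T.upperEq (T.cod x) d) →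
      T.lower x y ∨ T.upper x y := by
    rintro ⟨d, hd, hle⟩
    have hm := minus_of_le hd hle
    rcases hT.lower_or_of_minus hm hxy with h | (h | h) | h
    · exact Or.inl h
    · exact Or.inr h
    · exact absurd (hT.isLoop_of_upper_of_minus' h hm).1 hyl
    · exact absurd h.1 hxl
  by_cases hd : ∃ d, Cell.face d ∈ T.dom y ∧ T.upperEq (T.cod x) d
  · exact hdone hd
  push Not at hd
  -- Assume that γ(x) is not below δ(y). The equalities of cuts then place γ(x) strictly between t
  -- and t' for `<^∼`, as every other position would put an empty loop of a stretched face on the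
  -- wrong side.
  have hts1 : T.lower t (T.cod x) := by
    rcases hT.pencil_linearity t (T.cod x) (fun h => hd t ht (Or.inl h.symm)) ⟨z, hzt, hzs⟩ with
      (h | h) | h | h
    · exact h
    · exfalso
      by_cases hl : T.IsLoop t
      · obtain ⟨l, hlE, hlt⟩ := hts.resolve_left (not_not.2 hl)
        rw [htz] at hlE
        have hlu : l ∈ loopsUpTo X z t := ⟨hlE, fun h' => hT.not_upperEq_of_lower' h' hlt⟩
        rw [h1] at hlu
        rcases compare_emptyLoop hT hX hlE hsX hzs with h' | h' | h'
        · exact hT.not_upperEq_of_lower (hT.lower_trans _ _ _ h' h) hlt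
        · exact hlu.2 h'
        · exact hns l hlE h'
      · obtain ⟨d, hd', hle⟩ := minus_iff.1 (hT.lower_minus _ _ h)
        rw [hz, ← htz] at hle
        exact hT.faceGlobular.not_upper_of_le hle (upper_of_mem_dom hl hd')
    · exfalso
      obtain ⟨hl, -⟩ := hT.isLoop_of_upper h hsl
      obtain ⟨l, hlE, hlt⟩ := hts.resolve_left (not_not.2 hl)
      rw [htz] at hlE
      exact hns l hlE (hlt.trans_lt h).le
    · exact absurd h.le (hd t ht)
  have hts2 : T.lower (T.cod x) t' := by
    rcases hT.pencil_linearity (T.cod x) t' (fun h => hd t' ht' (Or.inl h))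
      ⟨z, hzs, Or.inl hzt'⟩ with (h | h) | h | h
    · exact h
    · exfalso
      by_cases hl : T.IsLoop t'
      · obtain ⟨l, hlE, hlt⟩ := hts'.resolve_left (not_not.2 hl)
        rw [← hl.eq_cod hzt'] at hlE
        have hlu : l ∉ loopsBefore X z t' := fun h' => hT.not_upperEq_of_lower h'.2 hlt
        rw [h2] at hlu
        have hsl' : T.lower (T.cod x) l := by
          by_contra hn
          exact hlu ⟨hlE, hn⟩
        exact hT.not_upperEq_of_lower' (hT.lower_trans _ _ _ h hsl') hlt
      · obtain ⟨d, hd', hle⟩ := minus_iff.1 (hT.lower_minus _ _ h)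
        rw [hsl.eq_cod hd', hz] at hle
        exact hT.faceGlobular.not_upper_of_le hle (upper_of_mem_dom hl hzt')
    · exact absurd h.le (hd t' ht')
    · exfalso
      obtain ⟨hl, hc⟩ := hT.isLoop_of_upper h hsl
      obtain ⟨l, hlE, hlt⟩ := hts'.resolve_left (not_not.2 hl)
      rw [hc, hz] at hlE
      exact hns l hlE (hlt.trans_lt h).le
  by_cases hι : z ∈ T.internal y
  · exact hT.pencil_linearity_internal x y hxe (hz ▸ hι)
  -- A non-internal z is incident to γ(y). Since t and t' lie `<⁺`-below γ(y) and γ(x) lies between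
  -- them, the only position left is γ(x) `<⁺`-below γ(y).
  have hzr := hT.mem_theta_cod_of_not_internal ht hzt hι
  have htr := upper_of_mem_dom hyl ht
  have htr' := upper_of_mem_dom hyl ht'
  have hsr : T.upper (T.cod x) (T.cod y) := by
    rcases hT.pencil_linearity (T.cod x) (T.cod y)
      (fun h => hT.not_upperEq_of_lower hts1 (h ▸ htr.le)) ⟨z, hzs, hzr⟩ with (h | h) | h | h
    · exact absurd htr.le (hT.not_upperEq_of_lower (hT.lower_trans _ _ _ hts1 h))
    · exact absurd htr'.le (hT.not_upperEq_of_lower' (hT.lower_trans _ _ _ h hts2))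
    · exact h
    · exact absurd (htr.trans h).le (hT.not_upperEq_of_lower hts1)
  rcases hT.le_dom_or_exists_of_upper_cod hX hsX hy hyl hsr with h | ⟨y', -, hyl', hyy', hye⟩
  · exact hdone h
  right
  rcases hT.comparable_of_cod_eq hxl hyl' hye.symm with rfl | h | h
  · exact hyy'
  · exact h.trans hyy'
  · rcases hT.comparable_of_upper h.le hyy'.le with h | h | h
    · exact absurd h hxy
    · exact h
    · exact absurd hsr (hT.faceGlobular.not_upper_of_le (hT.cod_mono h))

theorem isOrderedFaceStructure_stretch : IsOrderedFaceStructure (stretch hT hX) where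
  nonempty := by
    have key : ∀ k, ∀ a ∈ X.faces k, ∃ a, a ∈ X.faces 0 := by
      intro k
      induction k with
      | zero => exact fun a ha => ⟨a, ha⟩
      | succ k ih => exact fun a ha => ih _ (X.γ_mem (.face a) ha)
    obtain ⟨k, a, ha⟩ := hX.1
    obtain ⟨b, hb⟩ := key k a ha
    exact ⟨topCut X b hb⟩
  globularity_γ := (stretch_faceGlobular hX hT).globularity_γ
  globularity_δ a := (stretch_faceGlobular hX hT).globularity_δ a
  γ_empty := (stretch_faceGlobular hX hT).γ_empty
  δ_empty := (stretch_faceGlobular hX hT).δ_empty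
  local_discreteness := by
    intro k a
    have key : ∀ c d : Cut T X k, Cell.face c ∈ (stretch hT hX).dom a →
        Cell.face d ∈ (stretch hT hX).dom a → ¬ (stretch hT hX).upper c d := by
      intro c d hc hd h
      replace hc := (face_mem_stretch_dom hX hT).1 hc
      replace hd := (face_mem_stretch_dom hX hT).1 hd
      rcases upper_of_stretch_upper hX hT h with h | ⟨h1, h2⟩
      · exact (hT.local_discreteness _ _ _ hc.1 hd.1).1 h
      · rw [hc.2, hd.2, h1] at h2
        exact h2.ne rfl
    exact fun c d hc hd => ⟨key c d hc hd, key d c hd hc⟩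
  upper_irrefl := stretch_upper_irrefl hX hT
  upper_trans _ _ _ h h' := h.trans h'
  lower_irrefl c := hT.lower_irrefl (Cut.base c)
  lower_trans a b c := hT.lower_trans (Cut.base a) (Cut.base b) (Cut.base c)
  upper_linear := by
    intro c d
    rcases hT.upper_linear (Cut.base c) (Cut.base d) with h | h | h
    · exact stretch_comparable_of_base_eq hT hX h
    · exact Or.inr (Or.inl (stretch_upper_of_upper hT hX _ _ h))
    · exact Or.inr (Or.inr (stretch_upper_of_upper hT hX _ _ h))
  disjointness := by
    have key : ∀ {k} (a b : Cut T X (k + 1)), (stretch hT hX).upper a b →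
        ¬ T.lower a.base b.base ∧ ¬ T.lower b.base a.base := by
      intro k a b h
      have : T.upperEq a.base b.base := by
        rcases upper_of_stretch_upper hX hT h with h | ⟨h, -⟩
        · exact h.le
        · exact Or.inl h
      exact ⟨fun h' => hT.not_upperEq_of_lower h' this,
        fun h' => hT.not_upperEq_of_lower' h' this⟩
    rintro k a b ⟨h | h, h' | h'⟩
    · exact (key _ _ h').1 h
    · exact (key _ _ h').2 h
    · exact (key _ _ h').2 h
    · exact (key _ _ h').1 h
  lower_minus := by
    intro k a b h
    cases k with
    | zero => exact hT.lower_minus _ _ h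
    | succ k => exact stretch_minus_of_lower hT hX h
  lower_iff_minus a b hd := ⟨fun h => stretch_minus_of_lower hT hX h,
    fun h => lower_of_stretch_minus hT hX hd h⟩
  pencil_linearity := by
    rintro k a b hne ⟨c, h1, h2⟩
    by_cases he : Cut.base a = Cut.base b
    · exact Or.inr ((stretch_comparable_of_base_eq hT hX he).resolve_left hne)
    rcases hT.pencil_linearity _ _ he ⟨_, mem_theta_of_mem_stretch_theta hX hT h1,
      mem_theta_of_mem_stretch_theta hX hT h2⟩ with h | h | h
    · exact Or.inl h
    · exact Or.inr (Or.inl (stretch_upper_of_upper hT hX _ _ h))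
    · exact Or.inr (Or.inr (stretch_upper_of_upper hT hX _ _ h))
  pencil_linearity_internal := by
    rintro k (a : Cut T X (k + 2)) (b : Cut T X (k + 2)) ha ⟨c, hc, d, hd, he, hm⟩
    have hc1 := (face_mem_stretch_dom hX hT).1 hc.1
    have hd1 := (face_mem_stretch_dom hX hT).1 hd.1
    have hm1 := (face_mem_stretch_dom hX hT).1 hm
    have he1 : T.cod (Cut.base c) = T.cod (T.cod a.base) := congrArg Cut.base he
    have he2 : loopsUpTo X (T.cod (Cut.base c)) (Cut.base c) =
      loopsUpTo X (T.cod (T.cod a.base)) (T.cod a.base) := congrArg Cut.L he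
    have := lower_or_upper_of_position hT hX a.base_mem b.base_mem
      ((stretch_isEmptyDomain_iff hX hT).1 ha) rfl hc1.1 hd1.1
      ((stretch_not_isLoop_iff hX hT).1 hc.2) ((stretch_not_isLoop_iff hX hT).1 hd.2)
      he1 hm1.1 (he1 ▸ he2) hm1.2.symm
    exact this.imp_right (stretch_upper_of_upper hT hX _ _)
  loop_filling := by
    intro k c hc
    cases k with
    | zero => exact hc.elim
    | succ k => exact stretch_loop_filling hT hX c hc

theorem isMonotoneHom_stretchMap : IsMonotoneHom (stretch hT hX) T (stretchMap hT hX) where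
  map_cod _ := rfl
  map_dom := by
    intro k (c : Cut T X (k + 1))
    refine ⟨?_, ?_, ?_⟩
    · intro d hd
      cases d with
      | face d => exact ((face_mem_stretch_dom hX hT).1 hd).1
      | empty d =>
        obtain ⟨h1, rfl⟩ := (empty_mem_stretch_dom hX hT).1 hd
        change _ ∈ T.dom c.base
        rw [hT.faceGlobular.dom_eq_of_isEmptyDomain h1]
        rfl
    · intro d hd e he hde
      cases d with
      | face d =>
        cases e with
        | face e =>
          have h1 := (face_mem_stretch_dom hX hT).1 hd
          have h2 := (face_mem_stretch_dom hX hT).1 he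
          have h3 : Cut.base d = Cut.base e := Cell.face.inj hde
          refine congrArg _ (Cut.ext_of_L hT h3 ?_)
          rw [h1.2, h2.2, h3]
        | empty e => cases hde
      | empty d =>
        cases e with
        | face e => cases hde
        | empty e =>
          rw [((empty_mem_stretch_dom hX hT).1 hd).2, ((empty_mem_stretch_dom hX hT).1 he).2]
    · intro d hd
      cases d with
      | face d => exact ⟨.face (downCut hT hX c.base c.base_mem d hd),
          (face_mem_stretch_dom hX hT).2 ⟨hd, rfl⟩, rfl⟩
      | empty d =>
        have h1 := isEmptyDomain_of_mem hd
        refine ⟨.empty ((stretch hT hX).cod ((stretch hT hX).cod c)),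
          (empty_mem_stretch_dom hX hT).2 ⟨⟨d, h1⟩, rfl⟩, ?_⟩
        exact congrArg Cell.empty (hT.faceGlobular.dom_cod_of_dom_eq_empty h1).1
  map_lower _ _ h := h

theorem range_stretchMap (k : ℕ) : Set.range (stretchMap hT hX k) = X.faces k := by
  ext x
  constructor
  · rintro ⟨c, rfl⟩
    exact Cut.base_mem c
  · exact fun hx => ⟨topCut X x hx, rfl⟩

theorem emptyLoops_eq_empty_iff : (∀ k, X.emptyLoops k = ∅) ↔
    ∀ k, Function.Injective (stretchMap hT hX k) := by
  constructor
  · intro h k c d hcd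
    have hE : ∀ c : Cut T X k, c.L = ∅ := fun c =>
      Set.eq_empty_of_forall_notMem fun b hb => by
        have := (Cut.mem_of_mem_L hb).1
        rw [h] at this
        exact this
    exact Cut.ext_of_L hT hcd ((hE c).trans (hE d).symm)
  · intro h k
    refine Set.eq_empty_of_forall_notMem fun b hb => ?_
    cases k with
    | zero => exact hb.2.1
    | succ k =>
      have hX' : T.cod b ∈ X.faces k := X.γ_mem (.face b) hb.1
      let c : Cut T X k := ⟨T.cod b, hX', ∅, X.emptyLoopsOver (T.cod b), Set.empty_union _,
        fun _ h => h.elim⟩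
      have := h k (a₁ := c) (a₂ := topCut X _ hX') rfl
      have hbE : b ∈ X.emptyLoopsOver (T.cod b) := ⟨hb, rfl⟩
      have hL : (∅ : Set _) = X.emptyLoopsOver (T.cod b) := congrArg Cut.L this
      rw [← hL] at hbE
      exact hbE

end Lift

/-! ### Monotone morphisms and their fibres -/

theorem Cell.map_comp {F : ℕ → Type u} {G : ℕ → Type v} {H : ℕ → Type w} (g : ∀ k, G k → H k)
    (f : ∀ k, F k → G k) {k : ℕ} (c : Cell F k) :
    Cell.map (fun k a => g k (f k a)) c = Cell.map g (Cell.map f c) := by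
  cases c <;> rfl

theorem Cell.map_eq_self {F : ℕ → Type u} {f : ∀ k, F k → F k} (h : ∀ k a, f k a = a) {k : ℕ}
    (c : Cell F k) : Cell.map f c = c := by
  cases c <;> simp [Cell.map, h]

theorem IsMonotoneHom.comp {S : OrderedHypergraph.{u}} {T : OrderedHypergraph.{v}}
    {R : OrderedHypergraph.{w}} {g : ∀ k, T.Face k → R.Face k} {f : ∀ k, S.Face k → T.Face k}
    (hg : IsMonotoneHom T R g) (hf : IsMonotoneHom S T f) :
    IsMonotoneHom S R (fun k a => g k (f k a)) where
  map_cod a := by rw [hf.map_cod, hg.map_cod]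
  map_dom a := by
    have := (hg.map_dom (f _ a)).comp (hf.map_dom a)
    exact this.congr fun c _ => (Cell.map_comp g f c).symm
  map_lower a b h := hg.map_lower _ _ (hf.map_lower _ _ h)

theorem isMonotoneIso_of_bijective {S : OrderedHypergraph.{u}} {T : OrderedHypergraph.{v}}
    {f : ∀ k, S.Face k → T.Face k} (hf : IsMonotoneHom S T f)
    (hb : ∀ k, Function.Bijective (f k))
    (hl : ∀ {k : ℕ} (a b : S.Face k), T.lower (f k a) (f k b) → S.lower a b) :
    IsMonotoneIso S T f := by
  choose g hgf hfg using fun k => Function.bijective_iff_has_inverse.1 (hb k)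
  refine ⟨hf, g, ⟨⟨?_, ?_⟩, ?_⟩, hgf, hfg⟩
  · intro k b
    rw [← hgf k (S.cod _), hf.map_cod, hfg]
  · intro k b
    have h := hf.map_dom (g _ b)
    rw [hfg] at h
    refine Set.BijOn.symm ⟨fun c _ => ?_, fun c _ => ?_⟩ h
    · rw [← Cell.map_comp]
      exact Cell.map_eq_self hfg c
    · rw [← Cell.map_comp]
      exact Cell.map_eq_self hgf c
  · intro k a b h
    apply hl
    rw [hfg, hfg]
    exact h

namespace IsMonotoneHom

variable {S : OrderedHypergraph.{v}} {T : OrderedHypergraph.{u}}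
  {f : ∀ k, S.Face k → T.Face k} (hf : IsMonotoneHom S T f) {k : ℕ}
include hf

theorem mem_dom {a : S.Face (k + 1)} {t : S.Face k} (ht : Cell.face t ∈ S.dom a) :
    Cell.face (f k t) ∈ T.dom (f _ a) := (hf.map_dom a).mapsTo ht

theorem exists_mem_dom {a : S.Face (k + 1)} {t : T.Face k} (ht : Cell.face t ∈ T.dom (f _ a)) :
    ∃ s, Cell.face s ∈ S.dom a ∧ f k s = t := by
  obtain ⟨c, hc, he⟩ := (hf.map_dom a).surjOn ht
  cases c with
  | face s => exact ⟨s, hc, Cell.face.inj he⟩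
  | empty s => cases he

theorem eq_of_map_eq {a : S.Face (k + 1)} {s t : S.Face k} (hs : Cell.face s ∈ S.dom a)
    (ht : Cell.face t ∈ S.dom a) (h : f k s = f k t) : s = t :=
  Cell.face.inj ((hf.map_dom a).injOn hs ht (congrArg Cell.face h))

theorem upperEq_of_upper {a b : S.Face k} (h : S.upper a b) : T.upperEq (f k a) (f k b) := by
  induction h with
  | single h =>
    obtain ⟨α, -, ha, rfl⟩ := h
    rw [hf.map_cod]
    exact upperEq_of_mem_dom (hf.mem_dom ha)
  | tail _ h ih =>
    obtain ⟨α, -, ha, rfl⟩ := h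
    rw [hf.map_cod]
    exact ih.trans (upperEq_of_mem_dom (hf.mem_dom ha))

theorem map_upperEq {a b : S.Face k} (h : S.upperEq a b) : T.upperEq (f k a) (f k b) := by
  rcases h with rfl | h
  · exact .refl _
  · exact hf.upperEq_of_upper h

/-- The domain of a face that is mapped to a loop is a single face. -/
theorem dom_of_isLoop_map {a : S.Face (k + 1)} (ha : T.IsLoop (f _ a)) :
    ∃ s, S.dom a = {.face s} ∧ f k s = f k (S.cod a) := by
  have h := ha.cod_mem
  obtain ⟨s, hs, he⟩ := hf.exists_mem_dom h
  refine ⟨s, dom_eq_singleton_of_forall hs fun t ht => hf.eq_of_map_eq ht hs ?_, ?_⟩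
  · rw [ha.eq_cod (hf.mem_dom ht), he]
  · rw [he, hf.map_cod]

variable (hS : IsOrderedFaceStructure S) (hT : IsOrderedFaceStructure T)
include hS hT

/-- Faces with comparable images are comparable. -/
theorem comparable_of_map_upperEq {a b : S.Face k} (h : T.upperEq (f k a) (f k b)) :
    a = b ∨ S.upper a b ∨ S.upper b a := by
  induction k with
  | zero => exact hS.upper_linear a b
  | succ k ih =>
    have hc := hT.cod_mono_le h
    rw [← hf.map_cod, ← hf.map_cod] at hc
    -- The codomains are comparable by induction on the dimension. The alternatives with `<^∼` then
    -- drop out, because f preserves `<^∼`, which is disjoint from `<⁺` in T.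
    have : a = b ∨ (S.lower a b ∨ S.lower b a) ∨ (S.upper a b ∨ S.upper b a) := by
      rcases ih hc with h1 | h1 | h1
      · exact hS.comparable_of_cod_le (Or.inl h1)
      · exact hS.comparable_of_cod_le h1.le
      · rcases hS.comparable_of_cod_le h1.le with h2 | h2 | h2
        · exact Or.inl h2.symm
        · exact Or.inr (Or.inl h2.symm)
        · exact Or.inr (Or.inr h2.symm)
    rcases this with h1 | (h1 | h1) | h1
    · exact Or.inl h1
    · exact absurd h (hT.not_upperEq_of_lower (hf.map_lower _ _ h1))
    · exact absurd h (hT.not_upperEq_of_lower' (hf.map_lower _ _ h1))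
    · exact Or.inr h1

theorem upper_of_map_upper {a b : S.Face k} (h : T.upper (f k a) (f k b)) : S.upper a b := by
  rcases hf.comparable_of_map_upperEq hS hT h.le with rfl | h1 | h1
  · exact absurd h (hT.upper_irrefl _)
  · exact h1
  · exact absurd h (hT.faceGlobular.not_upper_of_le (hf.upperEq_of_upper h1))

theorem lower_of_map_lower {a b : S.Face k} (h : T.lower (f k a) (f k b)) : S.lower a b := by
  cases k with
  | zero => exact (hT.lower_minus _ _ h).elim
  | succ k =>
    obtain ⟨d, hd, hle⟩ := minus_iff.1 (hT.lower_minus _ _ h)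
    have hc := hle.trans (upperEq_of_mem_dom hd)
    rw [← hf.map_cod, ← hf.map_cod] at hc
    have : a = b ∨ (S.lower a b ∨ S.lower b a) ∨ (S.upper a b ∨ S.upper b a) := by
      rcases hf.comparable_of_map_upperEq hS hT hc with h1 | h1 | h1
      · exact hS.comparable_of_cod_le (Or.inl h1)
      · exact hS.comparable_of_cod_le h1.le
      · rcases hS.comparable_of_cod_le h1.le with h2 | h2 | h2
        · exact Or.inl h2.symm
        · exact Or.inr (Or.inl h2.symm)
        · exact Or.inr (Or.inr h2.symm)
    rcases this with rfl | (h1 | h1) | h1 | h1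
    · exact absurd h (hT.lower_irrefl _)
    · exact h1
    · exact absurd h (hT.lower_asymm (hf.map_lower _ _ h1))
    · exact absurd (hf.upperEq_of_upper h1) (hT.not_upperEq_of_lower h)
    · exact absurd (hf.upperEq_of_upper h1) (hT.not_upperEq_of_lower' h)

/-- Faces with the same image are parallel. -/
theorem parallel_of_map_eq {a b : S.Face (k + 1)} (h : f _ a = f _ b) :
    S.cod a = S.cod b ∧ ∀ c, Cell.face c ∈ S.dom a ↔ Cell.face c ∈ S.dom b := by
  have key : ∀ a b : S.Face (k + 1), S.upper a b → f _ a = f _ b →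
      S.cod a = S.cod b ∧ ∀ c, Cell.face c ∈ S.dom a ↔ Cell.face c ∈ S.dom b := by
    intro a
    induction a using (hS.faceGlobular.upper_wf_flip (k + 1)).induction with
    | _ a ih =>
      intro b hlt h
      obtain ⟨Φ, hΦ, haΦ, hle⟩ := exists_first_link hlt
      -- A non-loop image would put f(a) strictly below f(γ(Φ)), which is at most f(b) = f(a).
      -- Bijectivity on domains then makes a the only face of δ(Φ), so γ(Φ) is parallel to a.
      have hl : T.IsLoop (f _ Φ) := by
        by_contra hl
        have h1 := upper_of_mem_dom hl (hf.mem_dom haΦ)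
        rw [← hf.map_cod, h] at h1
        exact hT.faceGlobular.not_upper_of_le (hf.map_upperEq hle) h1
      obtain ⟨s, hs, he⟩ := hf.dom_of_isLoop_map hl
      rw [hs] at haΦ
      cases haΦ
      have haΦ : Cell.face a ∈ S.dom Φ := by
        rw [hs]
        rfl
      have honly : ∀ p, Cell.face p ∈ S.dom Φ → p = a := by
        intro p hp
        rw [hs] at hp
        cases hp
        rfl
      have h1 : S.cod a = S.cod (S.cod Φ) := by
        obtain ⟨p, hp, hpc⟩ := hS.faceGlobular.exists_cod_eq haΦ
        rw [← hpc, honly p hp]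
      have h2 : ∀ c, Cell.face c ∈ S.dom a ↔ Cell.face c ∈ S.dom (S.cod Φ) := by
        intro c
        constructor
        · intro hc
          refine hS.faceGlobular.mem_dom_cod haΦ hc fun p hp hpl hpc => hpl ?_
          rw [honly p hp] at hpc ⊢
          exact hS.faceGlobular.isLoop_of_cod_mem (hpc ▸ hc)
        · intro hc
          obtain ⟨p, hp, hcp⟩ := hS.faceGlobular.exists_mem_dom_of_mem_dom_cod haΦ hc
          exact honly p hp ▸ hcp
      rcases hle with rfl | hle
      · exact ⟨h1, h2⟩
      · obtain ⟨h3, h4⟩ := ih _ (upper_of_mem_dom hΦ haΦ) b hle (he ▸ h)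
        exact ⟨h1.trans h3, fun c => (h2 c).trans (h4 c)⟩
  rcases hf.comparable_of_map_upperEq hS hT (Or.inl h) with rfl | h1 | h1
  · exact ⟨rfl, fun _ => Iff.rfl⟩
  · exact key a b h1 h
  · obtain ⟨h2, h3⟩ := key b a h1 h.symm
    exact ⟨h2.symm, fun c => (h3 c).symm⟩

omit hS in
/-- The image of a monotone morphism. -/
def image : Subhypergraph T.toHypergraph where
  faces k := Set.range (f k)
  γ_mem := by
    intro k a ha
    cases a with
    | face a =>
      obtain ⟨s, rfl⟩ := ha
      exact ⟨S.cod s, hf.map_cod s⟩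
    | empty a =>
      rw [hT.γ_empty]
      exact ha
  δ_mem := by
    intro k a ha c hc
    cases a with
    | face a =>
      obtain ⟨s, rfl⟩ := ha
      obtain ⟨d, -, rfl⟩ := (hf.map_dom s).surjOn hc
      cases d with
      | face d => exact ⟨d, rfl⟩
      | empty d => exact ⟨d, rfl⟩
    | empty a =>
      rw [hT.δ_empty] at hc
      cases hc
      exact ha

/-! ### A monotone morphism identifies its source with the stretching of its image -/

variable {X : Subhypergraph T.toHypergraph} (hr : ∀ k, Set.range (f k) = X.faces k)
include hr

/-- The order `<⁺` is reflected by f, and each link of a chain in the source is mapped to a link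
inside the image or collapses to an equality. -/
theorem isConvex_of_range_eq : X.IsConvex := by
  refine ⟨?_, ?_⟩
  · obtain ⟨a⟩ := hS.nonempty
    exact ⟨0, f 0 a, hr 0 ▸ ⟨a, rfl⟩⟩
  · intro k a ha b hb
    constructor
    · exact fun h => Relation.TransGen.mono (fun _ _ ⟨α, _, h⟩ => ⟨α, h⟩) _ _ h
    · intro h
      rw [← hr] at ha hb
      obtain ⟨a, rfl⟩ := ha
      obtain ⟨b, rfl⟩ := hb
      have key : ∀ a b : S.Face k, S.upper a b →
          f k a = f k b ∨ T.upperIn X.faces (f k a) (f k b) := by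
        have link : ∀ a b : S.Face k, (∃ α : S.Face (k + 1), ¬ S.IsLoop α ∧
            Cell.face a ∈ S.dom α ∧ S.cod α = b) →
            f k a = f k b ∨ T.upperIn X.faces (f k a) (f k b) := by
          rintro a b ⟨α, -, ha, rfl⟩
          by_cases hl : T.IsLoop (f _ α)
          · left
            rw [hf.map_cod]
            exact hl.eq_cod (hf.mem_dom ha)
          · exact Or.inr (Relation.TransGen.single ⟨f _ α, hr _ ▸ ⟨α, rfl⟩, hl, hf.mem_dom ha,
              (hf.map_cod α).symm⟩)
        intro a b h
        induction h with
        | single h => exact link _ _ h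
        | tail _ h ih =>
          rcases ih with h1 | h1 <;> rcases link _ _ h with h2 | h2
          · exact Or.inl (h1.trans h2)
          · exact Or.inr (h1 ▸ h2)
          · exact Or.inr (h2 ▸ h1)
          · exact Or.inr (Relation.TransGen.trans h1 h2)
      rcases key a b (hf.upper_of_map_upper hS hT h) with h1 | h1
      · exact absurd (h1 ▸ h) (hT.upper_irrefl _)
      · exact h1

omit hT in
-- A loop l would be filled by some α. If f(α) is not a loop, it fills f(l) inside X; if it is one,
-- δ(α) is a single smaller loop with the same image, and the argument repeats.
theorem nonloop_of_map_mem_emptyLoops (l : S.Face (k + 1))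
    (hl : f _ l ∈ X.emptyLoops (k + 1)) : ¬ S.IsLoop l := by
  induction l using (hS.faceGlobular.upper_wf (k + 1)).induction with
  | _ l ih =>
    intro hll
    obtain ⟨α, hα, rfl⟩ := hS.loop_filling l hll
    by_cases hfα : T.IsLoop (f _ α)
    · obtain ⟨s, hs, he⟩ := hf.dom_of_isLoop_map hfα
      have hsα : Cell.face s ∈ S.dom α := by
        rw [hs]
        rfl
      have hlt := upper_of_mem_dom hα hsα
      exact ih s hlt (he ▸ hl) (hS.isLoop_of_upper hlt hll).1
    · exact hl.2.2 ⟨f _ α, hr _ ▸ ⟨α, rfl⟩, hfα, (hf.map_cod α).symm⟩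

section Fibre

variable {x : T.Face k} {l : S.Face (k + 1)} (hl : f _ l ∈ X.emptyLoopsOver x)
include hl

omit hS hT hr in
theorem map_cod_of_mem_emptyLoopsOver : f _ (S.cod l) = x := by
  rw [hf.map_cod]
  exact hl.2

omit hS hT hr in
theorem exists_dom_of_mem_emptyLoopsOver : ∃ s, Cell.face s ∈ S.dom l ∧ f _ s = x := by
  obtain ⟨s, hs, he⟩ := hf.dom_of_isLoop_map hl.1.2.1
  refine ⟨s, by rw [hs]; rfl, ?_⟩
  rw [he, hf.map_cod]
  exact hl.2

theorem map_eq_of_upper {m : S.Face (k + 1)} (h : S.upper m l) : f _ m = f _ l := by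
  rcases hf.upperEq_of_upper h with h1 | h1
  · exact h1
  · exact absurd h1 (not_upper_emptyLoop (hf.isConvex_of_range_eq hS hT hr)
      (hr _ ▸ ⟨m, rfl⟩) hl)

/-- A face over an empty loop joins neighbours of the fibre chain. A non-loop leaving s is
comparable with l, and a face strictly below l has the same image as l, hence the same codomain. -/
theorem le_or_cod_le {s t : S.Face k} (hs : Cell.face s ∈ S.dom l) (ht : f _ t = x) :
    S.upperEq t s ∨ S.upperEq (S.cod l) t := by
  have hsx : f _ s = x := by
    obtain ⟨s', hs', hx⟩ := hf.exists_dom_of_mem_emptyLoopsOver hl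
    obtain ⟨r, hr', -⟩ := hf.dom_of_isLoop_map hl.1.2.1
    rw [hr'] at hs hs'
    cases hs
    cases hs'
    exact hx
  rcases hf.comparable_of_map_upperEq hS hT (Or.inl (ht.trans hsx.symm)) with h | h | h
  · exact Or.inl (Or.inl h)
  · exact Or.inl h.le
  right
  obtain ⟨β, hβ, hsβ, hle⟩ := exists_first_link h
  have hll := hf.nonloop_of_map_mem_emptyLoops hS hr l hl.1
  rcases hS.comparable_of_mem_dom hll hβ hs hsβ with rfl | h1 | h1
  · exact hle
  · exact (hS.cod_mono h1).trans hle
  · rw [← (hf.parallel_of_map_eq hS hT (hf.map_eq_of_upper hS hT hr hl h1)).1]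
    exact hle

end Fibre

/-- The least non-loop β leaving s is mapped to a loop. Were it filled by a non-loop f(A), then γ(A)
would be parallel to β, and a non-loop p of δ(A) leaving s would satisfy β ≤⁺ p although f(p) lies
strictly below f(β). -/
theorem exists_emptyLoop_of_upper {s t : S.Face k} (h : S.upper s t) (he : f _ s = f _ t) :
    ∃ l, Cell.face s ∈ S.dom l ∧ ¬ S.IsLoop l ∧ f _ l ∈ X.emptyLoopsOver (f _ s) ∧
      S.upperEq (S.cod l) t := by
  obtain ⟨β₀, hβ₀, hsβ₀, hle₀⟩ := exists_first_link h
  obtain ⟨β, ⟨hβ, hsβ⟩, hmin⟩ := (hS.faceGlobular.upper_wf (k + 1)).has_min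
    {β | ¬ S.IsLoop β ∧ Cell.face s ∈ S.dom β} ⟨β₀, hβ₀, hsβ₀⟩
  have hmin' : ∀ p, ¬ S.IsLoop p → Cell.face s ∈ S.dom p → S.upperEq β p := by
    intro p hp hsp
    rcases hS.comparable_of_mem_dom hβ hp hsβ hsp with h1 | h1 | h1
    · exact Or.inl h1
    · exact h1.le
    · exact absurd h1 (hmin p ⟨hp, hsp⟩)
  have hle := (hS.cod_mono_le (hmin' β₀ hβ₀ hsβ₀)).trans hle₀
  have hlt := upper_of_mem_dom hβ hsβ
  have hx : f _ (S.cod β) = f _ s :=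
    hT.faceGlobular.upperEq_antisymm (he ▸ hf.map_upperEq hle) (hf.upperEq_of_upper hlt)
  have hfβ : T.IsLoop (f _ β) := by
    by_contra hl
    have h1 := upper_of_mem_dom hl (hf.mem_dom hsβ)
    rw [← hf.map_cod, hx] at h1
    exact hT.upper_irrefl _ h1
  refine ⟨β, hsβ, hβ, ⟨⟨hr _ ▸ ⟨β, rfl⟩, hfβ, ?_⟩, by rw [← hf.map_cod, hx]⟩, hle⟩
  rintro ⟨A, hAX, hA, hAβ⟩
  rw [← hr] at hAX
  obtain ⟨A, rfl⟩ := hAX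
  rw [← hf.map_cod] at hAβ
  obtain ⟨h1, h2⟩ := hf.parallel_of_map_eq hS hT hAβ
  have h3 : ¬ S.IsLoop (S.cod A) := fun h3 =>
    hβ (hS.faceGlobular.isLoop_of_cod_mem ((h2 _).1 (h1 ▸ h3.cod_mem)))
  obtain ⟨p, hp, hpl, hsp⟩ := hS.faceGlobular.exists_nonloop_mem_dom h3 ((h2 s).2 hsβ)
  have h4 := upper_of_mem_dom hA (hf.mem_dom hp)
  rw [← hf.map_cod, hAβ] at h4
  exact hT.faceGlobular.not_upper_of_le (hf.map_upperEq (hmin' p hpl hsp)) h4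

/-- The cut given by a face in the fibre of a monotone morphism. -/
def lift (s : S.Face k) : Cut T X k where
  base := f k s
  base_mem := hr k ▸ ⟨s, rfl⟩
  L := {b | b ∈ X.emptyLoopsOver (f k s) ∧ ∃ l, f _ l = b ∧ S.upperEq (S.cod l) s}
  U := {b | b ∈ X.emptyLoopsOver (f k s) ∧ ¬ ∃ l, f _ l = b ∧ S.upperEq (S.cod l) s}
  union_eq := by
    ext b
    constructor
    · rintro (h | h) <;> exact h.1
    · intro hb
      by_cases h : ∃ l, f _ l = b ∧ S.upperEq (S.cod l) s
      · exact Or.inl ⟨hb, h⟩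
      · exact Or.inr ⟨hb, h⟩
  lower_of_mem := by
    rintro _ ⟨hl, l, rfl, hle⟩ b ⟨hm, hn⟩
    obtain ⟨m, rfl⟩ : b ∈ Set.range (f (k + 1)) := hr _ ▸ hm.1.1
    have hml := hf.nonloop_of_map_mem_emptyLoops hS hr m hm.1
    obtain ⟨r, hrm, -⟩ := hf.exists_dom_of_mem_emptyLoopsOver hm
    have hsr := (hf.le_or_cod_le hS hT hr hm hrm rfl).resolve_right
      fun h => hn ⟨m, rfl, h⟩
    have hne : f _ l ≠ f _ m := fun he => hn ⟨l, he, hle⟩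
    refine hf.map_lower _ _ (hS.lower_of_minus (minus_of_le hrm (hle.trans hsr)) (Or.inr hml) ?_ ?_)
    · exact fun h => hne (hf.map_eq_of_upper hS hT hr hm h)
    · exact fun h => hne (hf.map_eq_of_upper hS hT hr hl h).symm

/-- Any preimage of the loop may be tested, since faces with the same image are parallel. -/
theorem mem_lift_L {s : S.Face k} {l : S.Face (k + 1)} (hl : f _ l ∈ X.emptyLoopsOver (f k s)) :
    f _ l ∈ (hf.lift hS hT hr s).L ↔ S.upperEq (S.cod l) s := by
  constructor
  · rintro ⟨-, m, hm, hle⟩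
    rw [← (hf.parallel_of_map_eq hS hT hm).1]
    exact hle
  · exact fun h => ⟨hl, l, rfl, h⟩

theorem lift_L_eq {s : S.Face k} {A : Set (T.Face (k + 1))}
    (hA : A ⊆ X.emptyLoopsOver (f k s))
    (h : ∀ l : S.Face (k + 1), f _ l ∈ X.emptyLoopsOver (f k s) →
      (S.upperEq (S.cod l) s ↔ f _ l ∈ A)) : (hf.lift hS hT hr s).L = A := by
  ext b
  by_cases hb : b ∈ X.emptyLoopsOver (f k s)
  · obtain ⟨l, rfl⟩ : b ∈ Set.range (f (k + 1)) := hr _ ▸ hb.1.1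
    rw [hf.mem_lift_L hS hT hr hb, h l hb]
  · exact ⟨fun h' => absurd h'.1 hb, fun h' => absurd (hA h') hb⟩

/-- For l over an empty loop, γ(l) is at most γ(a) exactly when f(a) is not `<^∼`-before f(l):
otherwise γ(a) is at most the face in δ(l), which gives a `<⁻` l and hence a `<^∼` l. -/
theorem lift_cod (hX : X.IsConvex) (a : S.Face (k + 1)) :
    hf.lift hS hT hr (S.cod a) = (stretch hT hX).cod (hf.lift hS hT hr a) := by
  refine Cut.ext_of_L hT (hf.map_cod a) ?_
  rw [stretch_cod_L]
  refine hf.lift_L_eq hS hT hr (fun b hb => hf.map_cod a ▸ hb.1) fun l hl => ?_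
  have hll := hf.nonloop_of_map_mem_emptyLoops hS hr l hl.1
  obtain ⟨r, hrl, -⟩ := hf.exists_dom_of_mem_emptyLoopsOver hl
  have hlt := upper_of_mem_dom hll hrl
  have hmem : f _ l ∈ loopsUpTo X (T.cod (f _ a)) (f _ a) ↔ ¬ T.lower (f _ a) (f _ l) :=
    ⟨fun h => h.2, fun h => ⟨hf.map_cod a ▸ hl, h⟩⟩
  refine Iff.trans ?_ hmem.symm
  constructor
  · intro hle h
    rcases hS.comparable_of_cod_le hle with rfl | (h1 | h1) | h1 | h1
    · exact hT.lower_irrefl _ h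
    · exact hT.lower_asymm h (hf.map_lower _ _ h1)
    · obtain ⟨d, hd, hle'⟩ := minus_iff.1 (hS.lower_minus _ _ h1)
      exact hS.faceGlobular.not_upper_of_le (hle.trans hle') (upper_of_mem_dom hll hd)
    · exact hT.not_upperEq_of_lower' h (hf.upperEq_of_upper h1)
    · exact hT.not_upperEq_of_lower h (hf.upperEq_of_upper h1)
  · intro hn
    refine (hf.le_or_cod_le hS hT hr hl hrl rfl).resolve_left fun hle => hn ?_
    refine hf.map_lower _ _ (hS.lower_of_minus (minus_of_le hrl hle) (Or.inr hll) ?_ ?_)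
    · intro h
      have := (hf.parallel_of_map_eq hS hT (hf.map_eq_of_upper hS hT hr hl h)).1
      rw [this] at hle
      exact hS.faceGlobular.not_upper_of_le hle hlt
    · intro h
      exact hS.upper_irrefl _ ((hlt.trans_le (hS.cod_mono h)).trans_le hle)

theorem lift_dom_L {a : S.Face (k + 1)} {t : S.Face k} (ht : Cell.face t ∈ S.dom a) :
    (hf.lift hS hT hr t).L = loopsBefore X (f k t) (f _ a) := by
  refine hf.lift_L_eq hS hT hr (fun b hb => hb.1) fun l hl => ?_
  have hll := hf.nonloop_of_map_mem_emptyLoops hS hr l hl.1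
  obtain ⟨r, hrl, -⟩ := hf.exists_dom_of_mem_emptyLoopsOver hl
  have hlt := upper_of_mem_dom hll hrl
  have hmem : f _ l ∈ loopsBefore X (f _ t) (f _ a) ↔ T.lower (f _ l) (f _ a) :=
    ⟨fun h => h.2, fun h => ⟨hl, h⟩⟩
  refine Iff.trans ?_ hmem.symm
  constructor
  · intro hle
    have hm := minus_of_le ht hle
    refine hf.map_lower _ _ (hS.lower_of_minus hm (Or.inl hll) ?_ ?_)
    · exact fun h => hll (hS.isLoop_of_upper_of_minus h hm).1
    · intro h
      obtain ⟨-, h2⟩ := hf.parallel_of_map_eq hS hT (hf.map_eq_of_upper hS hT hr hl h)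
      have h3 := (h2 t).1 ht
      exact hS.faceGlobular.not_upper_of_le hle (upper_of_mem_dom hll h3)
  · intro h
    refine (hf.le_or_cod_le hS hT hr hl hrl rfl).resolve_left fun hle => ?_
    have hcomp : l = a ∨ (S.lower l a ∨ S.lower a l) ∨ (S.upper l a ∨ S.upper a l) := by
      rcases hS.comparable_of_upper (upperEq_of_mem_dom ht) (hle.trans hlt.le) with h1 | h1 | h1
      · exact hS.comparable_of_cod_le (Or.inl h1.symm)
      · rcases hS.comparable_of_cod_le h1.le with h2 | h2 | h2
        · exact Or.inl h2.symm
        · exact Or.inr (Or.inl h2.symm)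
        · exact Or.inr (Or.inr h2.symm)
      · exact hS.comparable_of_cod_le h1.le
    rcases hcomp with rfl | (h1 | h1) | h1 | h1
    · exact hT.lower_irrefl _ h
    · obtain ⟨d, hd, hle'⟩ := minus_iff.1 (hS.lower_minus _ _ h1)
      exact (hS.local_discreteness a _ _ ht hd).1 ((hle.trans_lt hlt).trans_le hle')
    · exact hT.lower_asymm h (hf.map_lower _ _ h1)
    · exact hT.not_upperEq_of_lower h (hf.upperEq_of_upper h1)
    · exact hT.not_upperEq_of_lower' h (hf.upperEq_of_upper h1)

/-- Two members of a fibre are `<⁺`-comparable, and an empty loop crossed on leaving the lower one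
is counted by the upper one only. -/
theorem lift_injective : Function.Injective (hf.lift hS hT hr (k := k)) := by
  have key : ∀ s t : S.Face k, S.upper s t → hf.lift hS hT hr s ≠ hf.lift hS hT hr t := by
    intro s t h he
    have hb : f _ s = f _ t := congrArg Cut.base he
    obtain ⟨l, hsl, hll, hl, hle⟩ := hf.exists_emptyLoop_of_upper hS hT hr h hb
    have h1 := (hf.mem_lift_L hS hT hr (hb ▸ hl)).2 hle
    rw [← he, hf.mem_lift_L hS hT hr hl] at h1
    exact hS.faceGlobular.not_upper_of_le h1 (upper_of_mem_dom hll hsl)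
  intro s t he
  rcases hf.comparable_of_map_upperEq hS hT (Or.inl (congrArg Cut.base he)) with h | h | h
  · exact h
  · exact absurd he (key s t h)
  · exact absurd he.symm (key t s h)

/-- The bottom cut comes from the `<⁺`-least member of the fibre; a cut with non-empty L comes from
γ(l), where f(l) is the `<^∼`-last loop in L. -/
theorem lift_surjective : Function.Surjective (hf.lift hS hT hr (k := k)) := by
  intro c
  rcases c.L.eq_empty_or_nonempty with he | hne
  · obtain ⟨s₀, hs₀⟩ : c.base ∈ Set.range (f k) := hr k ▸ c.base_mem
    obtain ⟨s, hs, hmin⟩ := (hS.faceGlobular.upper_wf k).has_min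
      {s | f k s = c.base} ⟨s₀, hs₀⟩
    have hs : f k s = c.base := hs
    refine ⟨s, Cut.ext_of_L hT hs ?_⟩
    rw [he]
    refine hf.lift_L_eq hS hT hr (Set.empty_subset _) fun l hl => ⟨fun hle => ?_, False.elim⟩
    obtain ⟨r, hrl, hrx⟩ := hf.exists_dom_of_mem_emptyLoopsOver hl
    have hll := hf.nonloop_of_map_mem_emptyLoops hS hr l hl.1
    exact (hmin r (hrx.trans hs) ((upper_of_mem_dom hll hrl).trans_le hle)).elim
  · obtain ⟨b, hb, hmax⟩ := (lower_wf_flip hT k).has_min c.L hne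
    have hbE := Cut.mem_of_mem_L hb
    obtain ⟨l, rfl⟩ : b ∈ Set.range (f (k + 1)) := hr _ ▸ hbE.1.1
    have hc := hf.map_cod_of_mem_emptyLoopsOver hbE
    have hll := hf.nonloop_of_map_mem_emptyLoops hS hr l hbE.1
    obtain ⟨r, hrl, -⟩ := hf.exists_dom_of_mem_emptyLoopsOver hbE
    have hlt := upper_of_mem_dom hll hrl
    refine ⟨S.cod l, Cut.ext_of_L hT hc ?_⟩
    refine hf.lift_L_eq hS hT hr (fun d hd => hc ▸ Cut.mem_of_mem_L hd) fun m hm => ?_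
    have hml := hf.nonloop_of_map_mem_emptyLoops hS hr m hm.1
    obtain ⟨q, hqm, -⟩ := hf.exists_dom_of_mem_emptyLoopsOver hm
    constructor
    · intro hle
      by_contra hmL
      have hlow := c.lower_of_mem _ hb _ (Cut.mem_U (hc ▸ hm) hmL)
      obtain ⟨d, hd, hle'⟩ := minus_iff.1 (hS.lower_minus _ _ (hf.lower_of_map_lower hS hT hlow))
      exact hS.faceGlobular.not_upper_of_le (hle.trans hle') (upper_of_mem_dom hml hd)
    · intro hmL
      refine (hf.le_or_cod_le hS hT hr hm hqm rfl).resolve_left fun hle => ?_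
      refine hmax _ hmL (hf.map_lower _ _ (hS.lower_of_minus (minus_of_le hqm hle)
        (Or.inr hml) ?_ ?_))
      · intro h
        have := (hf.parallel_of_map_eq hS hT (hf.map_eq_of_upper hS hT hr hm h)).1
        rw [this] at hle
        exact hS.faceGlobular.not_upper_of_le hle (upper_of_mem_dom hml hqm)
      · intro h
        have := (hf.parallel_of_map_eq hS hT (hf.map_eq_of_upper hS hT hr hbE h)).1
        rw [← this] at hle
        exact hS.faceGlobular.not_upper_of_le hle (upper_of_mem_dom hml hqm)

theorem isMonotoneIso_lift (hX : X.IsConvex) :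
    IsMonotoneIso S (stretch hT hX) (fun _ => hf.lift hS hT hr) := by
  refine isMonotoneIso_of_bijective ⟨⟨fun a => hf.lift_cod hS hT hr hX a, ?_⟩,
    fun a b h => hf.map_lower a b h⟩
    (fun k => ⟨hf.lift_injective hS hT hr, hf.lift_surjective hS hT hr⟩)
    (fun a b h => hf.lower_of_map_lower hS hT h)
  intro k a
  have hν : ∀ c : Cell S.Face k, Cell.map (stretchMap hT hX)
      (Cell.map (fun _ => hf.lift hS hT hr) c : Cell (stretch hT hX).Face k) = Cell.map f c := by
    intro c
    cases c <;> rfl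
  have hmaps : ∀ c ∈ S.dom a, (Cell.map (fun _ => hf.lift hS hT hr) c :
      Cell (stretch hT hX).Face k) ∈ (stretch hT hX).dom (hf.lift hS hT hr a) := by
    intro c hc
    cases c with
    | face t =>
      exact (face_mem_stretch_dom hX hT).2 ⟨hf.mem_dom hc, hf.lift_dom_L hS hT hr hc⟩
    | empty t =>
      have h1 := isEmptyDomain_of_mem hc
      obtain ⟨h2, -⟩ := hS.faceGlobular.dom_cod_of_dom_eq_empty h1
      refine (empty_mem_stretch_dom hX hT).2 ⟨⟨f _ t, isEmptyDomain_of_mem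
        ((hf.map_dom a).mapsTo hc)⟩, ?_⟩
      subst h2
      exact (hf.lift_cod hS hT hr hX (S.cod a)).trans
        (congrArg (stretch hT hX).cod (hf.lift_cod hS hT hr hX a))
  -- Following the lift by the projection to T gives f. Both f and the projection are bijective on
  -- domains, hence so is the lift.
  have hbij := (isMonotoneHom_stretchMap hT hX).map_dom (hf.lift hS hT hr a)
  refine ⟨hmaps, ?_, ?_⟩
  · intro c hc d hd he
    refine (hf.map_dom a).injOn hc hd ?_
    rw [← hν, ← hν]
    exact congrArg _ he
  · intro d hd
    obtain ⟨c, hc, he⟩ := (hf.map_dom a).surjOn (hbij.mapsTo hd)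
    refine ⟨c, hc, hbij.injOn (hmaps c hc) hd ?_⟩
    exact (hν c).trans he

end IsMonotoneHom

theorem IsMonotoneHom.existsUnique_isMonotoneIso {T : OrderedHypergraph.{u}}
    {S₀ : OrderedHypergraph.{v}} {S₁ : OrderedHypergraph.{w}} (hT : IsOrderedFaceStructure T)
    (hS₀ : IsOrderedFaceStructure S₀) (hS₁ : IsOrderedFaceStructure S₁)
    {f₀ : ∀ k, S₀.Face k → T.Face k} {f₁ : ∀ k, S₁.Face k → T.Face k}
    (hf₀ : IsMonotoneHom S₀ T f₀) (hf₁ : IsMonotoneHom S₁ T f₁)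
    (hr : ∀ k, Set.range (f₀ k) = Set.range (f₁ k)) :
    ∃! g : ∀ k, S₀.Face k → S₁.Face k,
      IsMonotoneIso S₀ S₁ g ∧ ∀ k a, f₁ k (g k a) = f₀ k a := by
  let X := hf₀.image hT
  have hr₀ : ∀ k, Set.range (f₀ k) = X.faces k := fun k => rfl
  have hr₁ : ∀ k, Set.range (f₁ k) = X.faces k := fun k => (hr k).symm
  have hX := hf₀.isConvex_of_range_eq hS₀ hT hr₀
  obtain ⟨h₀, g₀, hg₀, hgl₀, hgr₀⟩ := hf₀.isMonotoneIso_lift hS₀ hT hr₀ hX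
  obtain ⟨h₁, g₁, hg₁, hgl₁, hgr₁⟩ := hf₁.isMonotoneIso_lift hS₁ hT hr₁ hX
  have hb : ∀ k a, f₁ k (g₁ k a) = Cut.base a := fun k a => congrArg Cut.base (hgr₁ k a)
  refine ⟨fun k a => g₁ k (hf₀.lift hS₀ hT hr₀ a), ⟨⟨hg₁.comp h₀, fun k a =>
    g₀ k (hf₁.lift hS₁ hT hr₁ a), hg₀.comp h₁, ?_, ?_⟩, fun k a => hb k _⟩, ?_⟩
  · intro k a
    exact (congrArg (g₀ k) (hgr₁ k _)).trans (hgl₀ k a)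
  · intro k a
    exact (congrArg (g₁ k) (hgr₀ k _)).trans (hgl₁ k a)
  · rintro g ⟨⟨hg, g', hg', hl, hr'⟩, hfg⟩
    funext k a
    -- The cut of a face is defined from f, γ and `<⁺` alone, so an isomorphism over T preserves it.
    -- This determines g.
    have : hf₁.lift hS₁ hT hr₁ (g k a) = hf₀.lift hS₀ hT hr₀ a := by
      refine Cut.ext_of_L hT (hfg k a) ?_
      ext b
      constructor
      · rintro ⟨hb, l, rfl, hle⟩
        refine ⟨hfg k a ▸ hb, g' _ l, by rw [← hfg, hr'], ?_⟩
        have h1 := hg'.map_upperEq hle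
        rw [hl, hg'.map_cod] at h1
        exact h1
      · rintro ⟨hb, l, rfl, hle⟩
        refine ⟨(hfg k a).symm ▸ hb, g _ l, hfg _ l, ?_⟩
        have h1 := hg.map_upperEq hle
        rw [hg.map_cod] at h1
        exact h1
    exact (hgl₁ k _).symm.trans (congrArg (g₁ k) this)

/-! ### Comparison of sizes -/

section Size

variable {T : OrderedHypergraph.{u}} {X : Subhypergraph T.toHypergraph}
  (hT : IsOrderedFaceStructure T) (hX : X.IsConvex)

/-- Empty loops over faces of dimension n have dimension n + 1, and their fillers in T, of dimension
n + 2, all lie in X. So there are none, and the faces of dimension n are those of X. -/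
theorem stretch_size {n : ℕ} (h : ∀ m, n < m → X.faces m = Set.univ) :
    (stretch hT hX).size n = {x : T.Face n | x ∈ X.faces n ∧
      ¬ ∃ α : T.Face (n + 1), ¬ T.IsLoop α ∧ Cell.face x ∈ T.dom α}.ncard := by
  have hE : ∀ (x : T.Face n) b, b ∉ X.emptyLoopsOver x := by
    rintro x b ⟨⟨-, hb, hn⟩, -⟩
    obtain ⟨α, hα, he⟩ := hT.loop_filling b hb
    exact hn ⟨α, h (n + 1 + 1) (by omega) ▸ Set.mem_univ α, hα, he⟩
  have hL : ∀ c : Cut T X n, c.L = ∅ := fun c =>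
    Set.eq_empty_of_forall_notMem fun b hb => hE _ b (Cut.mem_of_mem_L hb)
  have hinj : Function.Injective (Cut.base : Cut T X n → T.Face n) := fun c d hcd =>
    Cut.ext_of_L hT hcd ((hL c).trans (hL d).symm)
  have hiff : ∀ c : Cut T X n,
      (∃ α : Cut T X (n + 1), ¬ (stretch hT hX).IsLoop α ∧
        Cell.face c ∈ (stretch hT hX).dom α) ↔
      ∃ α : T.Face (n + 1), ¬ T.IsLoop α ∧ Cell.face c.base ∈ T.dom α := by
    intro c
    constructor
    · rintro ⟨α, h1, h2⟩
      refine ⟨α.base, ?_, ((face_mem_stretch_dom hX hT).1 h2).1⟩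
      rcases (stretch_not_isLoop_iff hX hT).1 h1 with h3 | ⟨b, hb, -⟩
      · exact h3
      · exact absurd hb (hE _ b)
    · rintro ⟨α, h1, h2⟩
      refine ⟨topCut X α (h (n + 1) (by omega) ▸ Set.mem_univ α),
        (stretch_not_isLoop_iff hX hT).2 (Or.inl h1),
        (face_mem_stretch_dom hX hT).2 ⟨h2, ?_⟩⟩
      rw [hL]
      exact (Set.eq_empty_of_forall_notMem fun b hb => hE _ b hb.1).symm
  refine (Set.ncard_image_of_injective (α := Cut T X n) _ hinj).symm.trans ?_
  congr 1
  ext x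
  constructor
  · rintro ⟨c, hc, rfl⟩
    exact ⟨c.base_mem, fun h' => hc ((hiff c).2 h')⟩
  · rintro ⟨hx, hn⟩
    exact ⟨topCut X x hx, fun h' => hn ((hiff _).1 h'), rfl⟩

theorem stretch_sizeLT (h : ∃ k, X.faces k ≠ Set.univ) :
    SizeLT (stretch hT hX).size T.size := by
  obtain ⟨n, hn⟩ := T.eventually_isEmpty
  have hbdd : BddAbove {k | X.faces k ≠ Set.univ} := by
    refine ⟨n, fun k hk => ?_⟩
    by_contra hlt
    have := hn k (by omega)
    exact hk (Set.eq_univ_of_forall fun x => this.elim x)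
  have hk := Nat.sSup_mem h hbdd
  set k := sSup {k | X.faces k ≠ Set.univ}
  have hgt : ∀ m, k < m → X.faces m = Set.univ := by
    intro m hm
    by_contra hne
    exact absurd (le_csSup hbdd hne) (not_le.2 hm)
  refine ⟨k, ?_, ?_⟩
  · rw [stretch_size hT hX hgt]
    have := T.finite_face k
    refine Set.ncard_lt_ncard ⟨fun x hx => hx.2, fun hsub => hk ?_⟩ (Set.toFinite _)
    refine Set.eq_univ_of_forall fun x => ?_
    -- All faces of dimension k + 1 are in X, which is closed under δ, so a face of dimension k
    -- missing from X lies in no domain. It is counted for T but not for [X].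
    by_cases hx : ∃ α : T.Face (k + 1), ¬ T.IsLoop α ∧ Cell.face x ∈ T.dom α
    · obtain ⟨α, -, hα⟩ := hx
      have hαX : α ∈ X.faces (k + 1) := hgt (k + 1) (by omega) ▸ Set.mem_univ α
      exact X.δ_mem (.face α) hαX _ hα
    · exact (hsub hx).1
  · intro l hl
    rw [stretch_size hT hX fun m hm => hgt m (by omega)]
    simp only [hgt l hl, Set.mem_univ, true_and]
    rfl

end Size

end FaceStructures

open FaceStructures

theorem mainTheorem8 (T : OrderedHypergraph.{u}) (hT : IsOrderedFaceStructure T)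
    (X : Subhypergraph T.toHypergraph) (hX : X.IsConvex) :
    (IsOrderedFaceStructure (stretch hT hX) ∧
      IsMonotoneHom (stretch hT hX) T (stretchMap hT hX) ∧
      ∀ k, Set.range (stretchMap hT hX k) = X.faces k) ∧
    (∀ (S₀ : OrderedHypergraph.{v}) (S₁ : OrderedHypergraph.{w}),
      IsOrderedFaceStructure S₀ → IsOrderedFaceStructure S₁ →
      ∀ (f₀ : ∀ k, S₀.Face k → T.Face k) (f₁ : ∀ k, S₁.Face k → T.Face k),
      IsMonotoneHom S₀ T f₀ → IsMonotoneHom S₁ T f₁ →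
      (∀ k, Set.range (f₀ k) = Set.range (f₁ k)) →
      ∃! g : ∀ k, S₀.Face k → S₁.Face k,
        IsMonotoneIso S₀ S₁ g ∧ ∀ k a, f₁ k (g k a) = f₀ k a) ∧
    ((∀ k, X.emptyLoops k = ∅) ↔ ∀ k, Function.Injective (stretchMap hT hX k)) ∧
    ((∃ k, X.faces k ≠ Set.univ) →
      SizeLT (stretch hT hX).size T.size) :=
  ⟨⟨isOrderedFaceStructure_stretch hT hX, isMonotoneHom_stretchMap hT hX,
    range_stretchMap hT hX⟩,
    fun _ _ hS₀ hS₁ _ _ hf₀ hf₁ hr => hf₀.existsUnique_isMonotoneIso hT hS₀ hS₁ hf₁ hr,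
    emptyLoops_eq_empty_iff hT hX, stretch_sizeLT hT hX⟩
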